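/- Let $G$ be a real finite-dimensional Lie group with Lie subgroups $A,B$ such that $G=AB$ is factorizable, i.e. multiplication $A\times B\to G$ is a diffeomorphism; write $g=g_Ag_B$ for the resulting unique factorization. Then $\mathfrak g=\mathfrak a\oplus\mathfrak b$ and $\mathfrak g^*=\mathfrak b^0\oplus\mathfrak a^0$ (annihilators), with projections $\pi_{\mathfrak b^0},\pi_{\mathfrak a^0}$. Put $\mathrm{Ad}^\sharp_g\sigma=\sigma\circ\mathrm{Ad}_{g^{-1}}$ and $\mathrm{ad}^\sharp_\xi\sigma=-\sigma([\xi,\cdot])$. Identify $T^*G\cong G\times\mathfrak g^*$ by left trivialization, with the canonical symplectic form $\omega=d(\sigma(\lambda))=\langle d\sigma\wedge\lambda\rangle+\sigma(d\lambda)$, $\lambda$ being the left Maurer–Cartan form. The group $A\times B$ acts on $G\times\mathfrak g^*$ by $(a,b)\cdot(g,\sigma)=(agb^{-1},\mathrm{Ad}^\sharp_b\sigma)$, with momentum map $$J(g,\sigma)=\bigl(\pi_{\mathfrak b^0}(\mathrm{Ad}^\sharp_g\sigma),\,\pi_{\mathfrak a^0}(\sigma)\bigr)\in\mathfrak b^0\times\mathfrak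 a^0 .$$ (With respect to $\sigma(\lambda)$, the second component is the momentum of the right action $g\mapsto gb$; its sign does not affect what follows.) The group $A$ acts on $\mathfrak b^0$ by $a\cdot\alpha=\pi_{\mathfrak b^0}(\mathrm{Ad}^\sharp_a\alpha)$ and $B$ acts on $\mathfrak a^0$ by $b\cdot\beta=\pi_{\mathfrak a^0}(\mathrm{Ad}^\sharp_b\beta)$. For $\mu\in\mathfrak b^0$, $\nu\in\mathfrak a^0$ let $A_\mu,B_\nu$ be the stabilizers and $\mathcal O^A_\mu,\mathcal O^B_\nu$ the orbits, with the manifold structures for which the orbit maps $A\to\mathcal O^A_\mu$, $B\to\mathcal O^B_\nu$ are smooth submersions (they are then immersed submanifolds of $\mathfrak g^*$). Let $\omega_\mu,\omega_\nu$ be the Kirillov–Kostant symplectic forms, $$\omega_\mu|_\alpha\bigl(\pi_{\mathfrak b^0}(\mathrm{ad}^\sharp_{\xi}\alpha),\pi_{\mathfrak b^0}(\mathrm{ad}^\sharp_{\xi'}\alpha)\bigr)=\alpha([\xi,\xi'])\quad(\xi,\xi'\in\mathfrak a),\qquad \omega_\nu|_\beta\bigl(\pi_{\mathfrak a^0}(\mathrm{ad}^\sharp_{\zeta}\beta),\pi_{\mathfrak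 a^0}(\mathrm{ad}^\sharp_{\zeta'}\beta)\bigr)=\beta([\zeta,\zeta'])\quad(\zeta,\zeta'\in\mathfrak b),$$ and put $\omega_{\mu\nu}=\omega_\mu-\omega_\nu$ on $\mathcal O^A_\mu\times\mathcal O^B_\nu$. Let $\Lambda_{\mu\nu}=J^{-1}(\mu,\nu)$, with inclusion $i_{\mu\nu}:\Lambda_{\mu\nu}\hookrightarrow G\times\mathfrak g^*$, and define $$M_{\mu\nu}:\Lambda_{\mu\nu}\to\mathcal O^A_\mu\times\mathcal O^B_\nu,\qquad M_{\mu\nu}(g,\sigma)=\bigl(\pi_{\mathfrak b^0}(\mathrm{Ad}^\sharp_{g_A^{-1}}\mu),\,\pi_{\mathfrak a^0}(\mathrm{Ad}^\sharp_{g_B}\nu)\bigr).$$ Then: 1. $M_{\mu\nu}(g,\sigma)=\bigl(\pi_{\mathfrak b^0}(\mathrm{Ad}^\sharp_{g_B}\sigma),\pi_{\mathfrak a^0}(\mathrm{Ad}^\sharp_{g_B}\sigma)\bigr)$ for all $(g,\sigma)\in\Lambda_{\mu\nu}$. 2. $\Lambda_{\mu\nu}$ is an embedded submanifold of $G\times\mathfrak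 g^*$, the orbits carry the manifold structures and symplectic forms described above, $M_{\mu\nu}$ is smooth, and $$i_{\mu\nu}^*\omega=M_{\mu\nu}^*\,\omega_{\mu\nu}.$$ 3. The Marsden–Weinstein reduced space $\Lambda_{\mu\nu}/(A_\mu\times B_\nu)$ carries a manifold structure for which the projection $q$ from $\Lambda_{\mu\nu}$ is a smooth submersion, and a symplectic form $\omega_{\mathrm{red}}$ with $q^*\omega_{\mathrm{red}}=i_{\mu\nu}^*\omega$; and $M_{\mu\nu}$ induces a symplectomorphism from $\bigl(\Lambda_{\mu\nu}/(A_\mu\times B_\nu),\omega_{\mathrm{red}}\bigr)$ onto $\bigl(\mathcal O^A_\mu\times\mathcal O^B_\nu,\omega_{\mu\nu}\bigr)$. -/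

import Mathlib

open scoped Manifold ContDiff Topology

noncomputable section

/-! ### Manifold structures, immersions, submersions, differential forms -/

/-- A smooth manifold structure (without boundary, finite-dimensional, Hausdorff, second countable)
on a bare type `X`. -/
structure SmoothStructure (X : Type*) where
  dim : ℕ
  [top : TopologicalSpace X]
  [charts : ChartedSpace (EuclideanSpace ℝ (Fin dim)) X]
  isManifold : IsManifold (𝓡 dim) ∞ X
  t2 : T2Space X
  secondCountable : SecondCountableTopology X

namespace SmoothStructure

variable {X : Type*} (s : SmoothStructure X)

/-- The type `X` endowed with the manifold structure `s` (and with no other structure). -/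
def Carrier (_s : SmoothStructure X) : Type _ := X

/-- The identity map from `X` to `X` with the structure `s`. -/
def equip (x : X) : s.Carrier := x

/-- The identity map from `X` with the structure `s` to `X`. -/
def out (x : s.Carrier) : X := x

instance : TopologicalSpace s.Carrier := s.top

instance : ChartedSpace (EuclideanSpace ℝ (Fin s.dim)) s.Carrier := s.charts

instance : IsManifold (𝓡 s.dim) ∞ s.Carrier := s.isManifold

instance : T2Space s.Carrier := s.t2

instance : SecondCountableTopology s.Carrier := s.secondCountable

end SmoothStructure

section Forms

variable {E₁ H₁ E₂ H₂ M N : Type*}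
  [NormedAddCommGroup E₁] [NormedSpace ℝ E₁] [TopologicalSpace H₁]
  [NormedAddCommGroup E₂] [NormedSpace ℝ E₂] [TopologicalSpace H₂]
  (I : ModelWithCorners ℝ E₁ H₁) (J : ModelWithCorners ℝ E₂ H₂)
  [TopologicalSpace M] [ChartedSpace H₁ M] [TopologicalSpace N] [ChartedSpace H₂ N]

/-- Smooth immersion between finite-dimensional manifolds. -/
def IsSmoothImmersion (f : M → N) : Prop :=
  ContMDiff I J ∞ f ∧ ∀ x, Function.Injective (mfderiv I J f x)

/-- Smooth submersion between finite-dimensional manifolds. -/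
def IsSmoothSubmersion (f : M → N) : Prop :=
  ContMDiff I J ∞ f ∧ ∀ x, Function.Surjective (mfderiv I J f x)

/-- (Not necessarily smooth) differential forms of degree `k` on `M`. -/
abbrev DiffForm (M : Type*) [TopologicalSpace M] [ChartedSpace H₁ M] (k : ℕ) : Type _ :=
  ∀ p : M, TangentSpace I p [⋀^Fin k]→L[ℝ] ℝ

/-- The pullback `f^* Ω`. -/
def pullbackForm (f : M → N) {k : ℕ} (Ω : DiffForm J N k) : DiffForm I M k :=
  fun p => (Ω (f p)).compContinuousLinearMap (mfderiv I J f p)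

/-- The form `Ω` read in the preferred chart at `p`: its pullback under the inverse chart. -/
def formInChart {k : ℕ} (Ω : DiffForm I M k) (p : M) (x : E₁) : E₁ [⋀^Fin k]→L[ℝ] ℝ :=
  pullbackForm 𝓘(ℝ, E₁) I (extChartAt I p).symm Ω x

/-- The form `Ω` is smooth. -/
def IsSmoothForm {k : ℕ} (Ω : DiffForm I M k) : Prop :=
  ∀ p : M, ContDiffAt ℝ ∞ (formInChart I Ω p) (extChartAt I p p)

/-- The exterior derivative of a form on a manifold without boundary, computed at each point `p` in
the preferred chart at `p`. -/
def extDerivForm {k : ℕ} (Ω : DiffForm I M k) : DiffForm I M (k + 1) :=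
  fun p => (extDeriv (formInChart I Ω p) (extChartAt I p p)).compContinuousLinearMap
    (mfderiv I 𝓘(ℝ, E₁) (extChartAt I p) p)

/-- The 2-form `Ω` is symplectic: smooth, closed and nondegenerate. -/
def IsSymplecticForm (Ω : DiffForm I M 2) : Prop :=
  IsSmoothForm I Ω ∧ extDerivForm I Ω = 0 ∧
    ∀ (p : M) (u : TangentSpace I p), (∀ v : TangentSpace I p, Ω p ![u, v] = 0) → u = 0

/-- The form `pr₁^* Ω₁ - pr₂^* Ω₂` on the product of two manifolds. -/
def productDiffForm {k : ℕ} (Ω₁ : DiffForm I M k) (Ω₂ : DiffForm J N k) :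
    DiffForm (I.prod J) (M × N) k :=
  pullbackForm (I.prod J) I Prod.fst Ω₁ - pullbackForm (I.prod J) J Prod.snd Ω₂

end Forms

/-! ### The cotangent bundle of a Lie group in the left trivialization -/

section LieGroup

variable {E : Type*} [NormedAddCommGroup E] [NormedSpace ℝ E]
  {G : Type*} [TopologicalSpace G] [ChartedSpace E G] [Group G]

variable (E) in
/-- The dual of the Lie algebra `T₁ G` of a Lie group modelled on `E`; the vector space `T₁ G` is by
definition a copy of `E`. -/
abbrev LieDual : Type _ := E →L[ℝ] ℝ

variable (G) in
/-- The bracket of the Lie algebra `T₁ G` of `G`. -/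
def lieBr (ξ ζ : GroupLieAlgebra 𝓘(ℝ, E) G) : GroupLieAlgebra 𝓘(ℝ, E) G := ⁅ξ, ζ⁆

/-- The adjoint action `Ad_g`, the derivative at `1` of `x ↦ g x g⁻¹`. -/
def adGroup (g : G) : E →L[ℝ] E :=
  mfderiv 𝓘(ℝ, E) 𝓘(ℝ, E) (fun x : G => g * x * g⁻¹) 1

/-- The coadjoint action `Ad^♯_g σ = σ ∘ Ad_{g⁻¹}`. -/
def coAd (g : G) (σ : LieDual E) : LieDual E := σ.comp (adGroup g⁻¹)

/-- The left Maurer-Cartan form `λ_g : T_g G → T₁ G`, the derivative at `g` of `x ↦ g⁻¹ x`. -/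
def maurerCartan (g : G) : TangentSpace 𝓘(ℝ, E) g →L[ℝ] E :=
  mfderiv 𝓘(ℝ, E) 𝓘(ℝ, E) (fun x : G => g⁻¹ * x) g

variable (E G) in
/-- The model of `T^* G = G × 𝔤^*`. -/
abbrev cotangentModel : ModelWithCorners ℝ (E × LieDual E) (ModelProd E (LieDual E)) :=
  𝓘(ℝ, E).prod 𝓘(ℝ, LieDual E)

variable (E G) in
/-- The canonical 1-form `σ(λ)` of `T^* G = G × 𝔤^*` (left trivialization). -/
def canonicalOneForm : DiffForm (cotangentModel E) (G × LieDual E) 1 :=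
  fun p => ContinuousAlternatingMap.ofSubsingleton ℝ _ ℝ (0 : Fin 1)
    ((p.2.comp (maurerCartan p.1)).comp
      (mfderiv (cotangentModel E) 𝓘(ℝ, E) (Prod.fst : G × LieDual E → G) p))

variable (E G) in
/-- The canonical symplectic form `d(σ(λ)) = ⟨dσ ∧ λ⟩ + σ(dλ)` of `T^* G = G × 𝔤^*`. -/
def canonicalForm : DiffForm (cotangentModel E) (G × LieDual E) 2 :=
  extDerivForm (cotangentModel E) (canonicalOneForm E G)

end LieGroup

/-! ### Factorizable Lie groups -/

section Factorization

variable {E EA EB : Type*}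
  [NormedAddCommGroup E] [NormedSpace ℝ E]
  [NormedAddCommGroup EA] [NormedSpace ℝ EA]
  [NormedAddCommGroup EB] [NormedSpace ℝ EB]
  {G : Type*} [TopologicalSpace G] [ChartedSpace E G] [Group G]

/-- The derivative at `1` of the inclusion of a Lie subgroup `K` of `G`. -/
def inclDeriv (K : Subgroup G) [ChartedSpace EA K] : EA →L[ℝ] E :=
  mfderiv 𝓘(ℝ, EA) 𝓘(ℝ, E) (Subtype.val : K → G) 1

variable (E EA) in
/-- The Lie algebra of a Lie subgroup `K`, as a subspace of the Lie algebra of `G`. -/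
def lieOfSubgroup (K : Subgroup G) [ChartedSpace EA K] : Submodule ℝ E :=
  LinearMap.range (inclDeriv (E := E) (EA := EA) K).toLinearMap

variable (A B : Subgroup G) [ChartedSpace EA A] [ChartedSpace EB B]

variable (E EA EB) in
/-- The Lie group `G` factorizes as `G = AB`: every `g` is uniquely a product `g_A g_B` with factors
depending smoothly on `g`, that is, multiplication is a diffeomorphism `A × B → G`. -/
structure Factorization where
  equiv : (A × B) ≃ₘ^∞⟮𝓘(ℝ, EA).prod 𝓘(ℝ, EB), 𝓘(ℝ, E)⟯ G
  equiv_apply : ∀ (a : A) (b : B), equiv (a, b) = (a : G) * (b : G)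

variable {A B} in
/-- `𝔤 = 𝔞 ⊕ 𝔟`. -/
theorem Factorization.isCompl (F : Factorization E EA EB A B) :
    IsCompl (lieOfSubgroup E EA A) (lieOfSubgroup E EB B) := by
  have hne : (∞ : WithTop ℕ∞) ≠ 0 := by simp
  let L := F.equiv.mfderivToContinuousLinearEquiv hne ((1 : A), (1 : B))
  have hL : ∀ (u : EA) (v : EB), (L (u, v) : E) =
      inclDeriv (E := E) (EA := EA) A u + inclDeriv (E := E) (EA := EB) B v := by
    intro u v
    have h := mfderiv_prod_eq_add_apply (v := (u, v))
      (F.equiv.contMDiff.mdifferentiable hne ((1 : A), (1 : B)))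
    have hA : (fun z : A => F.equiv (z, (1 : B))) = Subtype.val := by
      funext z; simp [F.equiv_apply]
    have hB : (fun z : B => F.equiv ((1 : A), z)) = Subtype.val := by
      funext z; simp [F.equiv_apply]
    have hA' : (mfderiv 𝓘(ℝ, EA) 𝓘(ℝ, E) (fun z : A => F.equiv (z, (1 : B))) 1 : EA →L[ℝ] E)
        = inclDeriv (E := E) (EA := EA) A := by rw [hA]; rfl
    have hB' : (mfderiv 𝓘(ℝ, EB) 𝓘(ℝ, E) (fun z : B => F.equiv ((1 : A), z)) 1 : EB →L[ℝ] E)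
        = inclDeriv (E := E) (EA := EB) B := by rw [hB]; rfl
    rw [← hA', ← hB']
    exact h
  constructor
  · rw [Submodule.disjoint_def]
    rintro x ⟨u, hu⟩ ⟨v, hv⟩
    have hu' : inclDeriv (E := E) (EA := EA) A u = x := hu
    have hv' : inclDeriv (E := E) (EA := EB) B v = x := hv
    have h0 : (L (u, -v) : E) = 0 := by
      rw [hL u (-v), map_neg, hu', hv', add_neg_cancel]
      rfl
    have h1 : ((u, -v) : EA × EB) = 0 := (map_eq_zero_iff L L.injective).1 h0
    have h2 : u = 0 := congrArg Prod.fst h1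
    rw [← hu', h2, map_zero]
  · rw [codisjoint_iff, Submodule.eq_top_iff']
    intro x
    obtain ⟨⟨u, v⟩, h⟩ := L.surjective x
    rw [Submodule.mem_sup]
    exact ⟨_, ⟨u, rfl⟩, _, ⟨v, rfl⟩, (hL u v).symm.trans h⟩

end Factorization

/-! ### Coadjoint orbits of the factors -/

section Orbits

variable {E EK : Type*} [NormedAddCommGroup E] [NormedSpace ℝ E]
  [NormedAddCommGroup EK] [NormedSpace ℝ EK]
  {G : Type*} [TopologicalSpace G] [ChartedSpace E G] [Group G]

/-- For a projection `P` of `𝔤` onto the Lie algebra `𝔨` of a factor along that of the other factor,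
`σ ↦ σ ∘ P` is the projection of `𝔤^*` onto the annihilator of the other Lie algebra along the
annihilator of `𝔨`; this is the map `g · σ = (Ad^♯_g σ) ∘ P`. -/
def projCoAd (P : E →L[ℝ] E) (g : G) (σ : LieDual E) : LieDual E := (coAd g σ).comp P

/-- The orbit `{k · μ : k ∈ K}`. -/
def projOrbit (P : E →L[ℝ] E) (K : Subgroup G) (μ : LieDual E) : Set (LieDual E) :=
  Set.range fun k : K => projCoAd P (k : G) μ

variable {P : E →L[ℝ] E} {K : Subgroup G} {μ : LieDual E}

/-- The inclusion of the orbit in `𝔤^*`. -/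
def orbitIncl (s : SmoothStructure (projOrbit P K μ)) (p : s.Carrier) : LieDual E := (s.out p).1

variable [ChartedSpace EK K]

variable (EK) in
/-- `s` is the manifold structure of the orbit: the one for which `k ↦ k · μ` is a smooth submersion
of `K` onto the orbit; the orbit is then an immersed submanifold of `𝔤^*`. -/
def IsOrbitStructure (s : SmoothStructure (projOrbit P K μ)) : Prop :=
  IsSmoothSubmersion 𝓘(ℝ, EK) (𝓡 s.dim)
    (fun k : K => s.equip ⟨projCoAd P (k : G) μ, k, rfl⟩) ∧
  IsSmoothImmersion (𝓡 s.dim) 𝓘(ℝ, LieDual E) (orbitIncl s)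

/-- The vector `u`, tangent to the orbit at `p`, equals `(ad^♯_ξ p) ∘ P` as an element of `𝔤^*`,
where `ad^♯_ξ p = - p([ξ, ·])`. -/
def IsGeneratedBy (s : SmoothStructure (projOrbit P K μ)) (p : s.Carrier)
    (u : TangentSpace (𝓡 s.dim) p) (ξ : E) : Prop :=
  ∀ x : E, NormedSpace.fromTangentSpace (orbitIncl s p)
      (mfderiv (𝓡 s.dim) 𝓘(ℝ, LieDual E) (orbitIncl s) p u) x =
    -(orbitIncl s p (lieBr G ξ (P x)))

variable (EK) in
/-- `Ω` is the Kirillov-Kostant form of the orbit: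
`Ω_p((ad^♯_ξ p) ∘ P, (ad^♯_ζ p) ∘ P) = p([ξ, ζ])` for `ξ, ζ ∈ 𝔨`. -/
def IsKirillovKostant (s : SmoothStructure (projOrbit P K μ))
    (Ω : DiffForm (𝓡 s.dim) s.Carrier 2) : Prop :=
  ∀ (p : s.Carrier) (u v : TangentSpace (𝓡 s.dim) p) (ξ ζ : E),
    ξ ∈ lieOfSubgroup E EK K → ζ ∈ lieOfSubgroup E EK K →
    IsGeneratedBy s p u ξ → IsGeneratedBy s p v ζ → Ω p ![u, v] = orbitIncl s p (lieBr G ξ ζ)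

end Orbits

/-! ### Reduction of `T^* G` -/

namespace Factorization

variable {E EA EB : Type*}
  [NormedAddCommGroup E] [NormedSpace ℝ E] [FiniteDimensional ℝ E]
  [NormedAddCommGroup EA] [NormedSpace ℝ EA]
  [NormedAddCommGroup EB] [NormedSpace ℝ EB]
  {G : Type*} [TopologicalSpace G] [ChartedSpace E G] [Group G]
  {A B : Subgroup G} [ChartedSpace EA A] [ChartedSpace EB B]
  (F : Factorization E EA EB A B) (μ ν : LieDual E)

/-- The factor `g_A` of `g = g_A g_B`. -/
def left (g : G) : A := (F.equiv.symm g).1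

/-- The factor `g_B` of `g = g_A g_B`. -/
def right (g : G) : B := (F.equiv.symm g).2

/-- The projection of `𝔤` onto `𝔞` along `𝔟`; then `σ ↦ σ ∘ projA` is the projection of `𝔤^*` onto
`𝔟⁰` along `𝔞⁰`. -/
def projA : E →L[ℝ] E :=
  LinearMap.toContinuousLinearMap (Submodule.projection _ _ F.isCompl)

/-- The projection of `𝔤` onto `𝔟` along `𝔞`; then `σ ↦ σ ∘ projB` is the projection of `𝔤^*` onto
`𝔞⁰` along `𝔟⁰`. -/
def projB : E →L[ℝ] E :=
  LinearMap.toContinuousLinearMap (Submodule.projection _ _ F.isCompl.symm)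

/-- The momentum map `J(g, σ) = (π_{𝔟⁰}(Ad^♯_g σ), π_{𝔞⁰}(σ))` of the action
`(a, b) · (g, σ) = (a g b⁻¹, Ad^♯_b σ)` of `A × B` on `T^* G = G × 𝔤^*` (in terms of the canonical
1-form, the second component is the momentum of the right action `(g, b) ↦ g b` of `B`). -/
def momentum (p : G × LieDual E) : LieDual E × LieDual E :=
  ((coAd p.1 p.2).comp F.projA, p.2.comp F.projB)

/-- The level set `Λ_{μν}` of the momentum map. -/
def levelSet : Set (G × LieDual E) := F.momentum ⁻¹' {(μ, ν)}

/-- Two points of `Λ_{μν}` are related if one is carried to the other by an element of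
`A_μ × B_ν` under the lifted action `(a, b) · (g, σ) = (a g b⁻¹, Ad^♯_b σ)`. -/
def reductionRel (p q : F.levelSet μ ν) : Prop :=
  ∃ (a : A) (b : B), projCoAd F.projA (a : G) μ = μ ∧ projCoAd F.projB (b : G) ν = ν ∧
    q.1 = ((a : G) * p.1.1 * (b : G)⁻¹, coAd (b : G) p.1.2)

/-- The Marsden-Weinstein reduced space `Λ_{μν} / (A_μ × B_ν)`. -/
def ReducedSpace : Type _ := Quot (F.reductionRel μ ν)

/-- The map `M_{μν} : Λ_{μν} → O^A_μ × O^B_ν`, `(g, σ) ↦ (g_A⁻¹ · μ, g_B · ν)`. -/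
def toOrbits (p : F.levelSet μ ν) : projOrbit F.projA A μ × projOrbit F.projB B ν :=
  (⟨projCoAd F.projA (((F.left p.1.1)⁻¹ : A) : G) μ, (F.left p.1.1)⁻¹, rfl⟩,
    ⟨projCoAd F.projB (F.right p.1.1 : G) ν, F.right p.1.1, rfl⟩)

/-- The map `M_{μν}` between the manifolds `Λ_{μν}` and `O^A_μ × O^B_ν`. -/
def mapM {F : Factorization E EA EB A B} {μ ν : LieDual E}
    (sL : SmoothStructure (F.levelSet μ ν)) (sA : SmoothStructure (projOrbit F.projA A μ))
    (sB : SmoothStructure (projOrbit F.projB B ν)) (p : sL.Carrier) : sA.Carrier × sB.Carrier :=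
  (sA.equip (F.toOrbits μ ν (sL.out p)).1, sB.equip (F.toOrbits μ ν (sL.out p)).2)

/-- The inclusion `i_{μν}` of `Λ_{μν}` in `T^* G`. -/
def levelIncl {F : Factorization E EA EB A B} {μ ν : LieDual E}
    (sL : SmoothStructure (F.levelSet μ ν)) (p : sL.Carrier) : G × LieDual E := (sL.out p).1

/-- The projection of `Λ_{μν}` onto the reduced space. -/
def quotientMap {F : Factorization E EA EB A B} {μ ν : LieDual E}
    (sL : SmoothStructure (F.levelSet μ ν)) (sR : SmoothStructure (F.ReducedSpace μ ν))
    (p : sL.Carrier) : sR.Carrier := sR.equip (Quot.mk _ (sL.out p))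

end Factorization

end

/-! For $(g,\sigma)$ put $\tau=\mathrm{Ad}^\sharp_{g_B}\sigma$. Then
$\mathrm{Ad}^\sharp_g\sigma=\mathrm{Ad}^\sharp_{g_A}\tau$ and
$\sigma=\mathrm{Ad}^\sharp_{g_B^{-1}}\tau$. Since $\mathrm{Ad}_A$ preserves $\mathfrak a$ and
$\mathrm{Ad}_B$ preserves $\mathfrak b$, the equation $J=(\mu,\nu)$ says exactly that the two
projections of $\tau$ are $g_A^{-1}\cdot\mu$ and $g_B\cdot\nu$ (`coAd_comp_proj_eq_iff`,
`mem_levelSet_iff`). This is the first claim. It also shows that $\Lambda_{\mu\nu}$ is the graph of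
a smooth map $G\to\mathfrak g^*$, hence an embedded copy of $G$. Under the diffeomorphism
$g\mapsto(g_A^{-1},g_B)$ onto $A\times B$, the map $M_{\mu\nu}$ becomes the product of the two orbit
maps.

The identity of forms is checked on primitives. The logarithmic derivative of $g=g_Ag_B$
(`leftMC_eq`) gives $i^*(\sigma(\lambda))=-(g_A^{-1})^*\mu(\lambda)+(g_B)^*\nu(\lambda)$
(`pullbackForm_canonicalOneForm`). By the Maurer-Cartan equation and the $\mathrm{Ad}$-invariance of
the bracket, $-d(\mu(\lambda))$ restricted to a factor is the pullback of its Kirillov-Kostant form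
under the orbit map (`flat_orbitPullback`, `exists_orbit_symplectic`). Applying $d$ gives
$i^*\omega=M^*(\omega_\mu-\omega_\nu)$.

The fibres of $M_{\mu\nu}$ are the classes of `reductionRel`, so $M_{\mu\nu}$ induces a bijection
from the reduced space to the product of orbits. The reduced space receives its manifold structure
and its form through this bijection.

Three general tools carry the rest. Orbits become manifolds through the constant rank theorem
(`exists_coordinates_of_constant_rank`), whose hypothesis comes from equivariance. Local sections
show that a form whose pullback under a surjective submersion has a smooth primitive is itself
smooth and closed (`IsSmoothSubmersion.closed_of_pullback_exact`); this serves both the orbits and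
the reduced space. Finally, the derivative of $\mathrm{Ad}$ at $1$ is the bracket
(`dM_adGroup_one`).

Derivatives and forms are read in the fixed model space (`dM`, `flat`), so that rewriting is not
obstructed by tangent spaces that depend on the base point. -/

noncomputable section

/-! ### Derivatives and forms in terms of the model spaces -/

section Flat

variable {E₁ H₁ E₂ H₂ E₃ H₃ M N Q : Type*}
  [NormedAddCommGroup E₁] [NormedSpace ℝ E₁] [TopologicalSpace H₁]
  [NormedAddCommGroup E₂] [NormedSpace ℝ E₂] [TopologicalSpace H₂]
  [NormedAddCommGroup E₃] [NormedSpace ℝ E₃] [TopologicalSpace H₃]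
  (I : ModelWithCorners ℝ E₁ H₁) (J : ModelWithCorners ℝ E₂ H₂) (K : ModelWithCorners ℝ E₃ H₃)
  [TopologicalSpace M] [ChartedSpace H₁ M] [TopologicalSpace N] [ChartedSpace H₂ N]
  [TopologicalSpace Q] [ChartedSpace H₃ Q]

/-- The derivative of a map between manifolds, as a map between the model vector spaces. -/
def dM (f : M → N) (x : M) : E₁ →L[ℝ] E₂ := mfderiv I J f x

/-- The value of a form at a point, as an alternating map on the model vector space. -/
def flat {k : ℕ} (Ω : DiffForm I M k) (p : M) : E₁ [⋀^Fin k]→L[ℝ] ℝ := Ω p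

variable {I J K}

theorem form_ext {k : ℕ} {Ω Ω' : DiffForm I M k} (h : ∀ p, flat I Ω p = flat I Ω' p) : Ω = Ω' :=
  funext h

theorem dM_comp {g : N → Q} {f : M → N} {x : M} (hg : MDifferentiableAt J K g (f x))
    (hf : MDifferentiableAt I J f x) :
    dM I K (fun y => g (f y)) x = (dM J K g (f x)).comp (dM I J f x) :=
  mfderiv_comp x hg hf

theorem dM_comp_apply {g : N → Q} {f : M → N} {x : M} (hg : MDifferentiableAt J K g (f x))
    (hf : MDifferentiableAt I J f x) (v : E₁) :
    dM I K (fun y => g (f y)) x v = dM J K g (f x) (dM I J f x v) := by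
  rw [dM_comp hg hf]; rfl

theorem dM_congr {f f' : M → N} {x : M} (h : f =ᶠ[𝓝 x] f') : dM I J f x = dM I J f' x :=
  h.mfderiv_eq

theorem dM_id (x : M) : dM I I (fun y : M => y) x = ContinuousLinearMap.id ℝ E₁ :=
  mfderiv_id

theorem dM_const (c : N) (x : M) : dM I J (fun _ : M => c) x = 0 :=
  mfderiv_const

theorem dM_eq_fderiv (f : E₁ → E₂) (x : E₁) : dM 𝓘(ℝ, E₁) 𝓘(ℝ, E₂) f x = fderiv ℝ f x :=
  mfderiv_eq_fderiv

theorem dM_clm_comp (L : E₂ →L[ℝ] E₃) {f : M → E₂} {x : M}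
    (hf : MDifferentiableAt I 𝓘(ℝ, E₂) f x) :
    dM I 𝓘(ℝ, E₃) (fun y => L (f y)) x = L.comp (dM I 𝓘(ℝ, E₂) f x) := by
  rw [dM_comp (J := 𝓘(ℝ, E₂)) (g := L) L.differentiableAt.mdifferentiableAt hf, dM_eq_fderiv,
    L.fderiv]

theorem dM_prodMk {f : M → N} {g : M → Q} {x : M} (hf : MDifferentiableAt I J f x)
    (hg : MDifferentiableAt I K g x) :
    dM I (J.prod K) (fun y => (f y, g y)) x = (dM I J f x).prod (dM I K g x) :=
  mfderiv_prodMk hf hg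

theorem flat_pullbackForm (f : M → N) {k : ℕ} (Ω : DiffForm J N k) (p : M) :
    flat I (pullbackForm I J f Ω) p
      = (flat J Ω (f p)).compContinuousLinearMap (dM I J f p) := rfl

theorem flat_extDerivForm {k : ℕ} (Ω : DiffForm I M k) (p : M) :
    flat I (extDerivForm I Ω) p = (extDeriv (formInChart I Ω p)
      (extChartAt I p p)).compContinuousLinearMap (dM I 𝓘(ℝ, E₁) (extChartAt I p) p) := rfl

theorem formInChart_eq {k : ℕ} (Ω : DiffForm I M k) (p : M) (x : E₁) :
    formInChart I Ω p x = (flat I Ω ((extChartAt I p).symm x)).compContinuousLinearMap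
      (dM 𝓘(ℝ, E₁) I (extChartAt I p).symm x) := rfl

theorem flat_pullbackForm_congr {f f' : M → N} {x : M} (h : f =ᶠ[𝓝 x] f') {k : ℕ}
    (Ω : DiffForm J N k) :
    flat I (pullbackForm I J f Ω) x = flat I (pullbackForm I J f' Ω) x := by
  rw [flat_pullbackForm, flat_pullbackForm, dM_congr h, h.self_of_nhds]

theorem flat_pullbackForm_comp {g : N → Q} {f : M → N} {x : M}
    (hg : MDifferentiableAt J K g (f x)) (hf : MDifferentiableAt I J f x) {k : ℕ}
    (Ω : DiffForm K Q k) :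
    flat I (pullbackForm I K (fun y => g (f y)) Ω) x
      = flat I (pullbackForm I J f (pullbackForm J K g Ω)) x := by
  simp only [flat_pullbackForm, dM_comp hg hf]
  rfl

theorem pullbackForm_comp {g : N → Q} {f : M → N}
    (hg : MDifferentiable J K g) (hf : MDifferentiable I J f) {k : ℕ} (Ω : DiffForm K Q k) :
    pullbackForm I K (fun y => g (f y)) Ω = pullbackForm I J f (pullbackForm J K g Ω) :=
  form_ext fun x => flat_pullbackForm_comp (hg (f x)) (hf x) Ω

theorem pullbackForm_neg (f : M → N) {k : ℕ} (Ω : DiffForm J N k) :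
    pullbackForm I J f (-Ω) = -pullbackForm I J f Ω := rfl

theorem pullbackForm_sub (f : M → N) {k : ℕ} (Ω Ω' : DiffForm J N k) :
    pullbackForm I J f (Ω - Ω') = pullbackForm I J f Ω - pullbackForm I J f Ω' := rfl

/-! ### Naturality of the exterior derivative -/

theorem one_le_infty : (1 : WithTop ℕ∞) ≤ ∞ := by exact_mod_cast (le_top : (1 : ℕ∞) ≤ ⊤)

theorem two_le_infty : (2 : WithTop ℕ∞) ≤ ∞ :=
  WithTop.coe_le_coe.2 (le_top : (2 : ℕ∞) ≤ ⊤)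

theorem writtenInExtChartAt_contDiffAt [I.Boundaryless] {f : M → N} {p : M} {n : WithTop ℕ∞}
    (hf : ContMDiffAt I J n f p) :
    ContDiffAt ℝ n (writtenInExtChartAt I J p f) (extChartAt I p p) := by
  have h := (contMDiffAt_iff.1 hf).2
  rw [I.range_eq_univ, contDiffWithinAt_univ] at h
  exact h

theorem dM_eq_fderiv_writtenInExtChartAt [I.Boundaryless] {f : M → N} {p : M}
    (hf : MDifferentiableAt I J f p) :
    dM I J f p = fderiv ℝ (writtenInExtChartAt I J p f) (extChartAt I p p) := by
  have h : dM I J f p = fderivWithin ℝ (writtenInExtChartAt I J p f) (Set.range I)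
      (extChartAt I p p) := hf.mfderiv
  rw [h, I.range_eq_univ, fderivWithin_univ]

theorem eventually_extChartAt_symm {p : M} {P : M → Prop} (h : ∀ᶠ y in 𝓝 p, P y) :
    ∀ᶠ x in 𝓝 (extChartAt I p p), P ((extChartAt I p).symm x) := by
  have h' : Filter.Tendsto (extChartAt I p).symm (𝓝 (extChartAt I p p)) (𝓝 p) := by
    have := (continuousAt_extChartAt_symm (I := I) p).tendsto
    rwa [extChartAt_to_inv] at this
  exact h'.eventually h

/-- The preferred chart of a vector space is the identity, so reading a form in it changes nothing.
-/
theorem formInChart_vectorSpace {k : ℕ} (Ω : DiffForm 𝓘(ℝ, E₁) E₁ k) (p : E₁) :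
    formInChart 𝓘(ℝ, E₁) Ω p = flat 𝓘(ℝ, E₁) Ω := by
  funext x
  have h : dM 𝓘(ℝ, E₁) 𝓘(ℝ, E₁) (extChartAt 𝓘(ℝ, E₁) p).symm x = ContinuousLinearMap.id ℝ E₁ :=
    dM_id x
  rw [formInChart_eq, h]
  rfl

theorem flat_extDerivForm_vectorSpace {k : ℕ} (Ω : DiffForm 𝓘(ℝ, E₁) E₁ k) (p : E₁) :
    flat 𝓘(ℝ, E₁) (extDerivForm 𝓘(ℝ, E₁) Ω) p = extDeriv (flat 𝓘(ℝ, E₁) Ω) p := by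
  have h : dM 𝓘(ℝ, E₁) 𝓘(ℝ, E₁) (extChartAt 𝓘(ℝ, E₁) p) p = ContinuousLinearMap.id ℝ E₁ :=
    dM_id p
  rw [flat_extDerivForm, formInChart_vectorSpace, h]
  rfl

section Boundaryless

variable [I.Boundaryless] [J.Boundaryless] [IsManifold I ∞ M] [IsManifold J ∞ N]

theorem contMDiffAt_extChartAt_symm_of_mem {p : M} {x : E₁} (hx : x ∈ (extChartAt I p).target) :
    ContMDiffAt 𝓘(ℝ, E₁) I ∞ (extChartAt I p).symm x :=
  (contMDiffOn_extChartAt_symm p).contMDiffAt ((isOpen_extChartAt_target p).mem_nhds hx)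

/-- As long as $f(c^{-1}x)$ stays in the chart $c'$ at $f(p)$, one has $f\circ c^{-1}=c'^{-1}\circ
F$ with $F$ the coordinate expression of $f$; pulling $\Omega$ back along the two factorizations
gives the two sides. This reduces naturality of $d$ to the vector space case. -/
theorem formInChart_pullbackForm {f : M → N} {p : M} (hf : ContMDiffAt I J 1 f p) {k : ℕ}
    (Ω : DiffForm J N k) :
    ∀ᶠ x in 𝓝 (extChartAt I p p), formInChart I (pullbackForm I J f Ω) p x =
      (formInChart J Ω (f p) (writtenInExtChartAt I J p f x)).compContinuousLinearMap
        (fderiv ℝ (writtenInExtChartAt I J p f) x) := by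
  have : IsManifold I 1 M := IsManifold.of_le (n := ∞) (by exact_mod_cast le_top)
  have : IsManifold J 1 N := IsManifold.of_le (n := ∞) (by exact_mod_cast le_top)
  have h1 : ∀ᶠ y in 𝓝 p, ContMDiffAt I J 1 f y :=
    (contMDiffAt_iff_contMDiffAt_nhds (by simp)).1 hf
  have h2 : ∀ᶠ y in 𝓝 p, f y ∈ (extChartAt J (f p)).source :=
    hf.continuousAt.eventually (extChartAt_source_mem_nhds (f p))
  filter_upwards [eventually_extChartAt_symm (I := I) h1,
    (eventually_extChartAt_symm (I := I) h2).eventually_nhds,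
    extChartAt_target_mem_nhds (I := I) p] with x hx1 hx2 hx3
  have hc := (contMDiffAt_extChartAt_symm_of_mem (I := I) hx3).mdifferentiableAt (by simp)
  have hfx := hx1.mdifferentiableAt (by simp)
  have hsrc := hx2.self_of_nhds
  have hF : MDifferentiableAt 𝓘(ℝ, E₁) 𝓘(ℝ, E₂) (writtenInExtChartAt I J p f) x :=
    ((contMDiffAt_extChartAt' (I := J) (n := 1) (by simpa using hsrc)).mdifferentiableAt
      (by simp)).comp x (hfx.comp x hc)
  have ht : writtenInExtChartAt I J p f x ∈ (extChartAt J (f p)).target :=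
    (extChartAt J (f p)).map_source hsrc
  have hc' := (contMDiffAt_extChartAt_symm_of_mem (I := J) ht).mdifferentiableAt (by simp)
  have e1 : formInChart I (pullbackForm I J f Ω) p x =
      flat 𝓘(ℝ, E₁) (pullbackForm 𝓘(ℝ, E₁) J (fun y => f ((extChartAt I p).symm y)) Ω) x :=
    (flat_pullbackForm_comp hfx hc Ω).symm
  have e2 : (fun y => f ((extChartAt I p).symm y)) =ᶠ[𝓝 x]
      fun y => (extChartAt J (f p)).symm (writtenInExtChartAt I J p f y) := by
    filter_upwards [hx2] with y hy
    exact ((extChartAt J (f p)).left_inv hy).symm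
  rw [e1, flat_pullbackForm_congr e2, flat_pullbackForm_comp hc' hF, flat_pullbackForm,
    dM_eq_fderiv]
  rfl

/-- The exterior derivative at a point depends only on the germ, so `formInChart_pullbackForm` and
`extDeriv_pullback` for the coordinate expression apply. The chain rule then removes the charts. -/
theorem flat_extDerivForm_pullbackForm {f : M → N} {p : M} (hf : ContMDiffAt I J 2 f p) {k : ℕ}
    {Ω : DiffForm J N k}
    (hΩ : DifferentiableAt ℝ (formInChart J Ω (f p)) (extChartAt J (f p) (f p))) :
    flat I (extDerivForm I (pullbackForm I J f Ω)) p =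
      flat I (pullbackForm I J f (extDerivForm J Ω)) p := by
  have h1 : ContMDiffAt I J 1 f p := hf.of_le (by norm_num)
  have hF0 : writtenInExtChartAt I J p f (extChartAt I p p) = extChartAt J (f p) (f p) := by
    simp [writtenInExtChartAt]
  have hpull := extDeriv_pullback (f := writtenInExtChartAt I J p f) (x := extChartAt I p p)
    (r := 2) (hF0 ▸ hΩ) (writtenInExtChartAt_contDiffAt hf)
    (by simp)
  -- Both sides are the derivative at `p` of the chart at `f p` composed with `f`.
  have hchain : (fderiv ℝ (writtenInExtChartAt I J p f) (extChartAt I p p)).comp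
      (dM I 𝓘(ℝ, E₁) (extChartAt I p) p) =
      (dM J 𝓘(ℝ, E₂) (extChartAt J (f p)) (f p)).comp (dM I J f p) := by
    have hcp : MDifferentiableAt I 𝓘(ℝ, E₁) (extChartAt I p) p :=
      (contMDiffAt_extChartAt (n := 1)).mdifferentiableAt (by simp)
    have hcf : MDifferentiableAt J 𝓘(ℝ, E₂) (extChartAt J (f p)) (f p) :=
      (contMDiffAt_extChartAt (n := 1)).mdifferentiableAt (by simp)
    rw [← dM_comp hcf (h1.mdifferentiableAt (by simp)), ← dM_eq_fderiv, ← dM_comp _ hcp]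
    · refine dM_congr ?_
      filter_upwards [extChartAt_source_mem_nhds (I := I) p] with y hy
      simp only [writtenInExtChartAt, Function.comp]
      rw [(extChartAt I p).left_inv hy]
    · exact ((writtenInExtChartAt_contDiffAt h1).differentiableAt (by simp)).mdifferentiableAt
  rw [flat_extDerivForm, Filter.EventuallyEq.extDeriv_eq (formInChart_pullbackForm h1 Ω), hpull, hF0,
    flat_pullbackForm, flat_extDerivForm]
  ext v
  have := congrArg (fun L : E₁ →L[ℝ] E₂ => extDeriv (formInChart J Ω (f p))
    (extChartAt J (f p) (f p)) (fun i => L (v i))) hchain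
  exact this

theorem extDerivForm_pullbackForm {f : M → N} (hf : ContMDiff I J ∞ f) {k : ℕ}
    {Ω : DiffForm J N k} (hΩ : IsSmoothForm J Ω) :
    extDerivForm I (pullbackForm I J f Ω) = pullbackForm I J f (extDerivForm J Ω) :=
  form_ext fun p => flat_extDerivForm_pullbackForm ((hf p).of_le two_le_infty)
    ((hΩ (f p)).differentiableAt (by simp))

/-- One-forms are linear functionals, and pullback is then composition of linear maps, which is
jointly smooth. Degree one suffices: smoothness of the two-forms that occur is deduced from
primitives. -/
theorem contDiffAt_comp_one_form {X : Type*} [NormedAddCommGroup X] [NormedSpace ℝ X]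
    {n : WithTop ℕ∞} {x : X} {w : X → E₂ [⋀^Fin 1]→L[ℝ] ℝ} {L : X → E₁ →L[ℝ] E₂}
    (hw : ContDiffAt ℝ n w x) (hL : ContDiffAt ℝ n L x) :
    ContDiffAt ℝ n (fun y => (w y).compContinuousLinearMap (L y)) x := by
  let e₁ := ContinuousAlternatingMap.ofSubsingletonLIE (𝕜 := ℝ) (E := E₁) (F := ℝ) (0 : Fin 1)
  let e₂ := ContinuousAlternatingMap.ofSubsingletonLIE (𝕜 := ℝ) (E := E₂) (F := ℝ) (0 : Fin 1)
  have h : (fun y => (w y).compContinuousLinearMap (L y)) =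
      fun y => e₁ ((e₂.symm (w y)).comp (L y)) := by
    funext y
    ext v
    have hv : v = fun _ => v 0 := by funext i; rw [Subsingleton.elim i 0]
    rw [hv]
    rfl
  rw [h]
  exact e₁.contDiff.contDiffAt.comp x ((e₂.symm.contDiff.contDiffAt.comp x hw).clm_comp hL)

theorem IsSmoothForm.contDiffAt_pullback_one {f : M → N} {p : M} (hf : ContMDiffAt I J ∞ f p)
    {Ω : DiffForm J N 1} (hΩ : IsSmoothForm J Ω) :
    ContDiffAt ℝ ∞ (formInChart I (pullbackForm I J f Ω) p) (extChartAt I p p) := by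
  have hF0 : writtenInExtChartAt I J p f (extChartAt I p p) = extChartAt J (f p) (f p) := by
    simp [writtenInExtChartAt]
  have hF := writtenInExtChartAt_contDiffAt hf
  refine ContDiffAt.congr_of_eventuallyEq ?_ (formInChart_pullbackForm
    (hf.of_le (by exact_mod_cast le_top)) Ω)
  refine contDiffAt_comp_one_form (ContDiffAt.comp _ ?_ hF) (hF.fderiv_right (m := ∞) (by simp))
  rw [hF0]
  exact hΩ (f p)

theorem IsSmoothForm.pullbackForm_one {f : M → N} (hf : ContMDiff I J ∞ f)
    {Ω : DiffForm J N 1} (hΩ : IsSmoothForm J Ω) : IsSmoothForm I (pullbackForm I J f Ω) :=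
  fun p => hΩ.contDiffAt_pullback_one (hf p)

end Boundaryless

/-! ### Linearity of the exterior derivative -/

section Linear

theorem formInChart_add {k : ℕ} (Ω Ω' : DiffForm I M k) (p : M) :
    formInChart I (Ω + Ω') p = formInChart I Ω p + formInChart I Ω' p := rfl

theorem formInChart_neg {k : ℕ} (Ω : DiffForm I M k) (p : M) :
    formInChart I (-Ω) p = -formInChart I Ω p := rfl

theorem IsSmoothForm.neg {k : ℕ} {Ω : DiffForm I M k} (h : IsSmoothForm I Ω) :
    IsSmoothForm I (-Ω) :=
  fun p => (h p).neg

theorem extDerivForm_add {k : ℕ} {Ω Ω' : DiffForm I M k} (h : IsSmoothForm I Ω)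
    (h' : IsSmoothForm I Ω') :
    extDerivForm I (Ω + Ω') = extDerivForm I Ω + extDerivForm I Ω' := by
  refine form_ext fun p => ?_
  rw [flat_extDerivForm, formInChart_add, extDeriv_add ((h p).differentiableAt (by simp))
    ((h' p).differentiableAt (by simp))]
  rfl

theorem extDerivForm_neg {k : ℕ} (Ω : DiffForm I M k) :
    extDerivForm I (-Ω) = -extDerivForm I Ω := by
  refine form_ext fun p => ?_
  have h := extDeriv_smul (x := extChartAt I p p) (-1 : ℝ) (formInChart I Ω p)
  rw [neg_one_smul, neg_one_smul] at h
  rw [flat_extDerivForm, formInChart_neg, h]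
  rfl

end Linear

/-! ### Local sections of submersions and descent of closed forms -/

section Sections

variable [I.Boundaryless] [IsManifold I ∞ M] [FiniteDimensional ℝ E₂]

/-- Choose a linear right inverse $R$ of the derivative $dF$ in coordinates and restrict $F$ to the
affine slice $x_0+R(y-y_0)$. The restriction has derivative the identity at $y_0$, so the inverse
function theorem inverts it. The section is defined on the model space of the target, hence inverts
`f` up to the chart. -/
theorem exists_local_section [IsManifold J ∞ N] {f : M → N} {p : M} (hf' : ContMDiff I J ∞ f)
    (hs : Function.Surjective (dM I J f p)) :
    ∃ s : E₂ → M, (∀ᶠ y in 𝓝 (extChartAt J (f p) (f p)), ContMDiffAt 𝓘(ℝ, E₂) I ∞ s y) ∧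
      s (extChartAt J (f p) (f p)) = p ∧
      ∀ᶠ y in 𝓝 (extChartAt J (f p) (f p)), f (s y) = (extChartAt J (f p)).symm y := by
  have hf := hf' p
  set x₀ := extChartAt I p p with hx₀
  set y₀ := extChartAt J (f p) (f p) with hy₀
  set F := writtenInExtChartAt I J p f with hFdef
  have hF0 : F x₀ = y₀ := by simp [hFdef, hx₀, hy₀, writtenInExtChartAt]
  have hF : ContDiffAt ℝ ∞ F x₀ := writtenInExtChartAt_contDiffAt hf
  rw [dM_eq_fderiv_writtenInExtChartAt (hf.mdifferentiableAt (by simp))] at hs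
  obtain ⟨R', hR'⟩ := (fderiv ℝ F x₀).toLinearMap.exists_rightInverse_of_surjective
    (LinearMap.range_eq_top.2 hs)
  let R : E₂ →L[ℝ] E₁ := LinearMap.toContinuousLinearMap R'
  have hR : ∀ y, fderiv ℝ F x₀ (R y) = y := fun y => LinearMap.congr_fun hR' y
  let j : E₂ → E₁ := fun y => x₀ + R (y - y₀)
  have hj0 : j y₀ = x₀ := by simp [j]
  have hj : ContDiff ℝ ∞ j := contDiff_const.add (R.contDiff.comp (contDiff_id.sub contDiff_const))
  have hjd : HasFDerivAt j R y₀ := by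
    have := R.hasFDerivAt.comp y₀ ((hasFDerivAt_id (𝕜 := ℝ) y₀).sub_const y₀)
    exact this.const_add x₀
  have hh : ContDiffAt ℝ ∞ (F ∘ j) y₀ := ContDiffAt.comp y₀ (hj0.symm ▸ hF) hj.contDiffAt
  have hhd : HasFDerivAt (F ∘ j) ((ContinuousLinearEquiv.refl ℝ E₂ : E₂ ≃L[ℝ] E₂) :
      E₂ →L[ℝ] E₂) y₀ := by
    have hFd : HasFDerivAt F (fderiv ℝ F x₀) (j y₀) := by
      rw [hj0]; exact (hF.differentiableAt (by simp)).hasFDerivAt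
    refine (hFd.comp y₀ hjd).congr_fderiv ?_
    ext y
    exact hR y
  have hh0 : (F ∘ j) y₀ = y₀ := by simp [hj0, hF0]
  let g := hh.localInverse hhd (by simp)
  let e := hh.toOpenPartialHomeomorph (F ∘ j) hhd (by simp)
  have he0 : y₀ ∈ e.target := by
    have := hh.image_mem_toOpenPartialHomeomorph_target hhd (by simp)
    rwa [hh0] at this
  have hg : ContDiffAt ℝ ∞ g y₀ := by
    have := hh.to_localInverse hhd (by simp)
    rwa [hh0] at this
  have hg0 : g y₀ = y₀ := by
    have := hh.localInverse_apply_image hhd (by simp)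
    rwa [hh0] at this
  have hgr : ∀ᶠ y in 𝓝 y₀, F (j (g y)) = y := by
    have := (hh.hasStrictFDerivAt' hhd (by simp)).eventually_right_inverse
    rwa [hh0] at this
  have hjg0 : j (g y₀) = x₀ := by rw [hg0, hj0]
  -- Order `∞` at a single point need not give order `∞` nearby, since the neighbourhood may shrink
  -- with the order. Smoothness of `f` at all points is used instead.
  have hFev : ∀ᶠ x in 𝓝 x₀, ContDiffAt ℝ ∞ F x := by
    filter_upwards [extChartAt_target_mem_nhds (I := I) p, eventually_extChartAt_symm (I := I)
      (hf.continuousAt.eventually_mem (extChartAt_source_mem_nhds (I := J) (f p)))] with x hx hx'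
    exact ((contMDiffAt_extChartAt' (I := J) (by simpa using hx')).comp x
      ((hf' _).comp x (contMDiffAt_extChartAt_symm_of_mem hx))).contDiffAt
  have hFj : ∀ᶠ y in 𝓝 y₀, ContDiffAt ℝ ∞ (F ∘ j) y := by
    have hj1 : Filter.Tendsto j (𝓝 y₀) (𝓝 x₀) := by
      have := hj.continuous.tendsto y₀
      rwa [hj0] at this
    filter_upwards [hj1.eventually hFev] with y hy
    exact hy.comp y hj.contDiffAt
  -- Invertible operators form an open set, so the local inverse is smooth at all points near $y_0$
  -- and not only at $y_0$.
  have hinv : ∀ᶠ y in 𝓝 y₀, fderiv ℝ (F ∘ j) y ∈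
      Set.range ((↑) : (E₂ ≃L[ℝ] E₂) → E₂ →L[ℝ] E₂) := by
    have hc : ContinuousAt (fderiv ℝ (F ∘ j)) y₀ :=
      (hh.fderiv_right (m := 0) (by simp)).continuousAt
    refine hc.eventually_mem ?_
    rw [hhd.fderiv]
    have := FiniteDimensional.complete ℝ E₂
    exact ContinuousLinearEquiv.nhds _
  have hgev : ∀ᶠ y in 𝓝 y₀, ContDiffAt ℝ ∞ g y := by
    have hg1 : Filter.Tendsto g (𝓝 y₀) (𝓝 y₀) := by
      have := hg.continuousAt.tendsto
      rwa [hg0] at this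
    filter_upwards [hg1.eventually hFj, hg1.eventually hinv, e.open_target.mem_nhds he0]
      with y h1 ⟨A, hA⟩ h3
    have := FiniteDimensional.complete ℝ E₂
    exact e.contDiffAt_symm h3 (f₀' := A)
      (by rw [hA]; exact (h1.differentiableAt (by simp)).hasFDerivAt) h1
  have hsev : ∀ᶠ y in 𝓝 y₀,
      ContMDiffAt 𝓘(ℝ, E₂) I ∞ (fun y => (extChartAt I p).symm (j (g y))) y := by
    have hjg : Filter.Tendsto (fun y => j (g y)) (𝓝 y₀) (𝓝 x₀) := by
      have := (hj.continuous.continuousAt.comp hg.continuousAt).tendsto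
      rw [Function.comp_apply, hjg0] at this
      exact this
    filter_upwards [hjg.eventually (extChartAt_target_mem_nhds (I := I) p), hgev] with y h1 h2
    exact (contMDiffAt_extChartAt_symm_of_mem h1).comp y (hj.contDiffAt.comp y h2).contMDiffAt
  have hs1 : ContMDiffAt 𝓘(ℝ, E₂) I ∞ (fun y => (extChartAt I p).symm (j (g y))) y₀ :=
    hsev.self_of_nhds
  have hs0 : (extChartAt I p).symm (j (g y₀)) = p := by rw [hjg0]; exact extChartAt_to_inv p
  refine ⟨fun y => (extChartAt I p).symm (j (g y)), hsev, hs0, ?_⟩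
  have hsrc : ∀ᶠ y in 𝓝 y₀, f ((extChartAt I p).symm (j (g y))) ∈ (extChartAt J (f p)).source := by
    have hc : ContinuousAt (fun y => f ((extChartAt I p).symm (j (g y)))) y₀ :=
      ContinuousAt.comp (f := fun y => (extChartAt I p).symm (j (g y))) (g := f)
        (by rw [hs0]; exact hf.continuousAt) hs1.continuousAt
    refine hc.eventually_mem ?_
    rw [hs0]
    exact extChartAt_source_mem_nhds (f p)
  filter_upwards [hgr, hsrc] with y h1 h2
  rw [← (extChartAt J (f p)).left_inv h2]
  congr 1

/-- With a local section $s$ of $q$, near each point $\Omega=(q\circ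
s)^*\Omega=s^*d\Theta=d(s^*\Theta)$. Thus $\Omega$ has a smooth local primitive, which gives
smoothness and, by $d^2=0$, closedness. -/
theorem IsSmoothSubmersion.closed_of_pullback_exact [J.Boundaryless] [IsManifold J ∞ N]
    {q : M → N} (hq : IsSmoothSubmersion I J q) (hsurj : Function.Surjective q) {Θ : DiffForm I M 1} (hΘ : IsSmoothForm I Θ)
    {Ω : DiffForm J N 2} (h : pullbackForm I J q Ω = extDerivForm I Θ) :
    IsSmoothForm J Ω ∧ extDerivForm J Ω = 0 := by
  have key : ∀ p : N, ∃ η : E₂ → E₂ [⋀^Fin 1]→L[ℝ] ℝ,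
      ContDiffAt ℝ ∞ η (extChartAt J p p) ∧
        formInChart J Ω p =ᶠ[𝓝 (extChartAt J p p)] extDeriv η := by
    intro p
    obtain ⟨m, rfl⟩ := hsurj p
    obtain ⟨s, hs, hsm, hsec⟩ := exists_local_section hq.1 (hq.2 m)
    refine ⟨pullbackForm 𝓘(ℝ, E₂) I s Θ, ?_, ?_⟩
    · have hΘ' := hΘ.contDiffAt_pullback_one hs.self_of_nhds
      rw [formInChart_vectorSpace] at hΘ'
      exact hΘ'
    · filter_upwards [hsec.eventually_nhds, hs] with x hx hx'
      have hx2 := hx'.of_le two_le_infty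
      have e1 : formInChart J Ω (q m) x = flat 𝓘(ℝ, E₂)
          (pullbackForm 𝓘(ℝ, E₂) J (fun y => q (s y)) Ω) x :=
        flat_pullbackForm_congr (hx.mono fun y hy => hy.symm) Ω
      rw [e1, flat_pullbackForm_comp ((hq.1 _).mdifferentiableAt (by simp))
        (hx2.mdifferentiableAt (by simp)), h, ← flat_extDerivForm_pullbackForm hx2
        ((hΘ (s x)).differentiableAt (by simp)), flat_extDerivForm_vectorSpace]
      rfl
  refine ⟨fun p => ?_, form_ext fun p => ?_⟩
  · obtain ⟨η, hη, he⟩ := key p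
    refine ContDiffAt.congr_of_eventuallyEq ?_ he
    -- `extDeriv` is a fixed continuous linear map, alternatization, applied to `fderiv`.
    exact (ContinuousAlternatingMap.alternatizeUncurryFinCLM ℝ E₂ ℝ).contDiff.contDiffAt.comp _
      (hη.fderiv_right (m := ∞) (by simp))
  · obtain ⟨η, hη, he⟩ := key p
    rw [flat_extDerivForm, he.extDeriv_eq, extDeriv_extDeriv_apply hη (by simpa using two_le_infty)]
    rfl

end Sections

end Flat

end

noncomputable section

/-! ### The constant rank theorem -/

section ConstantRank

variable {X V : Type*} [NormedAddCommGroup X] [NormedSpace ℝ X] [FiniteDimensional ℝ X]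
  [NormedAddCommGroup V] [NormedSpace ℝ V] [FiniteDimensional ℝ V]

open Module in
/-- If the rank of the derivative of `F` does not increase near `x₀`, then, near `x₀`, the values of
`F` are determined by finitely many linear coordinates of `F`, which form a submersion. -/
theorem exists_coordinates_of_constant_rank {F : X → V} {x₀ : X} (hF : ContDiffAt ℝ ∞ F x₀)
    (hrank : ∀ᶠ x in 𝓝 x₀, finrank ℝ (fderiv ℝ F x₀).ker ≤ finrank ℝ (fderiv ℝ F x).ker) :
    ∃ (d : ℕ) (π : V →L[ℝ] EuclideanSpace ℝ (Fin d)),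
      Function.Surjective (π.comp (fderiv ℝ F x₀)) ∧
      ∃ N ∈ 𝓝 x₀, ∀ x ∈ N, ∀ y ∈ N, π (F x) = π (F y) → F x = F y := by
  set D := fderiv ℝ F x₀ with hD
  -- `pr` and `κ'` are linear projections onto the range and the kernel of `D`.
  obtain ⟨pr, hpr⟩ := D.range.subtype.exists_leftInverse_of_injective (Submodule.ker_subtype _)
  obtain ⟨κ', hκ'⟩ := D.ker.subtype.exists_leftInverse_of_injective (Submodule.ker_subtype _)
  let e : D.range ≃L[ℝ] EuclideanSpace ℝ (Fin (finrank ℝ D.range)) := toEuclidean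
  let π : V →L[ℝ] EuclideanSpace ℝ (Fin (finrank ℝ D.range)) :=
    (e : D.range →L[ℝ] _).comp (LinearMap.toContinuousLinearMap pr)
  let κ : X →L[ℝ] D.ker := LinearMap.toContinuousLinearMap κ'
  have hπ : ∀ x, π (D x) = e ⟨D x, x, rfl⟩ := fun x => by
    have := LinearMap.congr_fun hpr ⟨D x, x, rfl⟩
    exact congrArg e this
  have hκ : ∀ z : D.ker, κ z = z := fun z => LinearMap.congr_fun hκ' z
  have hπs : Function.Surjective (π.comp D) := by
    intro w
    obtain ⟨⟨_, x, rfl⟩, hx⟩ := e.surjective w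
    exact ⟨x, (hπ x).trans hx⟩
  refine ⟨_, π, hπs, ?_⟩
  -- A kernel coordinate completes `π ∘ F` to a local diffeomorphism.
  let Θ : X → EuclideanSpace ℝ (Fin (finrank ℝ D.range)) × D.ker := fun x => (π (F x), κ x)
  have hΘ : ContDiffAt ℝ ∞ Θ x₀ :=
    (π.contDiff.contDiffAt.comp x₀ hF).prodMk κ.contDiff.contDiffAt
  have hΘd : ∀ x, DifferentiableAt ℝ F x →
      HasFDerivAt Θ ((π.comp (fderiv ℝ F x)).prod κ) x := fun x hx =>
    (π.hasFDerivAt.comp x hx.hasFDerivAt).prodMk κ.hasFDerivAt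
  have hbij : Function.Bijective ((π.comp D).prod κ) := by
    constructor
    · refine (injective_iff_map_eq_zero ((π.comp D).prod κ)).2 fun v hv => ?_
      have h1 : π (D v) = 0 := congrArg Prod.fst hv
      have h2 : κ v = 0 := congrArg Prod.snd hv
      rw [hπ, map_eq_zero_iff e e.injective] at h1
      have h3 : D v = 0 := congrArg Subtype.val h1
      have h4 := hκ ⟨v, h3⟩
      have h5 : κ v = ⟨v, h3⟩ := h4
      rw [h2] at h5
      exact (congrArg Subtype.val h5).symm
    · rintro ⟨w, z⟩
      obtain ⟨v, hv⟩ := hπs w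
      refine ⟨v - κ v + z, ?_⟩
      have hz : D (z : X) = 0 := z.2
      have hk : D (κ v : X) = 0 := (κ v).2
      refine Prod.ext ?_ ?_
      · change π (D (v - κ v + z)) = w
        rw [map_add, map_sub, hz, hk, sub_zero, add_zero]
        exact hv
      · change κ (v - κ v + z) = z
        rw [map_add, map_sub, hκ, hκ, sub_self, zero_add]
  let L : X ≃L[ℝ] EuclideanSpace ℝ (Fin (finrank ℝ D.range)) × D.ker :=
    (LinearEquiv.ofBijective ((π.comp D).prod κ).toLinearMap hbij).toContinuousLinearEquiv
  have hL : HasFDerivAt Θ (L : X →L[ℝ] _) x₀ :=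
    (hΘd x₀ (hF.differentiableAt (by simp))).congr_fderiv (by ext v <;> rfl)
  have : CompleteSpace X := FiniteDimensional.complete ℝ X
  let P := hΘ.toOpenPartialHomeomorph Θ hL (by simp)
  have hP : ∀ x, P x = Θ x := fun x => rfl
  have hx₀ : x₀ ∈ P.source := hΘ.mem_toOpenPartialHomeomorph_source hL (by simp)
  have hΘ₀ : Θ x₀ ∈ P.target := P.map_source hx₀
  have hsymm0 : P.symm (Θ x₀) = x₀ := P.left_inv hx₀
  have hsymm : ContDiffAt ℝ 1 P.symm (Θ x₀) :=
    (hΘ.to_localInverse hL (by simp)).of_le one_le_infty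
  have hten : Filter.Tendsto P.symm (𝓝 (Θ x₀)) (𝓝 x₀) := by
    have := hsymm.continuousAt.tendsto
    rwa [hsymm0] at this
  have hgood : ∀ᶠ q in 𝓝 (Θ x₀), q ∈ P.target ∧ DifferentiableAt ℝ P.symm q ∧
      DifferentiableAt ℝ F (P.symm q) ∧
      finrank ℝ D.ker ≤ finrank ℝ (fderiv ℝ F (P.symm q)).ker := by
    filter_upwards [P.open_target.mem_nhds hΘ₀, hsymm.eventually (by simp),
      hten.eventually ((hF.of_le one_le_infty).eventually (by simp)), hten.eventually hrank]
      with q h1 h2 h3 h4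
    exact ⟨h1, h2.differentiableAt (by simp), h3.differentiableAt (by simp), h4⟩
  obtain ⟨r, hr, hball⟩ := Metric.eventually_nhds_iff_ball.1 hgood
  -- In the coordinates `Θ`, the map `F` does not vary along the kernel directions: these are killed
  -- by the derivative of `π ∘ F`, which near $x_0$ has the same kernel as that of `F`.
  have hzero : ∀ q ∈ Metric.ball (Θ x₀) r, ∀ z : D.ker,
      fderiv ℝ F (P.symm q) (fderiv ℝ P.symm q (0, z)) = 0 := by
    intro q hq z
    obtain ⟨h1, h2, h3, h4⟩ := hball q hq
    have hid : ∀ w, ((π.comp (fderiv ℝ F (P.symm q))).prod κ) (fderiv ℝ P.symm q w) = w := by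
      have hc := (hΘd _ h3).comp q h2.hasFDerivAt
      have he : (Θ ∘ P.symm) =ᶠ[𝓝 q] id := by
        filter_upwards [P.open_target.mem_nhds h1] with y hy
        exact P.right_inv hy
      have := (hc.congr_of_eventuallyEq he.symm).unique (hasFDerivAt_id q)
      intro w
      exact DFunLike.congr_fun this w
    have hsub : (fderiv ℝ F (P.symm q)).ker ≤ (π.comp (fderiv ℝ F (P.symm q))).ker := by
      intro v hv
      have hv' : fderiv ℝ F (P.symm q) v = 0 := hv
      change π (fderiv ℝ F (P.symm q) v) = 0
      rw [hv', map_zero]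
    have hrange : (π.comp (fderiv ℝ F (P.symm q))).range = ⊤ := by
      refine LinearMap.range_eq_top.2 fun w => ⟨fderiv ℝ P.symm q (w, 0), ?_⟩
      exact congrArg Prod.fst (hid (w, 0))
    have hn1 := LinearMap.finrank_range_add_finrank_ker
      (π.comp (fderiv ℝ F (P.symm q))).toLinearMap
    have hn2 := LinearMap.finrank_range_add_finrank_ker D.toLinearMap
    -- The derivative of `π ∘ F` is still onto, so its kernel has the dimension of the kernel of
    -- `D`. By hypothesis the smaller kernel of `fderiv F` is at least that large.
    have hker : (fderiv ℝ F (P.symm q)).ker = (π.comp (fderiv ℝ F (P.symm q))).ker := by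
      refine Submodule.eq_of_le_of_finrank_le hsub ?_
      have h5 : finrank ℝ (π.comp (fderiv ℝ F (P.symm q))).range = finrank ℝ D.range := by
        rw [hrange, finrank_top, finrank_euclideanSpace_fin]
      change finrank ℝ (π.comp (fderiv ℝ F (P.symm q))).range +
        finrank ℝ (π.comp (fderiv ℝ F (P.symm q))).ker = _ at hn1
      change finrank ℝ D.range + finrank ℝ D.ker = _ at hn2
      omega
    have hmem : fderiv ℝ P.symm q (0, z) ∈ (π.comp (fderiv ℝ F (P.symm q))).ker :=
      congrArg Prod.fst (hid (0, z))
    rw [← hker] at hmem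
    exact hmem
  -- A ball for the product metric is a product of balls, so its slices over a fixed value of `π ∘
  -- F` are convex and `F` is constant on them.
  refine ⟨P.source ∩ P ⁻¹' Metric.ball (Θ x₀) r,
    Filter.inter_mem (P.open_source.mem_nhds hx₀)
      ((P.continuousAt hx₀).preimage_mem_nhds (Metric.ball_mem_nhds _ hr)), ?_⟩
  rintro x ⟨hx, hxb⟩ y ⟨hy, hyb⟩ hxy
  have hxb' : Θ x ∈ Metric.ball (Θ x₀) r := hxb
  have hyb' : Θ y ∈ Metric.ball (Θ x₀) r := hyb
  set a := π (F x) with ha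
  let G : D.ker → V := fun z => F (P.symm (a, z))
  have hmemball : ∀ z ∈ Metric.ball (κ x₀) r, (a, z) ∈ Metric.ball (Θ x₀) r := by
    intro z hz
    rw [Metric.mem_ball, Prod.dist_eq] at hxb' ⊢
    exact max_lt (lt_of_le_of_lt (le_max_left _ _) hxb') hz
  have hGd : ∀ z ∈ Metric.ball (κ x₀) r, HasFDerivAt G (0 : D.ker →L[ℝ] V) z := by
    intro z hz
    have hq := hmemball z hz
    obtain ⟨h1, h2, h3, h4⟩ := hball _ hq
    have hin : HasFDerivAt (fun z : D.ker => (a, z)) (ContinuousLinearMap.inr ℝ _ _) z :=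
      hasFDerivAt_prodMk_right a z
    refine (h3.hasFDerivAt.comp z (h2.hasFDerivAt.comp z hin)).congr_fderiv ?_
    ext1 u
    exact hzero _ hq u
  have hconst : G (κ x) = G (κ y) := by
    refine Metric.isOpen_ball.is_const_of_fderiv_eq_zero (𝕜 := ℝ)
      (convex_ball (κ x₀) r).isPreconnected
      (fun z hz => (hGd z hz).differentiableAt.differentiableWithinAt)
      (fun z hz => (hGd z hz).fderiv) ?_ ?_
    · rw [Metric.mem_ball, Prod.dist_eq] at hxb'
      exact lt_of_le_of_lt (le_max_right _ _) hxb'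
    · rw [Metric.mem_ball, Prod.dist_eq] at hyb'
      exact lt_of_le_of_lt (le_max_right _ _) hyb'
  have hGx : G (κ x) = F x := congrArg F (P.left_inv hx)
  have hGy : G (κ y) = F y := by
    change F (P.symm (a, κ y)) = F y
    rw [hxy]
    exact congrArg F (P.left_inv hy)
  rw [← hGx, hconst, hGy]

end ConstantRank

end

noncomputable section

set_option linter.unusedSectionVars false

/-! ### Orbits as manifolds -/

section OrbitManifold

variable {EK V K : Type*} [NormedAddCommGroup EK] [NormedSpace ℝ EK] [FiniteDimensional ℝ EK]
  [NormedAddCommGroup V] [NormedSpace ℝ V] [FiniteDimensional ℝ V]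
  [TopologicalSpace K] [ChartedSpace EK K] [Group K] [LieGroup 𝓘(ℝ, EK) ∞ K]

/-- The orbit map `φ k = k · v` of a linear action `T` of a Lie group `K`. -/
structure IsOrbitMap (EK : Type*) [NormedAddCommGroup EK] [NormedSpace ℝ EK] [ChartedSpace EK K]
    (φ : K → V) (T : K → V →L[ℝ] V) : Prop where
  smooth : ContMDiff 𝓘(ℝ, EK) 𝓘(ℝ, V) ∞ φ
  equivariant : ∀ h k, φ (h * k) = T h (φ k)

/-- Equivariance makes the rank of the orbit map constant. Left translation by $k$ carries the
derivative at $1$ to the derivative at $k$ up to $T_k$, so the kernel at $k$ is at least as large as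
that at $1$. -/
theorem IsOrbitMap.exists_coordinates {φ : K → V} {T : K → V →L[ℝ] V} (hφ : IsOrbitMap EK φ T) :
    ∃ (d : ℕ) (π : V →L[ℝ] EuclideanSpace ℝ (Fin d)),
      Function.Surjective (dM 𝓘(ℝ, EK) 𝓘(ℝ, EuclideanSpace ℝ (Fin d)) (fun k => π (φ k)) 1) ∧
      ∃ N ∈ 𝓝 (1 : K), ∀ x ∈ N, ∀ y ∈ N, π (φ x) = π (φ y) → φ x = φ y := by
  let c := extChartAt 𝓘(ℝ, EK) (1 : K)
  let F : EK → V := fun x => φ (c.symm x)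
  have hFs : ∀ x ∈ c.target, ContDiffAt ℝ ∞ F x := fun x hx =>
    ((hφ.smooth _).comp x (contMDiffAt_extChartAt_symm_of_mem hx)).contDiffAt
  have hφd : ∀ k, MDifferentiableAt 𝓘(ℝ, EK) 𝓘(ℝ, V) φ k := fun k =>
    (hφ.smooth k).mdifferentiableAt (by simp)
  have hmul : ∀ k y : K, MDifferentiableAt 𝓘(ℝ, EK) 𝓘(ℝ, EK) (fun y => k * y) y := fun k y =>
    (contMDiff_mul_left (I := 𝓘(ℝ, EK)) (n := ∞) (a := k) y).mdifferentiableAt (by simp)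
  have hdφ : dM 𝓘(ℝ, EK) 𝓘(ℝ, V) φ 1 = fderiv ℝ F (c 1) := by
    rw [dM_eq_fderiv_writtenInExtChartAt (hφd 1)]
    rfl
  obtain ⟨d, π, hπ, N, hN, hinj⟩ := exists_coordinates_of_constant_rank
    (hFs _ (mem_extChartAt_target 1)) (by
      filter_upwards [extChartAt_target_mem_nhds (I := 𝓘(ℝ, EK)) (1 : K)] with x hx
      let k := c.symm x
      have hk : k ∈ c.source := c.map_target hx
      have hck : c k = x := c.right_inv hx
      have hcd : MDifferentiableAt 𝓘(ℝ, EK) 𝓘(ℝ, EK) c (k * 1) := by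
        rw [mul_one]
        exact (contMDiffAt_extChartAt' (n := 1) (by simpa [c] using hk)).mdifferentiableAt (by simp)
      -- The derivative at `1` of left translation by `k`, read in the chart at the target; it is
      -- injective because translation by `k⁻¹` undoes it.
      let m := dM 𝓘(ℝ, EK) 𝓘(ℝ, EK) (fun y => c (k * y)) 1
      have hmd : MDifferentiableAt 𝓘(ℝ, EK) 𝓘(ℝ, EK) (fun y => c (k * y)) 1 :=
        MDifferentiableAt.comp (1 : K) hcd (hmul k 1)
      have hsrc : ∀ᶠ y in 𝓝 (1 : K), k * y ∈ c.source := by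
        refine (hmul k 1).continuousAt.eventually_mem ?_
        rw [mul_one]
        exact (isOpen_extChartAt_source 1).mem_nhds hk
      have hck1 : c (k * 1) = x := by rw [mul_one, hck]
      have h1 : ∀ v, fderiv ℝ F x (m v) = T k (dM 𝓘(ℝ, EK) 𝓘(ℝ, V) φ 1 v) := by
        intro v
        have hFx : MDifferentiableAt 𝓘(ℝ, EK) 𝓘(ℝ, V) F (c (k * 1)) := by
          rw [hck1]
          exact ((hFs x hx).differentiableAt (by simp)).mdifferentiableAt
        have e1 := dM_comp_apply (f := fun y => c (k * y)) hFx hmd v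
        rw [hck1, dM_eq_fderiv] at e1
        rw [← e1, ← ContinuousLinearMap.comp_apply, ← dM_clm_comp (T k) (hφd 1)]
        congr 1
        refine dM_congr ?_
        filter_upwards [hsrc] with y hy
        change φ (c.symm (c (k * y))) = T k (φ y)
        rw [c.left_inv hy, hφ.equivariant]
      have h2 : Function.Injective m := by
        have hcs : MDifferentiableAt 𝓘(ℝ, EK) 𝓘(ℝ, EK) (fun y => k⁻¹ * c.symm y) (c (k * 1)) := by
          rw [hck1]
          exact MDifferentiableAt.comp x (hmul _ _)
            ((contMDiffAt_extChartAt_symm_of_mem hx).mdifferentiableAt (by simp))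
        have e : ∀ v, dM 𝓘(ℝ, EK) 𝓘(ℝ, EK) (fun y => k⁻¹ * c.symm y) (c (k * 1)) (m v) = v := by
          intro v
          rw [← dM_comp_apply (f := fun y => c (k * y)) hcs hmd v]
          have : (fun y => k⁻¹ * c.symm (c (k * y))) =ᶠ[𝓝 (1 : K)] fun y => y := by
            filter_upwards [hsrc] with y hy
            rw [c.left_inv hy, inv_mul_cancel_left]
          rw [dM_congr this, dM_id]
          rfl
        exact Function.LeftInverse.injective e
      rw [← hdφ]
      -- By `h1` the map `m` sends the kernel at `1` into the kernel at `x`.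
      let ψ : (dM 𝓘(ℝ, EK) 𝓘(ℝ, V) φ 1).ker →ₗ[ℝ] (fderiv ℝ F x).ker :=
        (m.toLinearMap.comp (Submodule.subtype _)).codRestrict _ (by
          rintro ⟨v, hv⟩
          have hv' : dM 𝓘(ℝ, EK) 𝓘(ℝ, V) φ 1 v = 0 := hv
          change fderiv ℝ F x (m v) = 0
          rw [h1, hv', map_zero])
      refine LinearMap.finrank_le_finrank_of_injective (f := ψ) ?_
      intro u v huv
      exact Subtype.ext (h2 (congrArg Subtype.val huv)))
  refine ⟨d, π, ?_, c.source ∩ c ⁻¹' N, ?_, ?_⟩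
  · rw [dM_clm_comp π (hφd 1), hdφ]
    exact hπ
  · exact Filter.inter_mem (extChartAt_source_mem_nhds 1)
      ((continuousAt_extChartAt 1).preimage_mem_nhds hN)
  · rintro x ⟨hx, hxN⟩ y ⟨hy, hyN⟩ hxy
    have := hinj _ hxN _ hyN
    simp only [F, c.left_inv hx, c.left_inv hy] at this
    exact this hxy

/-- A local slice of the orbit map `φ` at the identity, in linear coordinates `π`. -/
structure OrbitSlice (EK : Type*) [NormedAddCommGroup EK] [NormedSpace ℝ EK] [ChartedSpace EK K]
    (φ : K → V) where
  d : ℕ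
  π : V →L[ℝ] EuclideanSpace ℝ (Fin d)
  N : Set K
  U : Set (EuclideanSpace ℝ (Fin d))
  s : EuclideanSpace ℝ (Fin d) → K
  isOpen_N : IsOpen N
  isOpen_U : IsOpen U
  one_mem : (1 : K) ∈ N
  base_mem : π (φ 1) ∈ U
  injOn : ∀ x ∈ N, ∀ y ∈ N, π (φ x) = π (φ y) → φ x = φ y
  s_base : s (π (φ 1)) = 1
  s_mem : ∀ w ∈ U, s w ∈ N
  s_smooth : ∀ w ∈ U, ContMDiffAt 𝓘(ℝ, EuclideanSpace ℝ (Fin d)) 𝓘(ℝ, EK) ∞ s w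
  s_section : ∀ w ∈ U, π (φ (s w)) = w

/-- A local section of `π ∘ φ` through `1`, with domain shrunk until it takes values in the
neighbourhood where `π ∘ φ` determines `φ`. -/
theorem IsOrbitMap.nonempty_slice {φ : K → V} {T : K → V →L[ℝ] V} (hφ : IsOrbitMap EK φ T) :
    Nonempty (OrbitSlice EK φ) := by
  obtain ⟨d, π, hsurj, N, hN, hinj⟩ := hφ.exists_coordinates
  have hsm : ContMDiff 𝓘(ℝ, EK) 𝓘(ℝ, EuclideanSpace ℝ (Fin d)) ∞ (fun k => π (φ k)) :=
    π.contDiff.contMDiff.comp hφ.smooth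
  obtain ⟨s, hs, hs1, hsec⟩ := exists_local_section hsm hsurj
  simp only [extChartAt_model_space_eq_id, PartialEquiv.refl_coe, PartialEquiv.refl_symm,
    id_eq] at hs hs1 hsec
  obtain ⟨N', hN'N, hN'o, h1N'⟩ := mem_nhds_iff.1 hN
  have hsN : ∀ᶠ w in 𝓝 (π (φ 1)), s w ∈ N' := by
    refine hs.self_of_nhds.continuousAt.eventually_mem ?_
    rw [hs1]
    exact hN'o.mem_nhds h1N'
  obtain ⟨U, hU, hUo, hU1⟩ := mem_nhds_iff.1 (hs.and (hsec.and hsN))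
  exact ⟨⟨d, π, N', U, s, hN'o, hUo, h1N', hU1, fun x hx y hy => hinj x (hN'N hx) y (hN'N hy),
    hs1, fun w hw => (hU hw).2.2, fun w hw => (hU hw).1, fun w hw => (hU hw).2.1⟩⟩

variable {φ : K → V} {T : K → V →L[ℝ] V}

/-- The orbit `φ(K)` with the manifold structure defined by a slice. -/
def OrbitManifold (_hφ : IsOrbitMap EK φ T) (_S : OrbitSlice EK φ) : Type _ := Set.range φ

namespace OrbitManifold

variable (hφ : IsOrbitMap EK φ T) (S : OrbitSlice EK φ)

/-- The orbit map onto the orbit. -/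
def proj (k : K) : OrbitManifold hφ S := ⟨φ k, k, rfl⟩

/-- The inclusion of the orbit. -/
def incl (p : OrbitManifold hφ S) : V := Subtype.val (p := (· ∈ Set.range φ)) p

/-- The quotient topology from `K`, possibly finer than the subspace topology of `V`: the orbit is
only immersed. -/
instance : TopologicalSpace (OrbitManifold hφ S) :=
  TopologicalSpace.coinduced (proj hφ S) inferInstance

theorem incl_proj (k : K) : incl hφ S (proj hφ S k) = φ k := rfl

theorem incl_injective : Function.Injective (incl hφ S) := Subtype.val_injective

theorem proj_surjective : Function.Surjective (proj hφ S) := by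
  rintro ⟨_, k, rfl⟩
  exact ⟨k, rfl⟩

theorem proj_eq_iff {k k' : K} : proj hφ S k = proj hφ S k' ↔ φ k = φ k' :=
  ⟨fun h => congrArg (incl hφ S) h, fun h => incl_injective hφ S h⟩

theorem isQuotientMap_proj : Topology.IsQuotientMap (proj hφ S) :=
  ⟨⟨rfl⟩, proj_surjective hφ S⟩

/-- The saturation of an open set is a union of right translates by the stabilizer of `φ 1`: if
$\varphi(u)=\varphi(x)$, then $x^{-1}u$ fixes $\varphi(1)$, and $y\mapsto y\,x^{-1}u$ moves $x$ to
$u$ without changing $\varphi(y)$. -/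
theorem isOpenMap_proj : IsOpenMap (proj hφ S) := by
  have : ContinuousMul K := (topologicalGroup_of_lieGroup 𝓘(ℝ, EK) ∞).toContinuousMul
  intro O hO
  rw [← (isQuotientMap_proj hφ S).isOpen_preimage, isOpen_iff_mem_nhds]
  rintro x ⟨u, hu, hux⟩
  rw [proj_eq_iff] at hux
  have hc : Continuous fun y : K => y * (x⁻¹ * u) := continuous_mul_const _
  have h1 : φ (x⁻¹ * u) = φ 1 := by
    rw [hφ.equivariant, hux, ← hφ.equivariant, inv_mul_cancel]
  refine Filter.mem_of_superset (hc.continuousAt.preimage_mem_nhds (hO.mem_nhds ?_)) ?_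
  · rwa [mul_inv_cancel_left]
  · intro y hy
    refine ⟨_, hy, (proj_eq_iff hφ S).2 ?_⟩
    rw [hφ.equivariant, h1, ← hφ.equivariant, mul_one]

theorem continuous_incl : Continuous (incl hφ S) :=
  (isQuotientMap_proj hφ S).continuous_iff.2 hφ.smooth.continuous

instance : T2Space (OrbitManifold hφ S) :=
  T2Space.of_injective_continuous (incl_injective hφ S) (continuous_incl hφ S)

instance [SecondCountableTopology K] : SecondCountableTopology (OrbitManifold hφ S) :=
  (isQuotientMap_proj hφ S).secondCountableTopology (isOpenMap_proj hφ S)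

theorem inv_translate (hφ : IsOrbitMap EK φ T) (k x : K) : T k⁻¹ (φ (k * x)) = φ x := by
  rw [← hφ.equivariant, inv_mul_cancel_left]

theorem slice_eq {x : K} (hx : x ∈ S.N) (hxU : S.π (φ x) ∈ S.U) : φ (S.s (S.π (φ x))) = φ x :=
  S.injOn _ (S.s_mem _ hxU) _ hx (S.s_section _ hxU)

/-- The chart of the orbit near `φ k`. -/
def chart (k : K) : OpenPartialHomeomorph (OrbitManifold hφ S) (EuclideanSpace ℝ (Fin S.d)) where
  toFun p := S.π (T k⁻¹ (incl hφ S p))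
  invFun w := proj hφ S (k * S.s w)
  source := (fun x => proj hφ S (k * x)) '' (S.N ∩ {x | S.π (φ x) ∈ S.U})
  target := S.U
  map_source' := by
    rintro _ ⟨x, ⟨hx, hxU⟩, rfl⟩
    rw [incl_proj, inv_translate hφ]
    exact hxU
  map_target' := by
    intro w hw
    refine ⟨S.s w, ⟨S.s_mem w hw, ?_⟩, rfl⟩
    change S.π (φ (S.s w)) ∈ S.U
    rwa [S.s_section w hw]
  left_inv' := by
    rintro _ ⟨x, ⟨hx, hxU⟩, rfl⟩
    change proj hφ S (k * S.s (S.π (T k⁻¹ (φ (k * x))))) = proj hφ S (k * x)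
    rw [inv_translate hφ, proj_eq_iff, hφ.equivariant, hφ.equivariant,
      slice_eq S hx hxU]
  right_inv' := by
    intro w hw
    rw [incl_proj, inv_translate hφ, S.s_section w hw]
  open_source := by
    have : ContinuousMul K := (topologicalGroup_of_lieGroup 𝓘(ℝ, EK) ∞).toContinuousMul
    refine (isOpenMap_proj hφ S).comp (isOpenMap_mul_left k) _ (S.isOpen_N.inter ?_)
    exact S.isOpen_U.preimage (S.π.continuous.comp hφ.smooth.continuous)
  open_target := S.isOpen_U
  continuousOn_toFun :=
    (S.π.continuous.comp ((T k⁻¹).continuous.comp (continuous_incl hφ S))).continuousOn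
  continuousOn_invFun := by
    have : ContinuousMul K := (topologicalGroup_of_lieGroup 𝓘(ℝ, EK) ∞).toContinuousMul
    intro w hw
    exact ((isQuotientMap_proj hφ S).continuous.continuousAt.comp
      ((continuous_const_mul k).continuousAt.comp (S.s_smooth w hw).continuousAt)).continuousWithinAt

theorem mem_chart_source (k : K) : proj hφ S k ∈ (chart hφ S k).source :=
  ⟨1, ⟨S.one_mem, S.base_mem⟩, congrArg (proj hφ S) (mul_one k)⟩

instance : ChartedSpace (EuclideanSpace ℝ (Fin S.d)) (OrbitManifold hφ S) where
  atlas := Set.range (chart hφ S)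
  chartAt p := chart hφ S (proj_surjective hφ S p).choose
  mem_chart_source p := by
    have h := mem_chart_source hφ S (proj_surjective hφ S p).choose
    rwa [(proj_surjective hφ S p).choose_spec] at h
  chart_mem_atlas p := ⟨_, rfl⟩

theorem contDiffAt_translate (hφ : IsOrbitMap EK φ T) (S : OrbitSlice EK φ) (L : V →L[ℝ] V)
    (k : K) {w : EuclideanSpace ℝ (Fin S.d)} (hw : w ∈ S.U) : ContDiffAt ℝ ∞ (fun w => L (φ (k * S.s w))) w := by
  have h : ContMDiffAt 𝓘(ℝ, EuclideanSpace ℝ (Fin S.d)) 𝓘(ℝ, V) ∞ (fun w => φ (k * S.s w)) w :=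
    (hφ.smooth _).comp w ((contMDiff_mul_left (I := 𝓘(ℝ, EK)) (n := ∞) (a := k) _).comp w
      (S.s_smooth w hw))
  exact L.contDiff.contDiffAt.comp w h.contDiffAt

/-- The transition maps are restrictions of $w\mapsto\pi(T_{k'^{-1}}\varphi(k\,s(w)))$, which is
smooth on all of `S.U`. -/
instance : IsManifold (𝓡 S.d) ∞ (OrbitManifold hφ S) := by
  refine isManifold_of_contDiffOn _ _ _ ?_
  rintro _ _ ⟨k, rfl⟩ ⟨k', rfl⟩ w ⟨hw, -⟩
  have hw' : w ∈ S.U := hw.1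
  exact (S.π.contDiff.contDiffAt.comp w
    (contDiffAt_translate hφ S (T k'⁻¹) k hw')).contDiffWithinAt

theorem contMDiff_incl : ContMDiff (𝓡 S.d) 𝓘(ℝ, V) ∞ (incl hφ S) := by
  intro p
  let e := chartAt (EuclideanSpace ℝ (Fin S.d)) p
  let k := (proj_surjective hφ S p).choose
  have hp : p ∈ e.source := ChartedSpace.mem_chart_source p
  have h1 : ContMDiffAt (𝓡 S.d) 𝓘(ℝ, EuclideanSpace ℝ (Fin S.d)) ∞ e p :=
    contMDiffOn_chart.contMDiffAt (e.open_source.mem_nhds hp)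
  have h2 := (contDiffAt_translate hφ S (ContinuousLinearMap.id ℝ V) k
    (e.map_source hp)).contMDiffAt.comp p h1
  refine h2.congr_of_eventuallyEq ?_
  filter_upwards [e.open_source.mem_nhds hp] with q hq
  exact congrArg (incl hφ S) (e.left_inv hq).symm

theorem contMDiff_proj : ContMDiff 𝓘(ℝ, EK) (𝓡 S.d) ∞ (proj hφ S) := by
  intro x
  let p := proj hφ S x
  let e := chartAt (EuclideanSpace ℝ (Fin S.d)) p
  let k := (proj_surjective hφ S p).choose
  have hp : p ∈ e.source := ChartedSpace.mem_chart_source p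
  have h1 : ContMDiffAt 𝓘(ℝ, EuclideanSpace ℝ (Fin S.d)) (𝓡 S.d) ∞ e.symm (e p) :=
    contMDiffOn_chart_symm.contMDiffAt (e.open_target.mem_nhds (e.map_source hp))
  have h2 : ContMDiff 𝓘(ℝ, EK) 𝓘(ℝ, EuclideanSpace ℝ (Fin S.d)) ∞
      (fun x => S.π (T k⁻¹ (φ x))) :=
    S.π.contDiff.contMDiff.comp ((T k⁻¹).contDiff.contMDiff.comp hφ.smooth)
  refine (ContMDiffAt.comp x h1 (h2 x)).congr_of_eventuallyEq ?_
  filter_upwards [(isQuotientMap_proj hφ S).continuous.continuousAt.eventually_mem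
    (e.open_source.mem_nhds hp)] with y hy
  exact (e.left_inv hy).symm

/-- The inverse of the chart at `k` factors through `K` as $w\mapsto k\,s(w)$, and the chart itself
is linear in the inclusion. The identity of the orbit is thus locally a composition passing through
both the inclusion and the projection. -/
theorem exists_local_inverse (k : K) :
    ∃ (c : EuclideanSpace ℝ (Fin S.d) → K) (r : V →L[ℝ] EuclideanSpace ℝ (Fin S.d)),
      ContMDiffAt 𝓘(ℝ, EuclideanSpace ℝ (Fin S.d)) 𝓘(ℝ, EK) ∞ c (r (φ k)) ∧ c (r (φ k)) = k ∧
      ∀ᶠ p in 𝓝 (proj hφ S k), proj hφ S (c (r (incl hφ S p))) = p := by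
  have hr : S.π (T k⁻¹ (φ k)) = S.π (φ 1) := by rw [← hφ.equivariant, inv_mul_cancel]
  refine ⟨fun w => k * S.s w, S.π.comp (T k⁻¹), ?_, ?_, ?_⟩
  · rw [ContinuousLinearMap.comp_apply, hr]
    exact (contMDiff_mul_left (I := 𝓘(ℝ, EK)) (n := ∞) (a := k) _).comp _
      (S.s_smooth _ S.base_mem)
  · change k * S.s (S.π (T k⁻¹ (φ k))) = k
    rw [hr, S.s_base, mul_one]
  · filter_upwards [(chart hφ S k).open_source.mem_nhds (mem_chart_source hφ S k)] with p hp
    exact (chart hφ S k).left_inv hp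

/-- Differentiating the factorization of the identity in `exists_local_inverse`. One formula yields
both surjectivity of the derivative of `proj` and injectivity of that of `incl`. -/
theorem derivative_left_inverse (k : K) :
    ∃ (c : EuclideanSpace ℝ (Fin S.d) →L[ℝ] EK) (r : V →L[ℝ] EuclideanSpace ℝ (Fin S.d)),
      ∀ u, dM 𝓘(ℝ, EK) (𝓡 S.d) (proj hφ S) k
        (c (r (dM (𝓡 S.d) 𝓘(ℝ, V) (incl hφ S) (proj hφ S k) u))) = u := by
  obtain ⟨c, r, hc, hck, hcr⟩ := exists_local_inverse hφ S k
  refine ⟨dM 𝓘(ℝ, EuclideanSpace ℝ (Fin S.d)) 𝓘(ℝ, EK) c (r (φ k)), r, fun u => ?_⟩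
  have hi := (contMDiff_incl hφ S (proj hφ S k)).mdifferentiableAt (n := ∞) (by simp)
  have hri : MDifferentiableAt (𝓡 S.d) 𝓘(ℝ, EuclideanSpace ℝ (Fin S.d))
      (fun p => r (incl hφ S p)) (proj hφ S k) :=
    r.differentiableAt.mdifferentiableAt.comp _ hi
  have hcd : MDifferentiableAt 𝓘(ℝ, EuclideanSpace ℝ (Fin S.d)) 𝓘(ℝ, EK) c
      (r (incl hφ S (proj hφ S k))) := hc.mdifferentiableAt (by simp)
  have hp : MDifferentiableAt 𝓘(ℝ, EK) (𝓡 S.d) (proj hφ S)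
      (c (r (incl hφ S (proj hφ S k)))) :=
    (contMDiff_proj hφ S _).mdifferentiableAt (by simp)
  have h1 := dM_comp_apply (f := fun p => c (r (incl hφ S p))) hp
    (MDifferentiableAt.comp (proj hφ S k) hcd hri) u
  rw [dM_congr (f' := fun p => p) hcr, dM_id,
    dM_comp_apply (f := fun p => r (incl hφ S p)) hcd hri, dM_clm_comp r hi] at h1
  have h2 : c (r (incl hφ S (proj hφ S k))) = k := hck
  rw [h2] at h1
  exact h1.symm

/-- The manifold structure of the orbit. -/
def smoothStructure [SecondCountableTopology K] : SmoothStructure (Set.range φ) where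
  dim := S.d
  top := inferInstanceAs (TopologicalSpace (OrbitManifold hφ S))
  charts := inferInstanceAs (ChartedSpace _ (OrbitManifold hφ S))
  isManifold := inferInstanceAs (IsManifold (𝓡 S.d) ∞ (OrbitManifold hφ S))
  t2 := inferInstanceAs (T2Space (OrbitManifold hφ S))
  secondCountable := inferInstanceAs (SecondCountableTopology (OrbitManifold hφ S))

end OrbitManifold

/-- An orbit of a linear action of a Lie group is an immersed submanifold. -/
theorem IsOrbitMap.exists_smoothStructure [SecondCountableTopology K] (hφ : IsOrbitMap EK φ T) :
    ∃ s : SmoothStructure (Set.range φ),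
      IsSmoothSubmersion 𝓘(ℝ, EK) (𝓡 s.dim) (fun k : K => s.equip ⟨φ k, k, rfl⟩) ∧
      IsSmoothImmersion (𝓡 s.dim) 𝓘(ℝ, V) (fun p : s.Carrier => (s.out p).1) := by
  obtain ⟨S⟩ := hφ.nonempty_slice
  refine ⟨OrbitManifold.smoothStructure hφ S,
    ⟨OrbitManifold.contMDiff_proj hφ S, fun k => ?_⟩,
    ⟨OrbitManifold.contMDiff_incl hφ S, fun p => ?_⟩⟩
  · obtain ⟨c, r, h⟩ := OrbitManifold.derivative_left_inverse hφ S k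
    exact fun u => ⟨_, h u⟩
  · obtain ⟨k, rfl⟩ := OrbitManifold.proj_surjective hφ S p
    obtain ⟨c, r, h⟩ := OrbitManifold.derivative_left_inverse hφ S k
    exact Function.LeftInverse.injective
      (g := fun v => dM 𝓘(ℝ, EK) (𝓡 S.d) (OrbitManifold.proj hφ S) k (c (r v))) h

end OrbitManifold

end

noncomputable section

/-! ### Calculus on Lie groups -/

section LieCalculus

set_option linter.unusedSectionVars false

variable {E : Type*} [NormedAddCommGroup E] [NormedSpace ℝ E]
  {G : Type*} [TopologicalSpace G] [ChartedSpace E G] [Group G] [LieGroup 𝓘(ℝ, E) ∞ G]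

/-- The left Maurer-Cartan form, as a family of endomorphisms of the model vector space. -/
def leftMC (g : G) : E →L[ℝ] E := dM 𝓘(ℝ, E) 𝓘(ℝ, E) (fun x : G => g⁻¹ * x) g

section

variable {E₁ H₁ M : Type*} [NormedAddCommGroup E₁] [NormedSpace ℝ E₁] [TopologicalSpace H₁]
  {I : ModelWithCorners ℝ E₁ H₁} [TopologicalSpace M] [ChartedSpace H₁ M]

theorem mdifferentiableAt_mul {u v : M → G} {m : M} (hu : MDifferentiableAt I 𝓘(ℝ, E) u m)
    (hv : MDifferentiableAt I 𝓘(ℝ, E) v m) :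
    MDifferentiableAt I 𝓘(ℝ, E) (fun x => u x * v x) m :=
  ((contMDiff_mul 𝓘(ℝ, E) ∞ (G := G)).mdifferentiable (by simp) (u m, v m)).comp m
    (hu.prodMk hv)

theorem mdifferentiableAt_inv {u : M → G} {m : M} (hu : MDifferentiableAt I 𝓘(ℝ, E) u m) :
    MDifferentiableAt I 𝓘(ℝ, E) (fun x => (u x)⁻¹) m :=
  ((contMDiff_inv 𝓘(ℝ, E) ∞ (G := G)).mdifferentiable (by simp) (u m)).comp m hu

theorem mdifferentiableAt_const_mul (g : G) {u : M → G} {m : M}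
    (hu : MDifferentiableAt I 𝓘(ℝ, E) u m) : MDifferentiableAt I 𝓘(ℝ, E) (fun x => g * u x) m :=
  mdifferentiableAt_mul mdifferentiableAt_const hu

theorem mdifferentiableAt_mul_const (g : G) {u : M → G} {m : M}
    (hu : MDifferentiableAt I 𝓘(ℝ, E) u m) : MDifferentiableAt I 𝓘(ℝ, E) (fun x => u x * g) m :=
  mdifferentiableAt_mul hu mdifferentiableAt_const

/-- Multiplication has derivative $(a,b)\mapsto a+b$ at $(1,1)$. Logarithmic derivatives of products
are reduced to this case by regrouping so that every factor is $1$ at the base point. -/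
theorem dM_mul_of_eq_one {u v : M → G} {m : M} (hu : MDifferentiableAt I 𝓘(ℝ, E) u m)
    (hv : MDifferentiableAt I 𝓘(ℝ, E) v m) (hu1 : u m = 1) (hv1 : v m = 1) :
    dM I 𝓘(ℝ, E) (fun x => u x * v x) m = dM I 𝓘(ℝ, E) u m + dM I 𝓘(ℝ, E) v m := by
  have hmul : MDifferentiableAt (𝓘(ℝ, E).prod 𝓘(ℝ, E)) 𝓘(ℝ, E) (fun p : G × G => p.1 * p.2)
      (u m, v m) := (contMDiff_mul 𝓘(ℝ, E) ∞ (G := G)).mdifferentiable (by simp) _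
  have h1 : ∀ a b : E, dM (𝓘(ℝ, E).prod 𝓘(ℝ, E)) 𝓘(ℝ, E) (fun p : G × G => p.1 * p.2)
      (u m, v m) (a, b) = a + b := by
    intro a b
    have h := mfderiv_prod_eq_add_apply (v := (a, b)) hmul
    have h' : dM (𝓘(ℝ, E).prod 𝓘(ℝ, E)) 𝓘(ℝ, E) (fun p : G × G => p.1 * p.2)
      (u m, v m) (a, b) = dM 𝓘(ℝ, E) 𝓘(ℝ, E) (fun z : G => z * v m) (u m) a +
        dM 𝓘(ℝ, E) 𝓘(ℝ, E) (fun z : G => u m * z) (v m) b := h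
    rw [h', hu1, hv1]
    simp only [mul_one, one_mul, dM_id]
    rfl
  ext w
  rw [dM_comp_apply (f := fun x => (u x, v x)) (g := fun p : G × G => p.1 * p.2) hmul
    (hu.prodMk hv), dM_prodMk hu hv]
  exact h1 _ _

/-- The product $u\,u^{-1}$ is constant. -/
theorem dM_inv_of_eq_one {u : M → G} {m : M} (hu : MDifferentiableAt I 𝓘(ℝ, E) u m)
    (hu1 : u m = 1) : dM I 𝓘(ℝ, E) (fun x => (u x)⁻¹) m = -dM I 𝓘(ℝ, E) u m := by
  have h := dM_mul_of_eq_one hu (mdifferentiableAt_inv hu) hu1 (by rw [hu1, inv_one])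
  simp only [mul_inv_cancel, dM_const] at h
  exact (neg_eq_of_add_eq_zero_right h.symm).symm

theorem mdifferentiableAt_conj (g x : G) :
    MDifferentiableAt 𝓘(ℝ, E) 𝓘(ℝ, E) (fun x : G => g * x * g⁻¹) x :=
  mdifferentiableAt_mul_const _ (mdifferentiableAt_const_mul _ mdifferentiableAt_id)

theorem dM_conj_of_eq_one (g : G) {u : M → G} {m : M} (hu : MDifferentiableAt I 𝓘(ℝ, E) u m)
    (hu1 : u m = 1) :
    dM I 𝓘(ℝ, E) (fun x => g * u x * g⁻¹) m = (adGroup g).comp (dM I 𝓘(ℝ, E) u m) := by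
  rw [dM_comp (g := fun x : G => g * x * g⁻¹) (mdifferentiableAt_conj g _) hu, hu1]
  rfl

theorem leftMC_comp {f : M → G} {m : M} (hf : MDifferentiableAt I 𝓘(ℝ, E) f m) :
    (leftMC (f m)).comp (dM I 𝓘(ℝ, E) f m) =
      dM I 𝓘(ℝ, E) (fun x => (f m)⁻¹ * f x) m :=
  (dM_comp (g := fun x : G => (f m)⁻¹ * x)
    (mdifferentiableAt_const_mul _ mdifferentiableAt_id) hf).symm

end

theorem adGroup_one : adGroup (1 : G) = ContinuousLinearMap.id ℝ E := by
  have h : adGroup (1 : G) = dM 𝓘(ℝ, E) 𝓘(ℝ, E) (fun x : G => 1 * x * 1⁻¹) 1 := rfl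
  simp only [one_mul, inv_one, mul_one] at h
  rw [h, dM_id]

theorem adGroup_mul (g h : G) : adGroup (E := E) (g * h) = (adGroup g).comp (adGroup h) := by
  have h1 := dM_conj_of_eq_one (E := E) g (u := fun x : G => h * x * h⁻¹) (m := (1 : G))
    (mdifferentiableAt_conj h 1) (by group)
  have h2 : adGroup (E := E) (g * h)
    = dM 𝓘(ℝ, E) 𝓘(ℝ, E) (fun x : G => g * h * x * (g * h)⁻¹) 1 := rfl
  have h3 : (fun x : G => g * h * x * (g * h)⁻¹) = fun x => g * (h * x * h⁻¹) * g⁻¹ := by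
    funext x; group
  rw [h2, h3]
  exact h1

theorem adGroup_inv_apply (g : G) (x : E) : adGroup g⁻¹ (adGroup g x) = x := by
  rw [← ContinuousLinearMap.comp_apply, ← adGroup_mul, inv_mul_cancel, adGroup_one]
  rfl

theorem adGroup_apply_inv (g : G) (x : E) : adGroup g (adGroup g⁻¹ x) = x := by
  rw [← ContinuousLinearMap.comp_apply, ← adGroup_mul, mul_inv_cancel, adGroup_one]
  rfl

theorem contMDiffAt_of_comp_extChartAt_symm {E₁ E₂ M : Type*} [NormedAddCommGroup E₁]
    [NormedSpace ℝ E₁] [NormedAddCommGroup E₂] [NormedSpace ℝ E₂] [TopologicalSpace M]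
    [ChartedSpace E₁ M] [IsManifold 𝓘(ℝ, E₁) ∞ M] {f : M → E₂} {p : M}
    (h : ContDiffAt ℝ ∞ (fun y => f ((extChartAt 𝓘(ℝ, E₁) p).symm y))
      (extChartAt 𝓘(ℝ, E₁) p p)) : ContMDiffAt 𝓘(ℝ, E₁) 𝓘(ℝ, E₂) ∞ f p := by
  refine (h.contMDiffAt.comp p (contMDiffAt_extChartAt (I := 𝓘(ℝ, E₁)))).congr_of_eventuallyEq ?_
  filter_upwards [extChartAt_source_mem_nhds (I := 𝓘(ℝ, E₁)) p] with x hx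
  exact congrArg f ((extChartAt 𝓘(ℝ, E₁) p).left_inv hx).symm

/-- In the chart at $1$, $\mathrm{Ad}_g$ is the partial derivative in $z$ of the jointly smooth
expression $g z g^{-1}$, and partial derivatives depend smoothly on the parameter. -/
theorem contMDiff_adGroup :
    ContMDiff 𝓘(ℝ, E) 𝓘(ℝ, E →L[ℝ] E) ∞ (fun g : G => adGroup (E := E) g) := by
  intro g₀
  refine contMDiffAt_of_comp_extChartAt_symm ?_
  let c := extChartAt 𝓘(ℝ, E) (1 : G)
  let c₀ := extChartAt 𝓘(ℝ, E) g₀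
  have h : ∀ g : G, adGroup (E := E) g = fderiv ℝ (fun z => c (g * c.symm z * g⁻¹)) (c 1) := by
    intro g
    have h1 : adGroup (E := E) g = dM 𝓘(ℝ, E) 𝓘(ℝ, E) (fun x : G => g * x * g⁻¹) 1 := rfl
    rw [h1, dM_eq_fderiv_writtenInExtChartAt (mdifferentiableAt_conj g 1)]
    simp only [writtenInExtChartAt, mul_one, mul_inv_cancel]
    rfl
  simp only [h]
  refine ContDiffAt.fderiv (n := ∞) (f := fun y z => c (c₀.symm y * c.symm z * (c₀.symm y)⁻¹))
    (g := fun _ => c 1) ?_ contDiffAt_const (by simp)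
  have h1 : ContMDiffAt 𝓘(ℝ, E × E) 𝓘(ℝ, E) ∞ (fun p : E × E => c₀.symm p.1) (c₀ g₀, c 1) :=
    ContMDiffAt.comp (c₀ g₀, c 1) (g := c₀.symm)
      (contMDiffAt_extChartAt_symm_of_mem (mem_extChartAt_target g₀)) contDiffAt_fst.contMDiffAt
  have h2 : ContMDiffAt 𝓘(ℝ, E × E) 𝓘(ℝ, E) ∞ (fun p : E × E => c.symm p.2) (c₀ g₀, c 1) :=
    ContMDiffAt.comp (c₀ g₀, c 1) (g := c.symm)
      (contMDiffAt_extChartAt_symm_of_mem (mem_extChartAt_target 1)) contDiffAt_snd.contMDiffAt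
  have h3 := (h1.mul h2).mul h1.inv
  have hc : ContMDiffAt 𝓘(ℝ, E) 𝓘(ℝ, E) ∞ c
      (c₀.symm (c₀ g₀) * c.symm (c 1) * (c₀.symm (c₀ g₀))⁻¹) := by
    have : c₀.symm (c₀ g₀) * c.symm (c 1) * (c₀.symm (c₀ g₀))⁻¹ = 1 := by
      simp only [c, extChartAt_to_inv]
      group
    rw [this]
    exact contMDiffAt_extChartAt
  exact (ContMDiffAt.comp (c₀ g₀, c 1) hc h3).contDiffAt

/-! ### Vector fields in charts -/

/-- The tangent space at `p` is identified with the model space through this very chart. -/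
theorem dM_extChartAt_self {M : Type*} [TopologicalSpace M] [ChartedSpace E M]
    [IsManifold 𝓘(ℝ, E) ∞ M] (p : M) :
    dM 𝓘(ℝ, E) 𝓘(ℝ, E) (extChartAt 𝓘(ℝ, E) p) p = ContinuousLinearMap.id ℝ E := by
  rw [dM_eq_fderiv_writtenInExtChartAt
    ((contMDiffAt_extChartAt (n := ∞)).mdifferentiableAt (by simp))]
  have : writtenInExtChartAt 𝓘(ℝ, E) 𝓘(ℝ, E) p (extChartAt 𝓘(ℝ, E) p)
      =ᶠ[𝓝 (extChartAt 𝓘(ℝ, E) p p)] id := by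
    filter_upwards [extChartAt_target_mem_nhds (I := 𝓘(ℝ, E)) p] with y hy
    exact (extChartAt 𝓘(ℝ, E) p).right_inv hy
  rw [this.fderiv_eq, fderiv_id]

/-- A vector field in the preferred chart at `p`. -/
def fieldInChart {M : Type*} [TopologicalSpace M] [ChartedSpace E M]
    (X : ∀ x : M, TangentSpace 𝓘(ℝ, E) x) (p : M) (y : E) : E :=
  dM 𝓘(ℝ, E) 𝓘(ℝ, E) (extChartAt 𝓘(ℝ, E) p) ((extChartAt 𝓘(ℝ, E) p).symm y)
    (X ((extChartAt 𝓘(ℝ, E) p).symm y))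

section Charts

variable {M : Type*} [TopologicalSpace M] [ChartedSpace E M] [IsManifold 𝓘(ℝ, E) ∞ M]

theorem dM_extChartAt_symm_comp {p : M} {y : E} (hy : y ∈ (extChartAt 𝓘(ℝ, E) p).target) :
    (dM 𝓘(ℝ, E) 𝓘(ℝ, E) (extChartAt 𝓘(ℝ, E) p).symm y).comp
      (dM 𝓘(ℝ, E) 𝓘(ℝ, E) (extChartAt 𝓘(ℝ, E) p) ((extChartAt 𝓘(ℝ, E) p).symm y)) =
        ContinuousLinearMap.id ℝ E := by
  have h := mfderivWithin_extChartAt_symm_comp_mfderiv_extChartAt (I := 𝓘(ℝ, E)) hy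
  rw [modelWithCornersSelf_coe, Set.range_id, mfderivWithin_univ] at h
  exact h

theorem dM_extChartAt_comp_symm {p : M} {y : E} (hy : y ∈ (extChartAt 𝓘(ℝ, E) p).target) :
    (dM 𝓘(ℝ, E) 𝓘(ℝ, E) (extChartAt 𝓘(ℝ, E) p) ((extChartAt 𝓘(ℝ, E) p).symm y)).comp
      (dM 𝓘(ℝ, E) 𝓘(ℝ, E) (extChartAt 𝓘(ℝ, E) p).symm y) = ContinuousLinearMap.id ℝ E := by
  have h := mfderiv_extChartAt_comp_mfderivWithin_extChartAt_symm (I := 𝓘(ℝ, E)) hy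
  rw [modelWithCornersSelf_coe, Set.range_id, mfderivWithin_univ] at h
  exact h

theorem dM_symm_fieldInChart (X : ∀ x : M, TangentSpace 𝓘(ℝ, E) x) {p : M} {y : E}
    (hy : y ∈ (extChartAt 𝓘(ℝ, E) p).target) :
    dM 𝓘(ℝ, E) 𝓘(ℝ, E) (extChartAt 𝓘(ℝ, E) p).symm y (fieldInChart X p y) =
      X ((extChartAt 𝓘(ℝ, E) p).symm y) :=
  DFunLike.congr_fun (dM_extChartAt_symm_comp hy) _

/-- The manifold bracket is by definition the bracket of the fields pulled back by the inverse
chart. That pullback inverts the derivative of the inverse chart, which is the same as applying the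
derivative of the chart. -/
theorem mlieBracket_eq_lieBracket_fieldInChart (X Y : ∀ x : M, TangentSpace 𝓘(ℝ, E) x) (p : M) :
    (VectorField.mlieBracket 𝓘(ℝ, E) X Y p : E) = VectorField.lieBracket ℝ (fieldInChart X p)
      (fieldInChart Y p) (extChartAt 𝓘(ℝ, E) p p) := by
  let c := extChartAt 𝓘(ℝ, E) p
  let pull : (∀ x : M, TangentSpace 𝓘(ℝ, E) x) → E → E := fun Z y =>
    VectorField.mpullbackWithin 𝓘(ℝ, E) 𝓘(ℝ, E) c.symm Z (Set.range 𝓘(ℝ, E)) y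
  have h1 : (VectorField.mlieBracket 𝓘(ℝ, E) X Y p : E) =
      (dM 𝓘(ℝ, E) 𝓘(ℝ, E) c p).inverse (VectorField.lieBracketWithin ℝ (pull X) (pull Y)
        (c.symm ⁻¹' Set.univ ∩ Set.range 𝓘(ℝ, E)) (c p)) := rfl
  have h2 : ∀ Z, pull Z =ᶠ[𝓝 (c p)] fieldInChart Z p := by
    intro Z
    filter_upwards [extChartAt_target_mem_nhds (I := 𝓘(ℝ, E)) p] with y hy
    have h3 : pull Z y = (dM 𝓘(ℝ, E) 𝓘(ℝ, E) c.symm y).inverse (Z (c.symm y)) := by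
      simp only [pull, VectorField.mpullbackWithin]
      rw [modelWithCornersSelf_coe, Set.range_id, mfderivWithin_univ]
      rfl
    rw [h3, ContinuousLinearMap.inverse_eq (dM_extChartAt_symm_comp hy)
      (dM_extChartAt_comp_symm hy)]
    rfl
  rw [h1, dM_extChartAt_self, ContinuousLinearMap.inverse_id]
  rw [(h2 X).lieBracketWithin_vectorField_eq_nhds (h2 Y), modelWithCornersSelf_coe, Set.range_id,
    Set.preimage_univ, Set.univ_inter, VectorField.lieBracketWithin_univ]
  rfl

end Charts

/-! ### The bracket and the Maurer-Cartan equation -/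

/-- The left-invariant vector field with value `ξ` at `1`. -/
def leftInvField (ξ : E) (g : G) : TangentSpace 𝓘(ℝ, E) g :=
  dM 𝓘(ℝ, E) 𝓘(ℝ, E) (fun x : G => g * x) 1 ξ

theorem leftMC_leftInvField (ξ : E) (g : G) : leftMC (E := E) g (leftInvField ξ g) = ξ := by
  have hl : ∀ a x : G, MDifferentiableAt 𝓘(ℝ, E) 𝓘(ℝ, E) (fun x : G => a * x) x :=
    fun a x => mdifferentiableAt_const_mul a mdifferentiableAt_id
  have h := dM_comp_apply (E₁ := E) (f := fun x : G => g * x) (g := fun x : G => g⁻¹ * x)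
    (x := (1 : G)) (hl g⁻¹ _) (hl g 1) ξ
  simp only [inv_mul_cancel_left, dM_id, mul_one] at h
  exact h.symm

theorem leftInvField_leftMC (u : E) (g : G) : leftInvField (leftMC (E := E) g u) g = u := by
  have hl : ∀ a x : G, MDifferentiableAt 𝓘(ℝ, E) 𝓘(ℝ, E) (fun x : G => a * x) x :=
    fun a x => mdifferentiableAt_const_mul a mdifferentiableAt_id
  have h := dM_comp_apply (E₁ := E) (f := fun x : G => g⁻¹ * x) (g := fun x : G => g * x)
    (x := g) (hl g _) (hl g⁻¹ g) u
  simp only [mul_inv_cancel_left, dM_id, inv_mul_cancel] at h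
  exact h.symm

variable (G) in
/-- The bracket of the Lie algebra of `G`, on the model vector space. -/
def flatBr (ξ ζ : E) : E := lieBr G ξ ζ

theorem flatBr_eq (ξ ζ : E) : flatBr G ξ ζ =
    VectorField.lieBracket ℝ (fieldInChart (leftInvField (G := G) ξ) 1)
      (fieldInChart (leftInvField (G := G) ζ) 1) (extChartAt 𝓘(ℝ, E) (1 : G) 1) :=
  mlieBracket_eq_lieBracket_fieldInChart _ _ (1 : G)

theorem contDiffAt_chart_mul (g : G) :
    ContDiffAt ℝ ∞ (fun q : E × E => extChartAt 𝓘(ℝ, E) g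
      ((extChartAt 𝓘(ℝ, E) g).symm q.1 * (extChartAt 𝓘(ℝ, E) (1 : G)).symm q.2))
      (extChartAt 𝓘(ℝ, E) g g, extChartAt 𝓘(ℝ, E) (1 : G) 1) := by
  let c := extChartAt 𝓘(ℝ, E) (1 : G)
  let c₀ := extChartAt 𝓘(ℝ, E) g
  have h1 : ContMDiffAt 𝓘(ℝ, E × E) 𝓘(ℝ, E) ∞ (fun p : E × E => c₀.symm p.1) (c₀ g, c 1) :=
    ContMDiffAt.comp (c₀ g, c 1) (g := c₀.symm)
      (contMDiffAt_extChartAt_symm_of_mem (mem_extChartAt_target g)) contDiffAt_fst.contMDiffAt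
  have h2 : ContMDiffAt 𝓘(ℝ, E × E) 𝓘(ℝ, E) ∞ (fun p : E × E => c.symm p.2) (c₀ g, c 1) :=
    ContMDiffAt.comp (c₀ g, c 1) (g := c.symm)
      (contMDiffAt_extChartAt_symm_of_mem (mem_extChartAt_target 1)) contDiffAt_snd.contMDiffAt
  have hc : ContMDiffAt 𝓘(ℝ, E) 𝓘(ℝ, E) ∞ c₀ (c₀.symm (c₀ g) * c.symm (c 1)) := by
    have : c₀.symm (c₀ g) * c.symm (c 1) = g := by
      simp only [c, c₀, extChartAt_to_inv, mul_one]
    rw [this]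
    exact contMDiffAt_extChartAt
  exact (ContMDiffAt.comp (c₀ g, c 1) hc (h1.mul h2)).contDiffAt

/-- The value of the field at $h$ is the derivative of $z\mapsto hz$ at $z=1$, hence a partial
derivative of the multiplication read in charts. -/
theorem fieldInChart_leftInvField (g : G) :
    ∀ᶠ y in 𝓝 (extChartAt 𝓘(ℝ, E) g g), ∀ ξ : E,
      fieldInChart (leftInvField (G := G) ξ) g y = fderiv ℝ (fun z => extChartAt 𝓘(ℝ, E) g
        ((extChartAt 𝓘(ℝ, E) g).symm y * (extChartAt 𝓘(ℝ, E) (1 : G)).symm z))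
        (extChartAt 𝓘(ℝ, E) (1 : G) 1) ξ := by
  filter_upwards [extChartAt_target_mem_nhds (I := 𝓘(ℝ, E)) g] with y hy ξ
  set h := (extChartAt 𝓘(ℝ, E) g).symm y with hh
  have hsrc : h ∈ (extChartAt 𝓘(ℝ, E) g).source := (extChartAt 𝓘(ℝ, E) g).map_target hy
  have hc : MDifferentiableAt 𝓘(ℝ, E) 𝓘(ℝ, E) (extChartAt 𝓘(ℝ, E) g) (h * 1) := by
    rw [mul_one]
    exact (contMDiffAt_extChartAt' (n := 1) (by simpa using hsrc)).mdifferentiableAt (by simp)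
  have hl : MDifferentiableAt 𝓘(ℝ, E) 𝓘(ℝ, E) (fun x : G => h * x) 1 :=
    mdifferentiableAt_const_mul h mdifferentiableAt_id
  have h1 := dM_comp_apply (f := fun x : G => h * x) (x := (1 : G)) hc hl ξ
  have hcomp : MDifferentiableAt 𝓘(ℝ, E) 𝓘(ℝ, E)
      (fun x : G => extChartAt 𝓘(ℝ, E) g (h * x)) 1 := MDifferentiableAt.comp (1 : G) hc hl
  rw [dM_eq_fderiv_writtenInExtChartAt hcomp, mul_one] at h1
  exact h1.symm

theorem contDiffAt_fieldInChart_leftInvField (ξ : E) (g : G) :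
    ContDiffAt ℝ ∞ (fieldInChart (leftInvField (G := G) ξ) g) (extChartAt 𝓘(ℝ, E) g g) := by
  have h : ContDiffAt ℝ ∞ (fun y => fderiv ℝ (fun z => extChartAt 𝓘(ℝ, E) g
        ((extChartAt 𝓘(ℝ, E) g).symm y * (extChartAt 𝓘(ℝ, E) (1 : G)).symm z))
        (extChartAt 𝓘(ℝ, E) (1 : G) 1)) (extChartAt 𝓘(ℝ, E) g g) :=
    ContDiffAt.fderiv (n := ∞) (contDiffAt_chart_mul g) contDiffAt_const (by simp)
  refine (h.clm_apply contDiffAt_const (g := fun _ => ξ)).congr_of_eventuallyEq ?_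
  filter_upwards [fieldInChart_leftInvField g] with y hy
  exact hy ξ

/-- Differentiate $gx=(gxg^{-1})g$ at $x=1$: left translation is right translation after
conjugation. -/
theorem fderiv_chart_mul_eq_comp_adGroup :
    ∀ᶠ y in 𝓝 (extChartAt 𝓘(ℝ, E) (1 : G) 1),
      fderiv ℝ (fun z => extChartAt 𝓘(ℝ, E) (1 : G) ((extChartAt 𝓘(ℝ, E) (1 : G)).symm y *
        (extChartAt 𝓘(ℝ, E) (1 : G)).symm z)) (extChartAt 𝓘(ℝ, E) (1 : G) 1) =
      (fderiv ℝ (fun z => extChartAt 𝓘(ℝ, E) (1 : G) ((extChartAt 𝓘(ℝ, E) (1 : G)).symm z *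
        (extChartAt 𝓘(ℝ, E) (1 : G)).symm y)) (extChartAt 𝓘(ℝ, E) (1 : G) 1)).comp
      (adGroup ((extChartAt 𝓘(ℝ, E) (1 : G)).symm y)) := by
  filter_upwards [extChartAt_target_mem_nhds (I := 𝓘(ℝ, E)) (1 : G)] with y hy
  set c := extChartAt 𝓘(ℝ, E) (1 : G)
  set g := c.symm y
  have hsrc : g ∈ c.source := c.map_target hy
  have hc : MDifferentiableAt 𝓘(ℝ, E) 𝓘(ℝ, E) c g :=
    (contMDiffAt_extChartAt' (n := 1) (by simpa [c] using hsrc)).mdifferentiableAt (by simp)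
  have hl : MDifferentiableAt 𝓘(ℝ, E) 𝓘(ℝ, E) (fun x : G => c (g * x)) 1 := by
    refine MDifferentiableAt.comp (1 : G) (g := c) (f := fun x : G => g * x) ?_
      (mdifferentiableAt_const_mul g mdifferentiableAt_id)
    rwa [mul_one]
  have hr : MDifferentiableAt 𝓘(ℝ, E) 𝓘(ℝ, E) (fun x : G => c (x * g)) 1 := by
    refine MDifferentiableAt.comp (1 : G) (g := c) (f := fun x : G => x * g) ?_
      (mdifferentiableAt_mul_const g mdifferentiableAt_id)
    rwa [one_mul]
  have hl' := dM_eq_fderiv_writtenInExtChartAt hl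
  have hr' := dM_eq_fderiv_writtenInExtChartAt hr
  have hcj : g * 1 * g⁻¹ = 1 := by group
  have hcomp := dM_comp (E₁ := E) (f := fun x : G => g * x * g⁻¹) (g := fun x : G => c (x * g))
    (x := (1 : G)) (I := 𝓘(ℝ, E)) (J := 𝓘(ℝ, E)) (K := 𝓘(ℝ, E)) (by rwa [hcj])
    (mdifferentiableAt_conj g 1)
  simp only [inv_mul_cancel_right] at hcomp
  rw [hcj, hl', hr'] at hcomp
  exact hcomp

/-- The derivative of the adjoint representation at `1` is the bracket. -/
theorem dM_adGroup_one (ξ ζ : E) :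
    dM 𝓘(ℝ, E) 𝓘(ℝ, E →L[ℝ] E) (fun g : G => adGroup (E := E) g) 1 ξ ζ = flatBr G ξ ζ := by
  set c := extChartAt 𝓘(ℝ, E) (1 : G) with hcdef
  set e₀ := c 1 with he₀
  let m : E × E → E := fun q => c (c.symm q.1 * c.symm q.2)
  have hm : ContDiffAt ℝ ∞ m (e₀, e₀) := contDiffAt_chart_mul (1 : G)
  let L : E → E →L[ℝ] E := fun y => fderiv ℝ (fun z => m (y, z)) e₀
  let R : E → E →L[ℝ] E := fun y => fderiv ℝ (fun z => m (z, y)) e₀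
  let A : E → E →L[ℝ] E := fun y => adGroup (c.symm y)
  -- The derivatives of `L` and `R` at `e₀` are the two mixed parts of the second derivative of
  -- multiplication in the chart.
  let D2 := fderiv ℝ (fderiv ℝ m) (e₀, e₀)
  have hsymm : ∀ a b, D2 a b = D2 b a := fun a b =>
    (hm.isSymmSndFDerivAt (by simpa using two_le_infty)).eq a b
  have hDm : DifferentiableAt ℝ (fderiv ℝ m) (e₀, e₀) :=
    (hm.fderiv_right (m := ∞) (by simp)).differentiableAt (by simp)
  have hmd : ∀ᶠ q in 𝓝 (e₀, e₀), DifferentiableAt ℝ m q :=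
    ((hm.of_le one_le_infty).eventually (by simp)).mono fun q hq => hq.differentiableAt (by simp)
  have hin1 : HasFDerivAt (fun y : E => (y, e₀)) (ContinuousLinearMap.inl ℝ E E) e₀ :=
    hasFDerivAt_prodMk_left e₀ e₀
  have hin2 : HasFDerivAt (fun y : E => (e₀, y)) (ContinuousLinearMap.inr ℝ E E) e₀ :=
    hasFDerivAt_prodMk_right e₀ e₀
  have hL : HasFDerivAt L ((((ContinuousLinearMap.compL ℝ E (E × E) E).flip
      (ContinuousLinearMap.inr ℝ E E)).comp D2).comp (ContinuousLinearMap.inl ℝ E E)) e₀ := by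
    have h1 := ((ContinuousLinearMap.compL ℝ E (E × E) E).flip
      (ContinuousLinearMap.inr ℝ E E)).hasFDerivAt.comp e₀
      (HasFDerivAt.comp (f := fun y : E => (y, e₀)) e₀ hDm.hasFDerivAt hin1)
    refine h1.congr_of_eventuallyEq ?_
    filter_upwards [hin1.continuousAt.eventually hmd] with y hy
    exact (hy.hasFDerivAt.comp e₀ (hasFDerivAt_prodMk_right y e₀)).fderiv
  have hR : HasFDerivAt R ((((ContinuousLinearMap.compL ℝ E (E × E) E).flip
      (ContinuousLinearMap.inl ℝ E E)).comp D2).comp (ContinuousLinearMap.inr ℝ E E)) e₀ := by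
    have h1 := ((ContinuousLinearMap.compL ℝ E (E × E) E).flip
      (ContinuousLinearMap.inl ℝ E E)).hasFDerivAt.comp e₀
      (HasFDerivAt.comp (f := fun y : E => (e₀, y)) e₀ hDm.hasFDerivAt hin2)
    refine h1.congr_of_eventuallyEq ?_
    filter_upwards [hin2.continuousAt.eventually hmd] with y hy
    exact (HasFDerivAt.comp (f := fun z : E => (z, y)) e₀ hy.hasFDerivAt
      (hasFDerivAt_prodMk_left e₀ y)).fderiv
  have hAdiff : MDifferentiableAt 𝓘(ℝ, E) 𝓘(ℝ, E →L[ℝ] E) (fun g : G => adGroup (E := E) g) 1 :=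
    (contMDiff_adGroup 1).mdifferentiableAt (by simp)
  have hAd : DifferentiableAt ℝ A e₀ := by
    have h1 : MDifferentiableAt 𝓘(ℝ, E) 𝓘(ℝ, E) c.symm e₀ :=
      (contMDiffAt_extChartAt_symm_of_mem (mem_extChartAt_target 1)).mdifferentiableAt (by simp)
    have h2 := MDifferentiableAt.comp e₀ (g := fun g : G => adGroup (E := E) g) (f := c.symm)
      ((contMDiff_adGroup _).mdifferentiableAt (by simp)) h1
    exact h2.differentiableAt
  have hA : dM 𝓘(ℝ, E) 𝓘(ℝ, E →L[ℝ] E) (fun g : G => adGroup (E := E) g) 1 = fderiv ℝ A e₀ :=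
    dM_eq_fderiv_writtenInExtChartAt hAdiff
  have hc1 : c.symm e₀ = 1 := extChartAt_to_inv 1
  have htar := extChartAt_target_mem_nhds (I := 𝓘(ℝ, E)) (1 : G)
  have hR0 : R e₀ = ContinuousLinearMap.id ℝ E := by
    have : (fun z => m (z, e₀)) =ᶠ[𝓝 e₀] id := by
      filter_upwards [htar] with z hz
      change c (c.symm z * c.symm e₀) = z
      rw [hc1, mul_one]
      exact c.right_inv hz
    exact this.fderiv_eq.trans fderiv_id
  have hL0 : L e₀ = ContinuousLinearMap.id ℝ E := by
    have : (fun z => m (e₀, z)) =ᶠ[𝓝 e₀] id := by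
      filter_upwards [htar] with z hz
      change c (c.symm e₀ * c.symm z) = z
      rw [hc1, one_mul]
      exact c.right_inv hz
    exact this.fderiv_eq.trans fderiv_id
  have hA0 : A e₀ = ContinuousLinearMap.id ℝ E := by
    change adGroup (c.symm e₀) = _
    rw [hc1, adGroup_one]
  -- The product rule applied to $L=R\circ A$, where $R$ and $A$ are the identity at the base point.
  have hprod : ∀ v w, D2 (v, 0) (0, w) = D2 (0, v) (w, 0) + fderiv ℝ A e₀ v w := by
    intro v w
    have h1 := (hR.clm_comp hAd.hasFDerivAt).congr_of_eventuallyEq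
      (fderiv_chart_mul_eq_comp_adGroup (E := E) (G := G))
    have h2 := DFunLike.congr_fun (DFunLike.congr_fun (hL.unique h1) v) w
    rw [hR0, hA0] at h2
    have h3 : D2 (v, 0) (0, w) = fderiv ℝ A e₀ v w + D2 (0, v) (w, 0) := h2
    rw [h3, add_comm]
  have hfield : ∀ w : E, fieldInChart (leftInvField (G := G) w) 1 =ᶠ[𝓝 e₀] fun y => L y w := by
    intro w
    filter_upwards [fieldInChart_leftInvField (E := E) (1 : G)] with y hy
    exact hy w
  have hfd : ∀ v w : E, fderiv ℝ (fieldInChart (leftInvField (G := G) w) 1) e₀ v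
      = D2 (v, 0) (0, w) := by
    intro v w
    rw [(hfield w).fderiv_eq, (hL.clm_apply (hasFDerivAt_const w e₀)).fderiv]
    simp
  have hf0 : ∀ w : E, fieldInChart (leftInvField (G := G) w) 1 e₀ = w := by
    intro w
    have h1 : fieldInChart (leftInvField (G := G) w) 1 e₀ = L e₀ w := (hfield w).self_of_nhds
    rw [h1, hL0]
    rfl
  -- The bracket is the antisymmetrized mixed second derivative. By `hprod` and symmetry of `D2`,
  -- the symmetric parts cancel and only the derivative of `A` remains.
  have hbr : flatBr G ξ ζ = D2 (ξ, 0) (0, ζ) - D2 (ζ, 0) (0, ξ) := by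
    rw [flatBr_eq, VectorField.lieBracket, ← hcdef, ← he₀, hf0, hf0, hfd, hfd]
  rw [hA, hbr, hprod, hsymm (ζ, 0)]
  abel

/-- In charts, $\lambda_h$ is the derivative of $z\mapsto h^{-1}z$ at $z=h$: a partial derivative of
a jointly smooth map, evaluated on the diagonal. -/
theorem contDiffAt_leftMC_chart (g : G) :
    ContDiffAt ℝ ∞ (fun y => (leftMC ((extChartAt 𝓘(ℝ, E) g).symm y)).comp
      (dM 𝓘(ℝ, E) 𝓘(ℝ, E) (extChartAt 𝓘(ℝ, E) g).symm y)) (extChartAt 𝓘(ℝ, E) g g) := by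
  set c₀ := extChartAt 𝓘(ℝ, E) g with hc₀
  let c := extChartAt 𝓘(ℝ, E) (1 : G)
  have h : ContDiffAt ℝ ∞ (fun y => fderiv ℝ (fun z => c ((c₀.symm y)⁻¹ * c₀.symm z)) y) (c₀ g) := by
    refine ContDiffAt.fderiv (n := ∞) (f := fun y z => c ((c₀.symm y)⁻¹ * c₀.symm z))
      (g := fun y => y) ?_ contDiffAt_id (by simp)
    have h1 : ContMDiffAt 𝓘(ℝ, E × E) 𝓘(ℝ, E) ∞ (fun p : E × E => c₀.symm p.1) (c₀ g, c₀ g) :=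
      ContMDiffAt.comp (c₀ g, c₀ g) (g := c₀.symm)
        (contMDiffAt_extChartAt_symm_of_mem (mem_extChartAt_target g)) contDiffAt_fst.contMDiffAt
    have h2 : ContMDiffAt 𝓘(ℝ, E × E) 𝓘(ℝ, E) ∞ (fun p : E × E => c₀.symm p.2) (c₀ g, c₀ g) :=
      ContMDiffAt.comp (c₀ g, c₀ g) (g := c₀.symm)
        (contMDiffAt_extChartAt_symm_of_mem (mem_extChartAt_target g)) contDiffAt_snd.contMDiffAt
    have hc : ContMDiffAt 𝓘(ℝ, E) 𝓘(ℝ, E) ∞ c ((c₀.symm (c₀ g))⁻¹ * c₀.symm (c₀ g)) := by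
      rw [inv_mul_cancel]
      exact contMDiffAt_extChartAt
    exact (ContMDiffAt.comp (c₀ g, c₀ g) hc (h1.inv.mul h2)).contDiffAt
  refine h.congr_of_eventuallyEq ?_
  filter_upwards [extChartAt_target_mem_nhds (I := 𝓘(ℝ, E)) g] with y hy
  have hd : MDifferentiableAt 𝓘(ℝ, E) 𝓘(ℝ, E) c₀.symm y :=
    (contMDiffAt_extChartAt_symm_of_mem hy).mdifferentiableAt (by simp)
  rw [leftMC_comp hd, dM_eq_fderiv_writtenInExtChartAt (mdifferentiableAt_const_mul _ hd)]
  simp only [writtenInExtChartAt, inv_mul_cancel]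
  rfl

variable (G) in
/-- The left-invariant 1-form with value `μ` at `1`. -/
def leftInvForm (μ : LieDual E) : DiffForm 𝓘(ℝ, E) G 1 :=
  fun g => ContinuousAlternatingMap.ofSubsingleton ℝ E ℝ (0 : Fin 1) (μ.comp (leftMC g))

theorem isSmoothForm_leftInvForm (μ : LieDual E) : IsSmoothForm 𝓘(ℝ, E) (leftInvForm G μ) := by
  intro g
  let e₁ := ContinuousAlternatingMap.ofSubsingletonLIE (𝕜 := ℝ) (E := E) (F := ℝ) (0 : Fin 1)
  exact e₁.contDiff.contDiffAt.comp _ (contDiffAt_const.clm_comp (contDiffAt_leftMC_chart g)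
    (g := fun _ => μ))

/-- The Maurer-Cartan equation. -/
theorem flat_extDerivForm_leftInvForm [CompleteSpace E] (μ : LieDual E) (g : G) (u v : E) :
    flat 𝓘(ℝ, E) (extDerivForm 𝓘(ℝ, E) (leftInvForm G μ)) g ![u, v] =
      -μ (flatBr G (leftMC g u) (leftMC g v)) := by
  set c := extChartAt 𝓘(ℝ, E) g with hc
  set ξ : E := leftMC g u with hξ
  set ζ : E := leftMC g v with hζ
  let F := formInChart 𝓘(ℝ, E) (leftInvForm G μ) g
  -- The arguments `u`, `v` are extended to left-invariant fields.
  let X : Fin 2 → E → E := ![fieldInChart (leftInvField (G := G) ξ) g,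
    fieldInChart (leftInvField (G := G) ζ) g]
  have hcg : c.symm (c g) = g := extChartAt_to_inv g
  have hX0 : ∀ w : E, fieldInChart (leftInvField (G := G) w) g (c g)
      = leftInvField (G := G) w g := by
    intro w
    have h1 : fieldInChart (leftInvField (G := G) w) g (c g) =
      dM 𝓘(ℝ, E) 𝓘(ℝ, E) c (c.symm (c g)) (leftInvField (G := G) w (c.symm (c g))) := rfl
    rw [h1, hcg, hc, dM_extChartAt_self]
    rfl
  have hFdiff : DifferentiableAt ℝ F (c g) :=
    (isSmoothForm_leftInvForm μ g).differentiableAt (by simp)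
  have hXdiff : ∀ i, DifferentiableAt ℝ (X i) (c g) := by
    intro i
    fin_cases i
    · exact (contDiffAt_fieldInChart_leftInvField ξ g).differentiableAt (by simp)
    · exact (contDiffAt_fieldInChart_leftInvField ζ g).differentiableAt (by simp)
  -- On a left-invariant field the form is constant, so in the formula for $d$ on vector fields only
  -- the bracket term survives.
  have hconst : ∀ w : E, ∀ᶠ y in 𝓝 (c g), ∀ t : Fin 1 → E,
      t 0 = fieldInChart (leftInvField (G := G) w) g y → F y t = μ w := by
    intro w
    filter_upwards [extChartAt_target_mem_nhds (I := 𝓘(ℝ, E)) g] with y hy t ht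
    have h1 : F y t = μ (leftMC (c.symm y) (dM 𝓘(ℝ, E) 𝓘(ℝ, E) c.symm y (t 0))) := rfl
    rw [h1, ht, dM_symm_fieldInChart _ hy]
    exact congrArg μ (leftMC_leftInvField w _)
  have hval : flat 𝓘(ℝ, E) (extDerivForm 𝓘(ℝ, E) (leftInvForm G μ)) g ![u, v] =
      extDeriv F (c g) (fun i => X i (c g)) := by
    rw [flat_extDerivForm, dM_extChartAt_self]
    change extDeriv F (c g) _ = _
    congr 1
    funext i
    fin_cases i
    · exact ((hX0 ξ).trans (leftInvField_leftMC u g)).symm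
    · exact ((hX0 ζ).trans (leftInvField_leftMC v g)).symm
  have hbr : VectorField.lieBracket ℝ (fieldInChart (leftInvField (G := G) ξ) g)
      (fieldInChart (leftInvField (G := G) ζ) g) (c g) = leftInvField (flatBr G ξ ζ) g := by
    rw [← mlieBracket_eq_lieBracket_fieldInChart]
    have : LieGroup 𝓘(ℝ, E) (minSmoothness ℝ 3) G := LieGroup.of_le (n := ∞) (by
      simpa using WithTop.coe_le_coe.2 (le_top : (3 : ℕ∞) ≤ ⊤))
    exact (congrFun (mulInvariantVector_mlieBracket (I := 𝓘(ℝ, E)) (G := G) ξ ζ) g).symm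
  have h0 : fderiv ℝ (fun y => F y ((0 : Fin 2).removeNth (X · y))) (c g) = 0 := by
    have : (fun y => F y ((0 : Fin 2).removeNth (X · y))) =ᶠ[𝓝 (c g)] fun _ => μ ζ := by
      filter_upwards [hconst ζ] with y hy
      exact hy _ rfl
    rw [this.fderiv_eq]
    exact fderiv_const_apply _
  have h1 : fderiv ℝ (fun y => F y ((1 : Fin 2).removeNth (X · y))) (c g) = 0 := by
    have : (fun y => F y ((1 : Fin 2).removeNth (X · y))) =ᶠ[𝓝 (c g)] fun _ => μ ξ := by
      filter_upwards [hconst ξ] with y hy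
      exact hy _ rfl
    rw [this.fderiv_eq]
    exact fderiv_const_apply _
  have hlast : ∀ t : Fin 1 → E, t 0 = leftInvField (flatBr G ξ ζ) g →
      F (c g) t = μ (flatBr G ξ ζ) := fun t ht =>
    (hconst (flatBr G ξ ζ)).self_of_nhds t (ht.trans (hX0 _).symm)
  rw [hval, extDeriv_apply_vectorField hFdiff hXdiff, Fin.sum_univ_two, h0, h1]
  simp only [Fin.isValue, zero_apply, smul_zero, add_zero, zero_sub]
  congr 1
  refine (Fin.sum_univ_one _).trans ((Finset.sum_eq_single_of_mem (0 : Fin 1) (by simp)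
    fun j _ hj => absurd (Subsingleton.elim j 0) hj).trans ?_)
  simp only [Fin.val_zero, add_zero, pow_zero, one_smul]
  exact hlast _ hbr

end LieCalculus

end

noncomputable section

/-! ### The coadjoint action and Lie subgroups -/

section Coadjoint

set_option linter.unusedSectionVars false

variable {E : Type*} [NormedAddCommGroup E] [NormedSpace ℝ E]
  {G : Type*} [TopologicalSpace G] [ChartedSpace E G] [Group G] [LieGroup 𝓘(ℝ, E) ∞ G]

theorem mdifferentiableAt_adGroup (g : G) :
    MDifferentiableAt 𝓘(ℝ, E) 𝓘(ℝ, E →L[ℝ] E) (fun g : G => adGroup (E := E) g) g :=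
  (contMDiff_adGroup g).mdifferentiableAt (by simp)

/-- Differentiate $\mathrm{Ad}_{ghg^{-1}}=\mathrm{Ad}_g\,\mathrm{Ad}_h\,\mathrm{Ad}_{g^{-1}}$ at
$h=1$. -/
theorem adGroup_flatBr (g : G) (ξ ζ : E) :
    adGroup g (flatBr G ξ ζ) = flatBr G (adGroup g ξ) (adGroup g ζ) := by
  have h1 : (fun h : G => adGroup (E := E) (g * h * g⁻¹)) =
      fun h : G => ((ContinuousLinearMap.compL ℝ E E E (adGroup g)).comp
        ((ContinuousLinearMap.compL ℝ E E E).flip (adGroup g⁻¹))) (adGroup h) := by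
    funext h
    rw [adGroup_mul, adGroup_mul]
    rfl
  have hc : g * 1 * g⁻¹ = 1 := by group
  have h2 := dM_comp_apply (E₁ := E) (f := fun h : G => g * h * g⁻¹)
    (g := fun h : G => adGroup (E := E) h) (x := (1 : G)) (mdifferentiableAt_adGroup _)
    (mdifferentiableAt_conj g 1) ξ
  rw [h1, dM_clm_comp _ (mdifferentiableAt_adGroup 1), hc] at h2
  have h3 := DFunLike.congr_fun h2 (adGroup g ζ)
  have h4 : adGroup g (dM 𝓘(ℝ, E) 𝓘(ℝ, E →L[ℝ] E) (fun h : G => adGroup (E := E) h) 1 ξ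
      (adGroup g⁻¹ (adGroup g ζ))) = dM 𝓘(ℝ, E) 𝓘(ℝ, E →L[ℝ] E)
      (fun h : G => adGroup (E := E) h) 1 (adGroup g ξ) (adGroup g ζ) := h3
  rwa [adGroup_inv_apply, dM_adGroup_one, dM_adGroup_one] at h4

theorem flatBr_neg_left (ξ ζ : E) : flatBr G (-ξ) ζ = -flatBr G ξ ζ := by
  rw [← dM_adGroup_one, ← dM_adGroup_one, map_neg]
  rfl

/-- The derivative of `g ↦ Ad_{g⁻¹}`. -/
theorem dM_adGroup_inv (g : G) (v x : E) :
    dM 𝓘(ℝ, E) 𝓘(ℝ, E →L[ℝ] E) (fun h : G => adGroup (E := E) h⁻¹) g v x =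
      -adGroup g⁻¹ (flatBr G (adGroup g (leftMC g v)) x) := by
  -- Since $h^{-1}=g^{-1}u(h)$ and $u(g)=1$, only the derivative of $\mathrm{Ad}$ at $1$ is needed.
  let u : G → G := fun h => g * h⁻¹
  have hu0 : MDifferentiableAt 𝓘(ℝ, E) 𝓘(ℝ, E) (fun h : G => g⁻¹ * h) g :=
    mdifferentiableAt_const_mul _ mdifferentiableAt_id
  have hu : MDifferentiableAt 𝓘(ℝ, E) 𝓘(ℝ, E) u g :=
    mdifferentiableAt_const_mul _ (mdifferentiableAt_inv mdifferentiableAt_id)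
  have hdu : dM 𝓘(ℝ, E) 𝓘(ℝ, E) u g = -(adGroup g).comp (leftMC g) := by
    have e : u = fun h => (g * (g⁻¹ * h) * g⁻¹)⁻¹ := by funext h; simp only [u]; group
    rw [e, dM_inv_of_eq_one (u := fun h => g * (g⁻¹ * h) * g⁻¹)
      (mdifferentiableAt_mul_const _ (mdifferentiableAt_const_mul _ hu0)) (by group),
      dM_conj_of_eq_one g hu0 (by group)]
    rfl
  have h1 : (fun h : G => adGroup (E := E) h⁻¹) =
      fun h : G => ContinuousLinearMap.compL ℝ E E E (adGroup g⁻¹) (adGroup (u h)) := by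
    funext h
    have : h⁻¹ = g⁻¹ * (g * h⁻¹) := by group
    rw [this, adGroup_mul]
    rfl
  have hAu : MDifferentiableAt 𝓘(ℝ, E) 𝓘(ℝ, E →L[ℝ] E) (fun h : G => adGroup (E := E) (u h)) g :=
    MDifferentiableAt.comp g (mdifferentiableAt_adGroup _) hu
  have hug : u g = 1 := mul_inv_cancel g
  rw [h1, dM_clm_comp _ hAu, dM_comp (mdifferentiableAt_adGroup (E := E) (u g)) hu, hug, hdu]
  change adGroup g⁻¹ (dM 𝓘(ℝ, E) 𝓘(ℝ, E →L[ℝ] E) (fun h : G => adGroup (E := E) h) 1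
    (-(adGroup g (leftMC g v))) x) = _
  rw [dM_adGroup_one, flatBr_neg_left, map_neg]

theorem contMDiff_projCoAd (P : E →L[ℝ] E) (σ : LieDual E) :
    ContMDiff 𝓘(ℝ, E) 𝓘(ℝ, LieDual E) ∞ (fun g : G => projCoAd P g σ) := by
  have h1 : ContMDiff 𝓘(ℝ, E) 𝓘(ℝ, E →L[ℝ] E) ∞ (fun g : G => adGroup (E := E) g⁻¹) :=
    contMDiff_adGroup.comp (contMDiff_inv 𝓘(ℝ, E) ∞)
  let Φ : (E →L[ℝ] E) →L[ℝ] LieDual E :=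
    ((ContinuousLinearMap.compL ℝ E E ℝ).flip P).comp (ContinuousLinearMap.compL ℝ E E ℝ σ)
  exact Φ.contDiff.contMDiff.comp h1

theorem projCoAd_apply (P : E →L[ℝ] E) (g : G) (σ : LieDual E) (x : E) :
    projCoAd P g σ x = σ (adGroup g⁻¹ (P x)) := rfl

theorem dM_projCoAd (P : E →L[ℝ] E) (σ : LieDual E) (g : G) (v x : E) :
    dM 𝓘(ℝ, E) 𝓘(ℝ, LieDual E) (fun g : G => projCoAd P g σ) g v x =
      -coAd g σ (flatBr G (adGroup g (leftMC g v)) (P x)) := by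
  have h1 : MDifferentiableAt 𝓘(ℝ, E) 𝓘(ℝ, E →L[ℝ] E) (fun g : G => adGroup (E := E) g⁻¹) g :=
    (contMDiff_adGroup.comp (contMDiff_inv 𝓘(ℝ, E) ∞) g).mdifferentiableAt (n := ∞) (by simp)
  let Φ : (E →L[ℝ] E) →L[ℝ] LieDual E :=
    ((ContinuousLinearMap.compL ℝ E E ℝ).flip P).comp (ContinuousLinearMap.compL ℝ E E ℝ σ)
  have h2 : dM 𝓘(ℝ, E) 𝓘(ℝ, LieDual E) (fun g : G => projCoAd P g σ) g =
      Φ.comp (dM 𝓘(ℝ, E) 𝓘(ℝ, E →L[ℝ] E) (fun g : G => adGroup (E := E) g⁻¹) g) :=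
    dM_clm_comp Φ h1
  rw [h2]
  change σ (dM 𝓘(ℝ, E) 𝓘(ℝ, E →L[ℝ] E) (fun g : G => adGroup (E := E) g⁻¹) g v (P x)) = _
  rw [dM_adGroup_inv, map_neg]
  rfl

theorem coAd_mul (g h : G) (σ : LieDual E) : coAd (g * h) σ = coAd g (coAd h σ) := by
  ext x
  change σ (adGroup (g * h)⁻¹ x) = σ (adGroup h⁻¹ (adGroup g⁻¹ x))
  rw [mul_inv_rev, adGroup_mul]
  rfl

theorem coAd_one (σ : LieDual E) : coAd (1 : G) σ = σ := by
  ext x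
  change σ (adGroup (1 : G)⁻¹ x) = σ x
  rw [inv_one, adGroup_one]
  rfl

/-! #### Lie subgroups -/

variable {EK : Type*} [NormedAddCommGroup EK] [NormedSpace ℝ EK]
  {K : Subgroup G} [ChartedSpace EK K] [LieGroup 𝓘(ℝ, EK) ∞ K]

/-- The inclusion is a homomorphism, so it intertwines the left translations of `K` and `G`. -/
theorem leftMC_incl (hι : ContMDiff 𝓘(ℝ, EK) 𝓘(ℝ, E) ∞ (Subtype.val : K → G)) (k : K) (v : EK) :
    leftMC (k : G) (dM 𝓘(ℝ, EK) 𝓘(ℝ, E) (Subtype.val : K → G) k v) =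
      inclDeriv (E := E) (EA := EK) K (leftMC k v) := by
  have hd : ∀ k, MDifferentiableAt 𝓘(ℝ, EK) 𝓘(ℝ, E) (Subtype.val : K → G) k :=
    hι.mdifferentiable (by simp)
  have h1 := DFunLike.congr_fun (leftMC_comp (hd k)) v
  have h2 := dM_comp_apply (E₁ := EK) (f := fun x : K => k⁻¹ * x) (g := (Subtype.val : K → G))
    (x := k) (hd _) (mdifferentiableAt_const_mul _ mdifferentiableAt_id) v
  rw [inv_mul_cancel] at h2
  exact h1.trans h2

theorem leftMC_incl_mem (hι : ContMDiff 𝓘(ℝ, EK) 𝓘(ℝ, E) ∞ (Subtype.val : K → G)) (k : K)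
    (v : EK) : leftMC (k : G) (dM 𝓘(ℝ, EK) 𝓘(ℝ, E) (Subtype.val : K → G) k v) ∈
      lieOfSubgroup E EK K :=
  ⟨_, (leftMC_incl hι k v).symm⟩

/-- Conjugation by an element of `K` commutes with the inclusion of `K`; differentiate at $1$. -/
theorem adGroup_mem (hι : ContMDiff 𝓘(ℝ, EK) 𝓘(ℝ, E) ∞ (Subtype.val : K → G)) (k : K)
    {ξ : E} (hξ : ξ ∈ lieOfSubgroup E EK K) : adGroup (k : G) ξ ∈ lieOfSubgroup E EK K := by
  obtain ⟨w, rfl⟩ := hξ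
  have hd : ∀ k, MDifferentiableAt 𝓘(ℝ, EK) 𝓘(ℝ, E) (Subtype.val : K → G) k :=
    hι.mdifferentiable (by simp)
  refine ⟨adGroup k w, ?_⟩
  have h1 := dM_comp_apply (E₁ := EK) (f := fun x : K => k * x * k⁻¹) (g := (Subtype.val : K → G))
    (x := 1) (hd _) (mdifferentiableAt_conj k 1) w
  have hc : k * 1 * k⁻¹ = 1 := by group
  rw [hc] at h1
  have h2 := DFunLike.congr_fun (dM_conj_of_eq_one (k : G) (hd 1) rfl) w
  exact h1.symm.trans h2

/-- Right trivialization maps onto the Lie algebra of `K`: take the left-invariant field of `K` with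
value $\mathrm{Ad}_{k^{-1}}\xi$ at $1$. -/
theorem exists_adGroup_leftMC_incl (hι : ContMDiff 𝓘(ℝ, EK) 𝓘(ℝ, E) ∞ (Subtype.val : K → G))
    (k : K) {ξ : E} (hξ : ξ ∈ lieOfSubgroup E EK K) :
    ∃ w : EK, adGroup (k : G) (leftMC (k : G)
      (dM 𝓘(ℝ, EK) 𝓘(ℝ, E) (Subtype.val : K → G) k w)) = ξ := by
  have h1 := adGroup_mem hι k⁻¹ hξ
  obtain ⟨w, hw⟩ := h1
  have h2 : leftMC (E := EK) k (leftInvField w k) = w := leftMC_leftInvField w k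
  refine ⟨leftInvField w k, (congrArg _ (leftMC_incl hι k _)).trans ?_⟩
  refine (congrArg (fun z => adGroup (k : G) (inclDeriv (E := E) (EA := EK) K z)) h2).trans ?_
  have h3 : inclDeriv (E := E) (EA := EK) K w = adGroup ((k⁻¹ : K) : G) ξ := hw
  rw [h3]
  exact adGroup_apply_inv (k : G) ξ

/-- $\mathrm{Ad}_k\zeta$ stays in $\mathfrak k$ for $k\in K$, so a linear map that vanishes on
$\mathfrak k$ annihilates its derivative at $k=1$, which is $[\xi,\zeta]$. No comparison of the
brackets of `K` and `G` is needed. -/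
theorem flatBr_mem [FiniteDimensional ℝ E]
    (hι : ContMDiff 𝓘(ℝ, EK) 𝓘(ℝ, E) ∞ (Subtype.val : K → G))
    {ξ ζ : E} (hξ : ξ ∈ lieOfSubgroup E EK K) (hζ : ζ ∈ lieOfSubgroup E EK K) :
    flatBr G ξ ζ ∈ lieOfSubgroup E EK K := by
  set 𝔨 := lieOfSubgroup E EK K with h𝔨
  obtain ⟨pr, hpr⟩ := 𝔨.subtype.exists_leftInverse_of_injective (Submodule.ker_subtype _)
  -- `L` is the identity minus a projection onto $\mathfrak k$, so its kernel is exactly $\mathfrak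
  -- k$.
  let L : E →L[ℝ] E := LinearMap.toContinuousLinearMap (LinearMap.id - 𝔨.subtype.comp pr)
  have hL : ∀ x, L x = x - pr x := fun x => rfl
  have hLk : ∀ x ∈ 𝔨, L x = 0 := by
    intro x hx
    have := LinearMap.congr_fun hpr ⟨x, hx⟩
    have h2 : pr x = ⟨x, hx⟩ := this
    rw [hL, h2, sub_self]
  obtain ⟨w, hw⟩ := hξ
  have hw' : dM 𝓘(ℝ, EK) 𝓘(ℝ, E) (Subtype.val : K → G) 1 w = ξ := hw
  have hd : MDifferentiableAt 𝓘(ℝ, EK) 𝓘(ℝ, E) (Subtype.val : K → G) 1 :=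
    hι.mdifferentiable (by simp) 1
  let Φ : (E →L[ℝ] E) →L[ℝ] E := L.comp (ContinuousLinearMap.apply ℝ E ζ)
  have hAι : MDifferentiableAt 𝓘(ℝ, EK) 𝓘(ℝ, E →L[ℝ] E)
      (fun k : K => adGroup (E := E) (k : G)) 1 :=
    MDifferentiableAt.comp (1 : K) (mdifferentiableAt_adGroup _) hd
  have hzero : (fun k : K => Φ (adGroup (E := E) (k : G))) = fun _ => 0 := by
    funext k
    exact hLk _ (adGroup_mem hι k hζ)
  have h1 := dM_clm_comp Φ hAι
  rw [hzero, dM_const, dM_comp (mdifferentiableAt_adGroup (E := E) _) hd] at h1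
  have h2 := DFunLike.congr_fun h1 w
  have h3 : (0 : E) = L (dM 𝓘(ℝ, E) 𝓘(ℝ, E →L[ℝ] E) (fun g : G => adGroup (E := E) g) 1
    (dM 𝓘(ℝ, EK) 𝓘(ℝ, E) (Subtype.val : K → G) 1 w) ζ) := h2
  rw [hw', dM_adGroup_one, hL] at h3
  rw [sub_eq_zero.1 h3.symm]
  exact (pr _).2

end Coadjoint

end

noncomputable section

/-! ### The symplectic form of an orbit -/

section Descent

variable {E₁ H₁ E₂ H₂ M N : Type*}
  [NormedAddCommGroup E₁] [NormedSpace ℝ E₁] [TopologicalSpace H₁]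
  [NormedAddCommGroup E₂] [NormedSpace ℝ E₂] [TopologicalSpace H₂] [FiniteDimensional ℝ E₂]
  {I : ModelWithCorners ℝ E₁ H₁} {J : ModelWithCorners ℝ E₂ H₂}
  [TopologicalSpace M] [ChartedSpace H₁ M] [TopologicalSpace N] [ChartedSpace H₂ N]

theorem compContinuousLinearMap_pair {V W : Type*} [NormedAddCommGroup V] [NormedSpace ℝ V]
    [NormedAddCommGroup W] [NormedSpace ℝ W] (η : W [⋀^Fin 2]→L[ℝ] ℝ) (L : V →L[ℝ] W) (u v : V) :
    η.compContinuousLinearMap L ![u, v] = η ![L u, L v] := by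
  change η _ = η _
  congr 1
  funext i
  fin_cases i <;> rfl

theorem alternating_two_ext {V : Type*} [NormedAddCommGroup V] [NormedSpace ℝ V]
    {η η' : V [⋀^Fin 2]→L[ℝ] ℝ} (h : ∀ u v, η ![u, v] = η' ![u, v]) : η = η' := by
  ext t
  have ht : t = ![t 0, t 1] := by
    funext i
    fin_cases i <;> rfl
  rw [ht, h]

/-- A basic 2-form on the domain of a surjective submersion descends to the target. -/
theorem IsSmoothSubmersion.exists_pullbackForm_eq {q : M → N} (hq : IsSmoothSubmersion I J q)
    (hsurj : Function.Surjective q) (Θ : DiffForm I M 2)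
    (hΘ : ∀ x y, q x = q y → ∀ u u' v v' : E₁, dM I J q x u = dM I J q y v →
      dM I J q x u' = dM I J q y v' → flat I Θ x ![u, u'] = flat I Θ y ![v, v']) :
    ∃ Ω : DiffForm J N 2, pullbackForm I J q Ω = Θ := by
  have key : ∀ p : N, ∃ η : E₂ [⋀^Fin 2]→L[ℝ] ℝ, ∀ x, q x = p → ∀ u u',
      η ![dM I J q x u, dM I J q x u'] = flat I Θ x ![u, u'] := by
    intro p
    obtain ⟨y, rfl⟩ := hsurj p
    have hs : Function.Surjective (dM I J q y) := hq.2 y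
    obtain ⟨R, hR⟩ := (dM I J q y).toLinearMap.exists_rightInverse_of_surjective
      (LinearMap.range_eq_top.2 hs)
    have hR' : ∀ w, dM I J q y (R w) = w := fun w => LinearMap.congr_fun hR w
    -- The value is built from one chosen preimage and a linear right inverse of the derivative
    -- there; `hΘ` makes it independent of these choices.
    refine ⟨(flat I Θ y).compContinuousLinearMap (LinearMap.toContinuousLinearMap R), ?_⟩
    intro x hx u u'
    rw [compContinuousLinearMap_pair]
    exact (hΘ x y hx _ _ _ _ (hR' _).symm (hR' _).symm).symm
  choose η hη using key
  refine ⟨η, form_ext fun x => alternating_two_ext fun u v => ?_⟩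
  exact (compContinuousLinearMap_pair (η (q x)) (dM I J q x) u v).trans (hη (q x) x rfl u v)

end Descent

/-! ### The Kirillov-Kostant form -/

section OrbitForm

set_option linter.unusedSectionVars false

variable {E : Type*} [NormedAddCommGroup E] [NormedSpace ℝ E] [FiniteDimensional ℝ E]
  {G : Type*} [TopologicalSpace G] [ChartedSpace E G] [Group G] [LieGroup 𝓘(ℝ, E) ∞ G]
  {EK : Type*} [NormedAddCommGroup EK] [NormedSpace ℝ EK]
  {K : Subgroup G} [ChartedSpace EK K] [LieGroup 𝓘(ℝ, EK) ∞ K]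

theorem flatBr_swap (ξ ζ : E) : flatBr G ξ ζ = -flatBr G ζ ξ := by
  have h := VectorField.mlieBracket_swap_apply (I := 𝓘(ℝ, E)) (x := (1 : G))
    (V := mulInvariantVectorField (I := 𝓘(ℝ, E)) (G := G) ξ)
    (W := mulInvariantVectorField (I := 𝓘(ℝ, E)) (G := G) ζ)
  exact h

/-- The pullback of `- d(μ(λ))` to the Lie subgroup `K`. -/
def orbitPullback (EK : Type*) [NormedAddCommGroup EK] [NormedSpace ℝ EK]
    (K : Subgroup G) [ChartedSpace EK K] (μ : LieDual E) : DiffForm 𝓘(ℝ, EK) K 2 :=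
  -pullbackForm 𝓘(ℝ, EK) 𝓘(ℝ, E) (Subtype.val : K → G) (extDerivForm 𝓘(ℝ, E) (leftInvForm G μ))

/-- The right-invariant value `Ad_k (k⁻¹ dk)` in the Lie algebra of `G`. -/
def rightMC (k : K) (w : EK) : E :=
  adGroup (k : G) (leftMC (k : G) (dM 𝓘(ℝ, EK) 𝓘(ℝ, E) (Subtype.val : K → G) k w))

variable {P : E →L[ℝ] E} {μ : LieDual E}

theorem rightMC_mem (hι : ContMDiff 𝓘(ℝ, EK) 𝓘(ℝ, E) ∞ (Subtype.val : K → G)) (k : K) (w : EK) :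
    (rightMC k w : E) ∈ lieOfSubgroup E EK K :=
  adGroup_mem hι k (leftMC_incl_mem hι k w)

theorem projCoAd_eq_coAd (hP : ∀ x ∈ lieOfSubgroup E EK K, P x = x) (g : G) {x : E}
    (hx : x ∈ lieOfSubgroup E EK K) : projCoAd P g μ x = coAd g μ x :=
  congrArg (coAd g μ) (hP x hx)

/-- The Maurer-Cartan equation gives $\mu([\lambda u,\lambda v])$, the sign cancelling the one in
`orbitPullback`. Passing to right trivialization with $\mathrm{Ad}_k$ replaces $\mu$ by
$\mathrm{Ad}^\sharp_k\mu$, and the bracket lies in $\mathfrak k$, where `P` is the identity. -/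
theorem flat_orbitPullback (hι : ContMDiff 𝓘(ℝ, EK) 𝓘(ℝ, E) ∞ (Subtype.val : K → G))
    (hP : ∀ x ∈ lieOfSubgroup E EK K, P x = x) (k : K) (u v : EK) :
    flat 𝓘(ℝ, EK) (orbitPullback EK K μ) k ![u, v] =
      projCoAd P (k : G) μ (flatBr G (rightMC k u) (rightMC k v)) := by
  have h1 : flat 𝓘(ℝ, EK) (orbitPullback EK K μ) k ![u, v] =
      -((flat 𝓘(ℝ, E) (extDerivForm 𝓘(ℝ, E) (leftInvForm G μ)) (k : G)).compContinuousLinearMap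
        (dM 𝓘(ℝ, EK) 𝓘(ℝ, E) (Subtype.val : K → G) k) ![u, v]) := rfl
  rw [h1, compContinuousLinearMap_pair, flat_extDerivForm_leftInvForm, neg_neg,
    projCoAd_eq_coAd hP _ (flatBr_mem hι (rightMC_mem hι k u) (rightMC_mem hι k v)),
    rightMC, rightMC, ← adGroup_flatBr]
  exact congrArg μ (adGroup_inv_apply (k : G) _).symm

/-- The bracket lies in $\mathfrak k$, so $\mathrm{Ad}^\sharp_k\mu$ may be replaced there by the
orbit point. Hence the image of `w` is the orbit vector generated by `rightMC k w`. -/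
theorem dM_projCoAd_incl (hι : ContMDiff 𝓘(ℝ, EK) 𝓘(ℝ, E) ∞ (Subtype.val : K → G))
    (hP : ∀ x ∈ lieOfSubgroup E EK K, P x = x) (hP' : ∀ x, P x ∈ lieOfSubgroup E EK K)
    (k : K) (w : EK) (x : E) :
    dM 𝓘(ℝ, EK) 𝓘(ℝ, LieDual E) (fun k : K => projCoAd P (k : G) μ) k w x =
      -projCoAd P (k : G) μ (flatBr G (rightMC k w) (P x)) := by
  rw [dM_comp_apply (J := 𝓘(ℝ, E)) (g := fun g : G => projCoAd P g μ)
    (f := (Subtype.val : K → G)) (x := k)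
    ((contMDiff_projCoAd P μ).mdifferentiable (by simp) _) (hι.mdifferentiable (by simp) _),
    dM_projCoAd, projCoAd_eq_coAd hP _ (flatBr_mem hι (rightMC_mem hι k w) (hP' x))]
  rfl

/-- $\mathrm{Ad}_{h^{-1}}$ preserves $\mathfrak k$, so the inner `P` does nothing and the projected
coadjoint maps compose. -/
theorem isOrbitMap_projCoAd (hι : ContMDiff 𝓘(ℝ, EK) 𝓘(ℝ, E) ∞ (Subtype.val : K → G))
    (hP : ∀ x ∈ lieOfSubgroup E EK K, P x = x) (hP' : ∀ x, P x ∈ lieOfSubgroup E EK K) :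
    IsOrbitMap EK (fun k : K => projCoAd P (k : G) μ) fun h =>
      ((ContinuousLinearMap.compL ℝ E E ℝ).flip ((adGroup ((h : G)⁻¹)).comp P)) where
  smooth := (contMDiff_projCoAd P μ).comp hι
  equivariant h k := by
    ext x
    change coAd ((h : G) * (k : G)) μ (P x) =
      coAd (k : G) μ (P (adGroup ((h⁻¹ : K) : G) (P x)))
    rw [hP _ (adGroup_mem hι h⁻¹ (hP' x)), coAd_mul]
    rfl

/-- The orbit of a Lie subgroup with its Kirillov-Kostant form is a symplectic manifold. -/
theorem exists_orbit_symplectic [FiniteDimensional ℝ EK] [SecondCountableTopology K]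
    (hι : ContMDiff 𝓘(ℝ, EK) 𝓘(ℝ, E) ∞ (Subtype.val : K → G))
    (hP : ∀ x ∈ lieOfSubgroup E EK K, P x = x) (hP' : ∀ x, P x ∈ lieOfSubgroup E EK K) :
    ∃ (s : SmoothStructure (projOrbit P K μ)) (Ω : DiffForm (𝓡 s.dim) s.Carrier 2),
      IsOrbitStructure EK s ∧ IsKirillovKostant EK s Ω ∧ IsSymplecticForm (𝓡 s.dim) Ω ∧
      pullbackForm 𝓘(ℝ, EK) (𝓡 s.dim) (fun k : K => s.equip ⟨projCoAd P (k : G) μ, k, rfl⟩) Ω =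
        orbitPullback EK K μ := by
  obtain ⟨s, hsub, himm⟩ := (isOrbitMap_projCoAd (μ := μ) hι hP hP').exists_smoothStructure
  change ∃ (s : SmoothStructure (Set.range fun k : K => projCoAd P (k : G) μ)) (_ : _), _
  let φ : K → s.Carrier := fun k => s.equip ⟨projCoAd P (k : G) μ, k, rfl⟩
  let j : s.Carrier → LieDual E := fun p => (s.out p).1
  change IsSmoothSubmersion 𝓘(ℝ, EK) (𝓡 s.dim) φ at hsub
  change IsSmoothImmersion (𝓡 s.dim) 𝓘(ℝ, LieDual E) j at himm
  have hsurj : Function.Surjective φ := by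
    rintro ⟨p, k, rfl⟩
    exact ⟨k, rfl⟩
  have hj : ∀ k w x, dM (𝓡 s.dim) 𝓘(ℝ, LieDual E) j (φ k)
      (dM 𝓘(ℝ, EK) (𝓡 s.dim) φ k w) x = -j (φ k) (flatBr G (rightMC k w) (P x)) := by
    intro k w x
    rw [← dM_comp_apply (J := 𝓡 s.dim) (g := j) (f := φ) (x := k)
      (himm.1.mdifferentiable (by simp) _) (hsub.1.mdifferentiable (by simp) _)]
    exact dM_projCoAd_incl hι hP hP' k w x
  have hΘ : ∀ k u v, flat 𝓘(ℝ, EK) (orbitPullback EK K μ) k ![u, v] =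
      j (φ k) (flatBr G (rightMC k u) (rightMC k v)) := flat_orbitPullback hι hP
  have hfix : ∀ (k : K) (w : EK), P (rightMC k w) = rightMC k w := fun k w =>
    hP _ (rightMC_mem hι k w)
  have hΘ' : ∀ k u v, flat 𝓘(ℝ, EK) (orbitPullback EK K μ) k ![u, v] =
      -dM (𝓡 s.dim) 𝓘(ℝ, LieDual E) j (φ k) (dM 𝓘(ℝ, EK) (𝓡 s.dim) φ k u) (rightMC k v) := by
    intro k u v
    rw [hj, hfix, hΘ, neg_neg]
  have hskew : ∀ (p : LieDual E) (ξ ζ : E), p (flatBr G ξ ζ) = -p (flatBr G ζ ξ) := by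
    intro p ξ ζ
    rw [flatBr_swap, map_neg]
  -- By `hΘ'` the form depends on `u` only through its image in the orbit; antisymmetry gives the
  -- same for the second argument.
  obtain ⟨Ω, hΩ⟩ := hsub.exists_pullbackForm_eq hsurj (orbitPullback EK K μ) (by
    intro k l hkl u u' v v' h h'
    have h1 := hj k u' (rightMC l v)
    rw [h', hkl, hj l, hfix, neg_inj] at h1
    rw [hΘ', h, hkl, hj, hfix, neg_neg, hskew, hΘ l, ← h1, ← hskew])
  have hval : ∀ k u v, flat (𝓡 s.dim) Ω (φ k) ![dM 𝓘(ℝ, EK) (𝓡 s.dim) φ k u,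
      dM 𝓘(ℝ, EK) (𝓡 s.dim) φ k v] = j (φ k) (flatBr G (rightMC k u) (rightMC k v)) := by
    intro k u v
    rw [← hΘ, ← hΩ, flat_pullbackForm, compContinuousLinearMap_pair]
  -- The inclusion is an immersion, so a tangent vector is determined by the element $\xi$ that
  -- generates it.
  have hgen : ∀ k (u : EuclideanSpace ℝ (Fin s.dim)) ξ, ξ ∈ lieOfSubgroup E EK K →
      (∀ x, dM (𝓡 s.dim) 𝓘(ℝ, LieDual E) j (φ k) u x = -j (φ k) (flatBr G ξ (P x))) →
      ∃ w, u = dM 𝓘(ℝ, EK) (𝓡 s.dim) φ k w ∧ rightMC k w = ξ := by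
    intro k u ξ hξ hu
    obtain ⟨w, hw⟩ := exists_adGroup_leftMC_incl hι k hξ
    refine ⟨w, himm.2 (φ k) ?_, hw⟩
    have : dM (𝓡 s.dim) 𝓘(ℝ, LieDual E) j (φ k) u =
        dM (𝓡 s.dim) 𝓘(ℝ, LieDual E) j (φ k) (dM 𝓘(ℝ, EK) (𝓡 s.dim) φ k w) := by
      ext x
      rw [hu, hj, rightMC, hw]
    exact this
  have hι1 : IsSmoothForm 𝓘(ℝ, EK) (pullbackForm 𝓘(ℝ, EK) 𝓘(ℝ, E) (Subtype.val : K → G)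
      (leftInvForm G μ)) := (isSmoothForm_leftInvForm μ).pullbackForm_one hι
  -- Upstairs, on `K`, the form has the primitive $-\mu(\lambda)$.
  have hclosed := hsub.closed_of_pullback_exact hsurj hι1.neg (Ω := Ω) (by
    rw [hΩ, extDerivForm_neg, extDerivForm_pullbackForm hι (isSmoothForm_leftInvForm μ)]
    rfl)
  refine ⟨s, Ω, ⟨hsub, himm⟩, ?_, ⟨hclosed.1, hclosed.2, ?_⟩, hΩ⟩
  · intro p u v ξ ζ hξ hζ hu hv
    obtain ⟨k, rfl⟩ := hsurj p
    obtain ⟨w, rfl, rfl⟩ := hgen k u ξ hξ hu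
    obtain ⟨w', rfl, rfl⟩ := hgen k v ζ hζ hv
    exact hval k w w'
  · intro p u hu
    obtain ⟨k, rfl⟩ := hsurj p
    obtain ⟨w, rfl⟩ : ∃ w, dM 𝓘(ℝ, EK) (𝓡 s.dim) φ k w = u := hsub.2 k u
    refine himm.2 (φ k) ?_
    -- If $u$, generated by $\xi$, pairs to zero with everything, then the orbit point kills
    -- $[\xi,\mathfrak k]$. By `hj` this says that $u$ has zero image in $\mathfrak g^*$.
    have : dM (𝓡 s.dim) 𝓘(ℝ, LieDual E) j (φ k) (dM 𝓘(ℝ, EK) (𝓡 s.dim) φ k w) = 0 := by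
      ext x
      obtain ⟨w', hw'⟩ := exists_adGroup_leftMC_incl hι k (hP' x)
      have h0 : flat (𝓡 s.dim) Ω (φ k) ![dM 𝓘(ℝ, EK) (𝓡 s.dim) φ k w,
        dM 𝓘(ℝ, EK) (𝓡 s.dim) φ k w'] = 0 := hu _
      rw [hval] at h0
      have h1 : rightMC k w' = P x := hw'
      rw [hj, ← h1, h0]
      simp
    exact this.trans (map_zero _).symm

end OrbitForm

end

noncomputable section

/-! ### Transport of manifold structures along bijections -/

section Transport

variable {E₁ H₁ M X : Type*}
  [NormedAddCommGroup E₁] [NormedSpace ℝ E₁] [FiniteDimensional ℝ E₁] [TopologicalSpace H₁]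
  (I : ModelWithCorners ℝ E₁ H₁) [I.Boundaryless]
  [TopologicalSpace M] [ChartedSpace H₁ M]

/-- The model space of a manifold without boundary, identified with a Euclidean space. -/
def modelToEuclidean : H₁ ≃ₜ EuclideanSpace ℝ (Fin (Module.finrank ℝ E₁)) :=
  I.toHomeomorph.trans toEuclidean.toHomeomorph

/-- The chart of `X` obtained from the chart of `M` at `h x`. -/
def transportedChart [TopologicalSpace X] (h : X ≃ₜ M) (x : X) :
    OpenPartialHomeomorph X (EuclideanSpace ℝ (Fin (Module.finrank ℝ E₁))) :=
  (h.toOpenPartialHomeomorph.trans (chartAt H₁ (h x))).transHomeomorph (modelToEuclidean I)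

theorem mem_transportedChart_source [TopologicalSpace X] (h : X ≃ₜ M) (x y : X) :
    y ∈ (transportedChart I h x).source ↔ h y ∈ (chartAt H₁ (h x)).source := by
  simp [transportedChart]

/-- The transition maps are those of `M` conjugated by a linear isomorphism with Euclidean space. -/
theorem contDiffOn_transportedChart [IsManifold I ∞ M] [TopologicalSpace X] (h : X ≃ₜ M)
    (x y : X) : ContDiffOn ℝ ∞ ((transportedChart I h x).symm.trans (transportedChart I h y))
      ((transportedChart I h x).symm.trans (transportedChart I h y)).source := by
  have hc := (HasGroupoid.compatible (G := contDiffGroupoid ∞ I) (chart_mem_atlas H₁ (h x))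
    (chart_mem_atlas H₁ (h y))).1
  have hc' : ContDiffOn ℝ ∞ (I ∘ ((chartAt H₁ (h x)).symm.trans (chartAt H₁ (h y))) ∘ I.symm)
    (I.symm ⁻¹' ((chartAt H₁ (h x)).symm.trans (chartAt H₁ (h y))).source ∩ Set.range I) := hc
  let L : E₁ ≃L[ℝ] EuclideanSpace ℝ (Fin (Module.finrank ℝ E₁)) := toEuclidean
  refine (L.contDiff.comp_contDiffOn (hc'.comp L.symm.contDiff.contDiffOn ?_)).congr ?_
  · intro z hz
    refine ⟨?_, by rw [I.range_eq_univ]; trivial⟩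
    simp only [transportedChart, OpenPartialHomeomorph.trans_source,
      Set.mem_inter_iff, Set.mem_preimage] at hz ⊢
    simpa [modelToEuclidean] using hz
  · intro z _
    change L (I (chartAt H₁ (h y) (h (h.symm _)))) = _
    rw [h.apply_symm_apply]
    rfl

/-- In corresponding charts `h` is a linear isomorphism. -/
theorem contMDiff_of_transportedChart [IsManifold I ∞ M] [TopologicalSpace X] (h : X ≃ₜ M)
    [ChartedSpace (EuclideanSpace ℝ (Fin (Module.finrank ℝ E₁))) X]
    [IsManifold (𝓡 (Module.finrank ℝ E₁)) ∞ X]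
    (hch : ∀ x, chartAt (EuclideanSpace ℝ (Fin (Module.finrank ℝ E₁))) x = transportedChart I h x) :
    ContMDiff (𝓡 (Module.finrank ℝ E₁)) I ∞ h ∧
      ContMDiff I (𝓡 (Module.finrank ℝ E₁)) ∞ h.symm := by
  let L : E₁ ≃L[ℝ] EuclideanSpace ℝ (Fin (Module.finrank ℝ E₁)) := toEuclidean
  have hext : ∀ p q, extChartAt (𝓡 (Module.finrank ℝ E₁)) p q = L (extChartAt I (h p) (h q)) := by
    intro p q
    rw [extChartAt, hch]
    rfl
  constructor
  · intro x
    rw [contMDiffAt_iff_target]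
    refine ⟨h.continuous.continuousAt, ?_⟩
    have : (extChartAt I (h x) ∘ h) = fun q => L.symm (extChartAt (𝓡 (Module.finrank ℝ E₁)) x q) := by
      funext q
      rw [hext, L.symm_apply_apply]
      rfl
    rw [this]
    exact L.symm.contDiff.contMDiff.contMDiffAt.comp x contMDiffAt_extChartAt
  · intro m
    obtain ⟨x, rfl⟩ := h.surjective m
    rw [contMDiffAt_iff_target_of_mem_source (y := x)
      (by rw [h.symm_apply_apply]; exact mem_chart_source _ x)]
    refine ⟨h.symm.continuous.continuousAt, ?_⟩
    have : (extChartAt (𝓡 (Module.finrank ℝ E₁)) x ∘ h.symm) = fun q => L (extChartAt I (h x) q) := by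
      funext q
      rw [Function.comp_apply, hext, h.apply_symm_apply]
    rw [this]
    exact L.contDiff.contMDiff.contMDiffAt.comp (h x) contMDiffAt_extChartAt

/-- The manifold structure on `X` for which the bijection `e` is a diffeomorphism. -/
def transportedStructure [IsManifold I ∞ M] [T2Space M] [SecondCountableTopology M]
    (e : X ≃ M) : SmoothStructure X :=
  letI top : TopologicalSpace X := TopologicalSpace.induced e inferInstance
  let h : X ≃ₜ M := e.toHomeomorphOfIsInducing ⟨rfl⟩
  letI ch : ChartedSpace (EuclideanSpace ℝ (Fin (Module.finrank ℝ E₁))) X :=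
    { atlas := Set.range (transportedChart I h)
      chartAt := transportedChart I h
      mem_chart_source := fun x =>
        (mem_transportedChart_source I h x x).2 (mem_chart_source H₁ (h x))
      chart_mem_atlas := fun x => ⟨x, rfl⟩ }
  { dim := Module.finrank ℝ E₁
    top := top
    charts := ch
    isManifold := isManifold_of_contDiffOn _ _ _ (by
      rintro _ _ ⟨x, rfl⟩ ⟨y, rfl⟩
      exact (contDiffOn_transportedChart I h x y).mono fun z hz => hz.1)
    t2 := h.symm.t2Space
    secondCountable := h.isInducing.secondCountableTopology }

variable {I}

/-- Used for the level set, which is in bijection with `G`, and for the reduced space, which is in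
bijection with the product of the orbits. -/
theorem exists_smoothStructure_of_equiv [IsManifold I ∞ M] [T2Space M] [SecondCountableTopology M]
    (e : X ≃ M) : ∃ (s : SmoothStructure X) (Φ : s.Carrier ≃ₘ^∞⟮𝓡 s.dim, I⟯ M),
      ∀ p, Φ p = e (s.out p) := by
  let s := transportedStructure I e
  let f : s.Carrier ≃ₜ M := Equiv.toHomeomorphOfIsInducing (X := s.Carrier) e ⟨rfl⟩
  have hf : ContMDiff (𝓡 s.dim) I ∞ f ∧ ContMDiff I (𝓡 s.dim) ∞ f.symm := by
    let _ : ChartedSpace (EuclideanSpace ℝ (Fin (Module.finrank ℝ E₁))) s.Carrier := s.charts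
    have _ : IsManifold (𝓡 (Module.finrank ℝ E₁)) ∞ s.Carrier := s.isManifold
    exact contMDiff_of_transportedChart I f (fun x => rfl)
  exact ⟨s, ⟨f.toEquiv, hf.1, hf.2⟩, fun p => rfl⟩

end Transport

end

noncomputable section

/-! ### Submersions and products -/

section Submersions

variable {E₁ H₁ E₂ H₂ E₃ H₃ M N Q : Type*}
  [NormedAddCommGroup E₁] [NormedSpace ℝ E₁] [TopologicalSpace H₁]
  [NormedAddCommGroup E₂] [NormedSpace ℝ E₂] [TopologicalSpace H₂]
  [NormedAddCommGroup E₃] [NormedSpace ℝ E₃] [TopologicalSpace H₃]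
  {I : ModelWithCorners ℝ E₁ H₁} {J : ModelWithCorners ℝ E₂ H₂} {K : ModelWithCorners ℝ E₃ H₃}
  [TopologicalSpace M] [ChartedSpace H₁ M] [TopologicalSpace N] [ChartedSpace H₂ N]
  [TopologicalSpace Q] [ChartedSpace H₃ Q]

theorem IsSmoothSubmersion.comp {g : N → Q} {f : M → N} (hg : IsSmoothSubmersion J K g)
    (hf : IsSmoothSubmersion I J f) : IsSmoothSubmersion I K (fun x => g (f x)) := by
  refine ⟨hg.1.comp hf.1, fun x => ?_⟩
  have h : dM I K (fun x => g (f x)) x = (dM J K g (f x)).comp (dM I J f x) :=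
    dM_comp (hg.1.mdifferentiable (by simp) _) (hf.1.mdifferentiable (by simp) _)
  have h' : Function.Surjective (dM I K (fun x => g (f x)) x) := by
    rw [h]
    exact (hg.2 (f x)).comp (hf.2 x)
  exact h'

theorem dM_comp_of_leftInverse {g : N → M} {f : M → N} (hg : ContMDiff J I ∞ g)
    (hf : ContMDiff I J ∞ f) (h : Function.LeftInverse g f) (x : M) (v : E₁) :
    dM J I g (f x) (dM I J f x v) = v := by
  rw [← dM_comp_apply (hg.mdifferentiable (by simp) _) (hf.mdifferentiable (by simp) _)]
  have : (fun y => g (f y)) = fun y => y := funext h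
  rw [this, dM_id]
  rfl

theorem isSmoothImmersion_of_leftInverse {g : N → M} {f : M → N} (hg : ContMDiff J I ∞ g)
    (hf : ContMDiff I J ∞ f) (h : Function.LeftInverse g f) : IsSmoothImmersion I J f :=
  ⟨hf, fun x => Function.LeftInverse.injective (g := dM J I g (f x))
    (dM_comp_of_leftInverse hg hf h x)⟩

theorem isSmoothSubmersion_of_inverse {g : N → M} {f : M → N} (hg : ContMDiff J I ∞ g)
    (hf : ContMDiff I J ∞ f) (h : Function.LeftInverse g f) (h' : Function.RightInverse g f) :
    IsSmoothSubmersion I J f := by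
  refine ⟨hf, fun x v => ⟨dM J I g (f x) v, ?_⟩⟩
  have := dM_comp_of_leftInverse hf hg h' (f x) v
  rw [h x] at this
  exact this

theorem IsSmoothSubmersion.prodMap {E₄ H₄ R : Type*} [NormedAddCommGroup E₄] [NormedSpace ℝ E₄]
    [TopologicalSpace H₄] {K' : ModelWithCorners ℝ E₄ H₄} [TopologicalSpace R] [ChartedSpace H₄ R]
    {f : M → N} {g : Q → R} (hf : IsSmoothSubmersion I J f) (hg : IsSmoothSubmersion K K' g) :
    IsSmoothSubmersion (I.prod K) (J.prod K') (fun p : M × Q => (f p.1, g p.2)) := by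
  refine ⟨hf.1.prodMap hg.1, fun p => ?_⟩
  have h : dM (I.prod K) (J.prod K') (fun p : M × Q => (f p.1, g p.2)) p =
      (dM I J f p.1).prodMap (dM K K' g p.2) :=
    mfderiv_prodMap (hf.1.mdifferentiable (by simp) _) (hg.1.mdifferentiable (by simp) _)
  have h' : Function.Surjective (dM (I.prod K) (J.prod K') (fun p : M × Q => (f p.1, g p.2)) p) := by
    rw [h]
    exact (hf.2 p.1).prodMap (hg.2 p.2)
  exact h'

theorem flat_productDiffForm (Ω₁ : DiffForm I M 2) (Ω₂ : DiffForm J N 2) (p : M × N)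
    (u v : E₁ × E₂) : flat (I.prod J) (productDiffForm I J Ω₁ Ω₂) p ![u, v] =
      flat I Ω₁ p.1 ![u.1, v.1] - flat J Ω₂ p.2 ![u.2, v.2] := by
  have h1 : dM (I.prod J) I (Prod.fst : M × N → M) p = ContinuousLinearMap.fst ℝ E₁ E₂ :=
    mfderiv_fst
  have h2 : dM (I.prod J) J (Prod.snd : M × N → N) p = ContinuousLinearMap.snd ℝ E₁ E₂ :=
    mfderiv_snd
  have h3 : flat (I.prod J) (productDiffForm I J Ω₁ Ω₂) p ![u, v] =
    (flat I Ω₁ p.1).compContinuousLinearMap (dM (I.prod J) I (Prod.fst : M × N → M) p) ![u, v] -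
    (flat J Ω₂ p.2).compContinuousLinearMap (dM (I.prod J) J (Prod.snd : M × N → N) p) ![u, v] :=
    rfl
  rw [h3, compContinuousLinearMap_pair, compContinuousLinearMap_pair, h1, h2]
  rfl

/-- Testing against $(v,0)$ and $(0,v)$ separates the factors; the minus sign is harmless. -/
theorem productDiffForm_nondegenerate {Ω₁ : DiffForm I M 2} {Ω₂ : DiffForm J N 2}
    (h₁ : IsSymplecticForm I Ω₁) (h₂ : IsSymplecticForm J Ω₂) (p : M × N) (u : E₁ × E₂)
    (hu : ∀ v, flat (I.prod J) (productDiffForm I J Ω₁ Ω₂) p ![u, v] = 0) : u = 0 := by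
  have hz₁ : ∀ w : E₁, flat I Ω₁ p.1 ![w, 0] = 0 := fun w =>
    (flat I Ω₁ p.1).map_coord_zero 1 rfl
  have hz₂ : ∀ w : E₂, flat J Ω₂ p.2 ![w, 0] = 0 := fun w =>
    (flat J Ω₂ p.2).map_coord_zero 1 rfl
  refine Prod.ext (h₁.2.2 p.1 u.1 fun v => ?_) (h₂.2.2 p.2 u.2 fun v => ?_)
  · have h := hu (v, 0)
    rw [flat_productDiffForm, hz₂, sub_zero] at h
    exact h
  · have h := hu (0, v)
    rw [flat_productDiffForm, hz₁, zero_sub, neg_eq_zero] at h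
    exact h

theorem Diffeomorph.pullbackForm_nondegenerate (Ψ : M ≃ₘ^∞⟮I, J⟯ N) {Ω : DiffForm J N 2}
    (hΩ : ∀ p (u : E₂), (∀ v, flat J Ω p ![u, v] = 0) → u = 0) (p : M) (u : E₁)
    (hu : ∀ v, flat I (pullbackForm I J Ψ Ω) p ![u, v] = 0) : u = 0 := by
  have hinj : Function.Injective (dM I J Ψ p) :=
    (isSmoothImmersion_of_leftInverse Ψ.symm.contMDiff Ψ.contMDiff Ψ.symm_apply_apply).2 p
  have hsur : Function.Surjective (dM I J Ψ p) :=
    (isSmoothSubmersion_of_inverse Ψ.symm.contMDiff Ψ.contMDiff Ψ.symm_apply_apply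
      Ψ.apply_symm_apply).2 p
  refine hinj ((hΩ (Ψ p) _ fun v => ?_).trans (map_zero _).symm)
  obtain ⟨w, rfl⟩ := hsur v
  rw [← hu w, flat_pullbackForm, compContinuousLinearMap_pair]

theorem pullbackForm_productDiffForm {f : Q → M} {g : Q → N} (hf : MDifferentiable K I f)
    (hg : MDifferentiable K J g) {k : ℕ} (Ω₁ : DiffForm I M k) (Ω₂ : DiffForm J N k) :
    pullbackForm K (I.prod J) (fun x => (f x, g x)) (productDiffForm I J Ω₁ Ω₂) =
      pullbackForm K I f Ω₁ - pullbackForm K J g Ω₂ := by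
  have hfg : MDifferentiable K (I.prod J) (fun x => (f x, g x)) := fun x => (hf x).prodMk (hg x)
  rw [productDiffForm, pullbackForm_sub, ← pullbackForm_comp mdifferentiable_fst hfg,
    ← pullbackForm_comp mdifferentiable_snd hfg]

end Submersions

/-! ### The canonical one-form of the cotangent bundle -/

section CanonicalForm

set_option linter.unusedSectionVars false

variable {E : Type*} [NormedAddCommGroup E] [NormedSpace ℝ E]
  {G : Type*} [TopologicalSpace G] [ChartedSpace E G] [Group G] [LieGroup 𝓘(ℝ, E) ∞ G]

theorem contDiff_ofSubsingleton {V : Type*} [NormedAddCommGroup V] [NormedSpace ℝ V] :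
    ContDiff ℝ ∞ (fun L : V →L[ℝ] ℝ =>
      ContinuousAlternatingMap.ofSubsingleton ℝ V ℝ (0 : Fin 1) L) :=
  (ContinuousAlternatingMap.ofSubsingletonLIE (𝕜 := ℝ) (E := V) (F := ℝ) (0 : Fin 1)).contDiff

/-- In the product chart the form is $\sigma$ composed with the Maurer-Cartan form in the chart of
`G` and the first projection, all smooth in $(x,\sigma)$. -/
theorem isSmoothForm_canonicalOneForm :
    IsSmoothForm (cotangentModel E) (canonicalOneForm E G) := by
  intro p
  let c := extChartAt 𝓘(ℝ, E) p.1
  let e₁ := ContinuousAlternatingMap.ofSubsingletonLIE (𝕜 := ℝ) (E := E × LieDual E) (F := ℝ)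
    (0 : Fin 1)
  have hsymm : ∀ x, (extChartAt (cotangentModel E) p).symm x = (c.symm x.1, x.2) := fun x => rfl
  have hfst : ∀ x, (extChartAt (cotangentModel E) p x).1 = c x.1 := fun x => rfl
  have hev : ∀ᶠ x in 𝓝 (extChartAt (cotangentModel E) p p),
      formInChart (cotangentModel E) (canonicalOneForm E G) p x =
        e₁ ((x.2.comp ((leftMC (c.symm x.1)).comp (dM 𝓘(ℝ, E) 𝓘(ℝ, E) c.symm x.1))).comp
          (ContinuousLinearMap.fst ℝ E (LieDual E))) := by
    have hc : c.target ∈ 𝓝 (extChartAt (cotangentModel E) p p).1 :=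
      extChartAt_target_mem_nhds (I := 𝓘(ℝ, E)) p.1
    filter_upwards [extChartAt_target_mem_nhds (I := cotangentModel E) p,
      continuous_fst.continuousAt.preimage_mem_nhds hc] with x hx hx1
    have hd : MDifferentiableAt 𝓘(ℝ, E × LieDual E) (cotangentModel E)
        (extChartAt (cotangentModel E) p).symm x :=
      (contMDiffAt_extChartAt_symm_of_mem hx).mdifferentiableAt (n := ∞) (by simp)
    have hd1 : MDifferentiableAt 𝓘(ℝ, E) 𝓘(ℝ, E) c.symm x.1 :=
      (contMDiffAt_extChartAt_symm_of_mem hx1).mdifferentiableAt (n := ∞) (by simp)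
    -- `h1` and `h2` differentiate the same map, factored through the cotangent bundle and through
    -- the chart of `G`.
    have h1 : dM 𝓘(ℝ, E × LieDual E) 𝓘(ℝ, E)
        (fun y => ((extChartAt (cotangentModel E) p).symm y).1) x = _ :=
      dM_comp (J := cotangentModel E) (g := (Prod.fst : G × LieDual E → G)) mdifferentiableAt_fst hd
    have h2 : dM 𝓘(ℝ, E × LieDual E) 𝓘(ℝ, E)
        (fun y : E × LieDual E => c.symm y.1) x = _ :=
      dM_comp (J := 𝓘(ℝ, E)) (g := c.symm) hd1 differentiableAt_fst.mdifferentiableAt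
    have h3 : dM 𝓘(ℝ, E × LieDual E) 𝓘(ℝ, E) (fun y : E × LieDual E => y.1) x =
        ContinuousLinearMap.fst ℝ E (LieDual E) := by
      rw [dM_eq_fderiv]
      exact fderiv_fst
    rw [h3] at h2
    have h4 := h1.symm.trans h2
    change e₁ ((x.2.comp (leftMC (c.symm x.1))).comp
      ((dM (cotangentModel E) 𝓘(ℝ, E) (Prod.fst : G × LieDual E → G)
        ((extChartAt (cotangentModel E) p).symm x)).comp
        (dM 𝓘(ℝ, E × LieDual E) (cotangentModel E) (extChartAt (cotangentModel E) p).symm x))) = _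
    rw [h4]
    rfl
  refine ContDiffAt.congr_of_eventuallyEq ?_ hev
  have he : ContDiff ℝ ∞ (fun L : E × LieDual E →L[ℝ] ℝ => e₁ L) :=
    contDiff_ofSubsingleton
  refine he.contDiffAt.comp _ ?_
  have hL : ContDiffAt ℝ ∞ (fun x : E × LieDual E => (leftMC (c.symm x.1)).comp
      (dM 𝓘(ℝ, E) 𝓘(ℝ, E) c.symm x.1)) (extChartAt (cotangentModel E) p p) :=
    ContDiffAt.comp (extChartAt (cotangentModel E) p p) (contDiffAt_leftMC_chart p.1)
      contDiffAt_fst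
  exact (contDiffAt_snd.clm_comp hL).clm_comp contDiffAt_const

theorem flat_pullbackForm_canonicalOneForm {E₁ H₁ M : Type*} [NormedAddCommGroup E₁]
    [NormedSpace ℝ E₁] [TopologicalSpace H₁] {I : ModelWithCorners ℝ E₁ H₁} [TopologicalSpace M]
    [ChartedSpace H₁ M] {f : M → G} {S : M → LieDual E} {x : M}
    (hf : MDifferentiableAt I 𝓘(ℝ, E) f x)
    (hS : MDifferentiableAt I 𝓘(ℝ, LieDual E) S x) (v : Fin 1 → E₁) :
    flat I (pullbackForm I (cotangentModel E) (fun y => (f y, S y)) (canonicalOneForm E G)) x v =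
      S x (leftMC (f x) (dM I 𝓘(ℝ, E) f x (v 0))) := by
  have h1 := dM_comp_apply (J := cotangentModel E) (g := (Prod.fst : G × LieDual E → G))
    (f := fun y => (f y, S y)) (x := x) mdifferentiableAt_fst (hf.prodMk hS) (v 0)
  exact congrArg (fun w => S x (leftMC (f x) w)) h1.symm

end CanonicalForm

end

noncomputable section

/-! ### The level set of the momentum map -/

section StabilizerOrbit

variable {EK V K : Type*} [NormedAddCommGroup EK] [NormedSpace ℝ EK]
  [NormedAddCommGroup V] [NormedSpace ℝ V]
  [TopologicalSpace K] [ChartedSpace EK K] [Group K]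

theorem IsOrbitMap.apply_eq_iff {φ : K → V} {T : K → V →L[ℝ] V} (hφ : IsOrbitMap EK φ T)
    (h k : K) : φ h = φ k ↔ φ (k⁻¹ * h) = φ 1 := by
  constructor
  · intro e
    rw [hφ.equivariant, e, ← hφ.equivariant, inv_mul_cancel]
  · intro e
    have h1 := hφ.equivariant k (k⁻¹ * h)
    rw [e, ← hφ.equivariant, mul_one, mul_inv_cancel_left] at h1
    exact h1

end StabilizerOrbit

section CoadjointProjection

set_option linter.unusedSectionVars false

variable {E : Type*} [NormedAddCommGroup E] [NormedSpace ℝ E]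
  {G : Type*} [TopologicalSpace G] [ChartedSpace E G] [Group G] [LieGroup 𝓘(ℝ, E) ∞ G]
  {EK : Type*} [NormedAddCommGroup EK] [NormedSpace ℝ EK]
  {K : Subgroup G} [ChartedSpace EK K] [LieGroup 𝓘(ℝ, EK) ∞ K]
  {P : E →L[ℝ] E} {μ : LieDual E}

/-- Since $\mathrm{Ad}_k$ preserves $\mathfrak k$, the restriction of $\mathrm{Ad}^\sharp_k\tau$ to
$\mathfrak k$ depends only on that of $\tau$, and the condition can be moved across by $k^{-1}$. The
assumption `hμ` makes $\mu$ determined by its restriction to $\mathfrak k$. -/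
theorem coAd_comp_proj_eq_iff (hι : ContMDiff 𝓘(ℝ, EK) 𝓘(ℝ, E) ∞ (Subtype.val : K → G))
    (hP : ∀ x ∈ lieOfSubgroup E EK K, P x = x) (hP' : ∀ x, P x ∈ lieOfSubgroup E EK K)
    (hμ : ∀ x, μ (P x) = μ x) (k : K) (τ : LieDual E) :
    (coAd (k : G) τ).comp P = μ ↔ τ.comp P = projCoAd P ((k⁻¹ : K) : G) μ := by
  have hadj : ∀ (h : K) x, P (adGroup (h : G) (P x)) = adGroup (h : G) (P x) := fun h x =>
    hP _ (adGroup_mem hι h (hP' x))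
  have e1 : ∀ x, projCoAd P ((k⁻¹ : K) : G) μ x = μ (adGroup (k : G) (P x)) := by
    intro x
    rw [projCoAd_apply, Subgroup.coe_inv, inv_inv]
  constructor
  · intro h
    ext x
    have h1 : μ (adGroup (k : G) (P x)) = τ (adGroup ((k : G)⁻¹) (P (adGroup (k : G) (P x)))) :=
      (DFunLike.congr_fun h (adGroup (k : G) (P x))).symm
    rw [e1, h1, hadj, adGroup_inv_apply]
    rfl
  · intro h
    ext x
    have h1 := DFunLike.congr_fun h (adGroup ((k⁻¹ : K) : G) (P x))
    rw [e1, hadj, Subgroup.coe_inv, adGroup_apply_inv, hμ] at h1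
    rw [← h1]
    change τ (adGroup ((k : G)⁻¹) (P x)) = τ (P (adGroup ((k⁻¹ : K) : G) (P x)))
    rw [hadj]
    rfl

end CoadjointProjection

/-! ### The level set as a graph over the group, and the fibres of the map to the orbits -/

namespace Factorization

set_option linter.unusedSectionVars false

variable {E EA EB : Type*}
  [NormedAddCommGroup E] [NormedSpace ℝ E] [FiniteDimensional ℝ E]
  [NormedAddCommGroup EA] [NormedSpace ℝ EA]
  [NormedAddCommGroup EB] [NormedSpace ℝ EB]
  {G : Type*} [TopologicalSpace G] [ChartedSpace E G] [Group G] [LieGroup 𝓘(ℝ, E) ∞ G]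
  {A B : Subgroup G} [ChartedSpace EA A] [LieGroup 𝓘(ℝ, EA) ∞ A]
  [ChartedSpace EB B] [LieGroup 𝓘(ℝ, EB) ∞ B]
  (F : Factorization E EA EB A B) {μ ν : LieDual E}

/-- The inclusion is the restriction of the multiplication diffeomorphism to $A\times\{1\}$, so the
factorization already forces it to be smooth. -/
theorem contMDiff_coe_left (F : Factorization E EA EB A B) :
    ContMDiff 𝓘(ℝ, EA) 𝓘(ℝ, E) ∞ (Subtype.val : A → G) := by
  have h : ContMDiff 𝓘(ℝ, EA) 𝓘(ℝ, E) ∞ (fun a : A => F.equiv (a, 1)) :=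
    F.equiv.contMDiff.comp (contMDiff_id.prodMk contMDiff_const)
  have e : (fun a : A => F.equiv (a, 1)) = Subtype.val := by
    funext a
    simp [F.equiv_apply]
  rwa [e] at h

theorem contMDiff_coe_right (F : Factorization E EA EB A B) :
    ContMDiff 𝓘(ℝ, EB) 𝓘(ℝ, E) ∞ (Subtype.val : B → G) := by
  have h : ContMDiff 𝓘(ℝ, EB) 𝓘(ℝ, E) ∞ (fun b : B => F.equiv (1, b)) :=
    F.equiv.contMDiff.comp (contMDiff_const.prodMk contMDiff_id)
  have e : (fun b : B => F.equiv (1, b)) = Subtype.val := by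
    funext b
    simp [F.equiv_apply]
  rwa [e] at h

theorem contMDiff_left : ContMDiff 𝓘(ℝ, E) 𝓘(ℝ, EA) ∞ F.left :=
  contMDiff_fst.comp F.equiv.symm.contMDiff

theorem contMDiff_right : ContMDiff 𝓘(ℝ, E) 𝓘(ℝ, EB) ∞ F.right :=
  contMDiff_snd.comp F.equiv.symm.contMDiff

theorem left_mul_right (g : G) : (F.left g : G) * (F.right g : G) = g := by
  rw [← F.equiv_apply]
  exact F.equiv.apply_symm_apply g

theorem symm_mul (a : A) (b : B) : F.equiv.symm ((a : G) * (b : G)) = (a, b) := by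
  rw [← F.equiv_apply, F.equiv.symm_apply_apply]

theorem left_mul (a : A) (b : B) : F.left ((a : G) * (b : G)) = a :=
  congrArg Prod.fst (F.symm_mul a b)

theorem right_mul (a : A) (b : B) : F.right ((a : G) * (b : G)) = b :=
  congrArg Prod.snd (F.symm_mul a b)

theorem projA_of_mem {x : E} (hx : x ∈ lieOfSubgroup E EA A) : F.projA x = x :=
  Submodule.projection_apply_of_mem_left F.isCompl hx

theorem projB_of_mem {x : E} (hx : x ∈ lieOfSubgroup E EB B) : F.projB x = x :=
  Submodule.projection_apply_of_mem_left F.isCompl.symm hx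

theorem projA_mem (x : E) : F.projA x ∈ lieOfSubgroup E EA A :=
  Submodule.projection_apply_mem F.isCompl x

theorem projB_mem (x : E) : F.projB x ∈ lieOfSubgroup E EB B :=
  Submodule.projection_apply_mem F.isCompl.symm x

theorem projA_add_projB (x : E) : F.projA x + F.projB x = x :=
  Submodule.projection_add_projection_eq_self F.isCompl x

theorem projB_projA (x : E) : F.projB (F.projA x) = 0 := by
  have h := F.projA_add_projB (F.projA x)
  rwa [F.projA_of_mem (F.projA_mem x), add_eq_left] at h

theorem projA_projB (x : E) : F.projA (F.projB x) = 0 := by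
  have h := F.projA_add_projB (F.projB x)
  rwa [F.projB_of_mem (F.projB_mem x), add_eq_right] at h

theorem dual_ext {σ τ : LieDual E} (hA : σ.comp F.projA = τ.comp F.projA)
    (hB : σ.comp F.projB = τ.comp F.projB) : σ = τ := by
  ext x
  have h1 : σ (F.projA x) = τ (F.projA x) := DFunLike.congr_fun hA x
  have h2 : σ (F.projB x) = τ (F.projB x) := DFunLike.congr_fun hB x
  rw [← F.projA_add_projB x, map_add, map_add, h1, h2]

variable (μ ν) in
/-- The covector `Ad^♯_{g_B} σ` at the point `(g, σ)` of the level set over `g`. -/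
def levelCovector (g : G) : LieDual E :=
  projCoAd F.projA (((F.left g)⁻¹ : A) : G) μ + projCoAd F.projB (F.right g : G) ν

variable (μ ν) in
/-- The second component of the point of the level set over `g`. -/
def levelSection (g : G) : LieDual E := (F.levelCovector μ ν g).comp (adGroup (F.right g : G))

theorem levelCovector_comp_projA (g : G) : (F.levelCovector μ ν g).comp F.projA =
    projCoAd F.projA (((F.left g)⁻¹ : A) : G) μ := by
  ext x
  change coAd _ μ (F.projA (F.projA x)) + coAd _ ν (F.projB (F.projA x)) = coAd _ μ (F.projA x)
  rw [F.projA_of_mem (F.projA_mem x), F.projB_projA, map_zero, add_zero]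

theorem levelCovector_comp_projB (g : G) : (F.levelCovector μ ν g).comp F.projB =
    projCoAd F.projB (F.right g : G) ν := by
  ext x
  change coAd _ μ (F.projA (F.projB x)) + coAd _ ν (F.projB (F.projB x)) = coAd _ ν (F.projB x)
  rw [F.projB_of_mem (F.projB_mem x), F.projA_projB, map_zero, zero_add]

theorem annihilator_comp_projA (hμ : ∀ y ∈ lieOfSubgroup E EB B, μ y = 0) (x : E) :
    μ (F.projA x) = μ x := by
  conv_rhs => rw [← F.projA_add_projB x, map_add, hμ _ (F.projB_mem x), add_zero]

theorem annihilator_comp_projB (hν : ∀ x ∈ lieOfSubgroup E EA A, ν x = 0) (x : E) :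
    ν (F.projB x) = ν x := by
  conv_rhs => rw [← F.projA_add_projB x, map_add, hν _ (F.projA_mem x), zero_add]

/-- With $\tau=\mathrm{Ad}^\sharp_{g_B}\sigma$, the first condition concerns
$\mathrm{Ad}^\sharp_{g_A}\tau$ and the second $\mathrm{Ad}^\sharp_{g_B^{-1}}\tau$. By
`coAd_comp_proj_eq_iff` each fixes one projection of $\tau$, and together they fix $\tau$. -/
theorem mem_levelSet_iff (hμ : ∀ y ∈ lieOfSubgroup E EB B, μ y = 0)
    (hν : ∀ x ∈ lieOfSubgroup E EA A, ν x = 0) (p : G × LieDual E) :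
    p ∈ F.levelSet μ ν ↔ coAd (F.right p.1 : G) p.2 = F.levelCovector μ ν p.1 := by
  obtain ⟨g, σ⟩ := p
  have hA := coAd_comp_proj_eq_iff F.contMDiff_coe_left (fun _ => F.projA_of_mem) F.projA_mem
    (F.annihilator_comp_projA hμ) (F.left g) (coAd (F.right g : G) σ)
  have hB := coAd_comp_proj_eq_iff F.contMDiff_coe_right (fun _ => F.projB_of_mem) F.projB_mem
    (F.annihilator_comp_projB hν) (F.right g)⁻¹ (coAd (F.right g : G) σ)
  rw [← coAd_mul, F.left_mul_right] at hA
  rw [← coAd_mul, ← Subgroup.coe_mul, inv_mul_cancel, Subgroup.coe_one, coAd_one, inv_inv] at hB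
  have h0 : (g, σ) ∈ F.levelSet μ ν ↔ (coAd g σ).comp F.projA = μ ∧ σ.comp F.projB = ν :=
    Prod.mk_inj
  rw [h0, hA, hB, ← F.levelCovector_comp_projA (ν := ν), ← F.levelCovector_comp_projB (μ := μ)]
  exact ⟨fun h => F.dual_ext h.1 h.2, fun h => by rw [h]; exact ⟨rfl, rfl⟩⟩

theorem coAd_eq_iff_eq_comp (g : G) (σ τ : LieDual E) :
    coAd g σ = τ ↔ σ = τ.comp (adGroup g) := by
  constructor
  · rintro rfl
    ext x
    exact congrArg σ (adGroup_inv_apply g x).symm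
  · rintro rfl
    ext x
    exact congrArg τ (adGroup_apply_inv g x)

/-- The level set is the graph of a map from `G` to `𝔤^*`. -/
def levelEquiv (hμ : ∀ y ∈ lieOfSubgroup E EB B, μ y = 0)
    (hν : ∀ x ∈ lieOfSubgroup E EA A, ν x = 0) : F.levelSet μ ν ≃ G where
  toFun p := p.1.1
  invFun g := ⟨(g, F.levelSection μ ν g),
    (F.mem_levelSet_iff hμ hν _).2 ((coAd_eq_iff_eq_comp _ _ _).2 rfl)⟩
  left_inv p := Subtype.ext (Prod.ext rfl
    ((coAd_eq_iff_eq_comp _ _ _).1 ((F.mem_levelSet_iff hμ hν _).1 p.2)).symm)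
  right_inv _ := rfl

theorem toOrbits_eq (hμ : ∀ y ∈ lieOfSubgroup E EB B, μ y = 0)
    (hν : ∀ x ∈ lieOfSubgroup E EA A, ν x = 0) (p : F.levelSet μ ν) :
    ((F.toOrbits μ ν p).1 : LieDual E) = projCoAd F.projA (F.right p.1.1 : G) p.1.2 ∧
      ((F.toOrbits μ ν p).2 : LieDual E) = projCoAd F.projB (F.right p.1.1 : G) p.1.2 := by
  have h := (F.mem_levelSet_iff hμ hν p.1).1 p.2
  constructor
  · rw [projCoAd, h, F.levelCovector_comp_projA]
    rfl
  · rw [projCoAd, h, F.levelCovector_comp_projB]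
    rfl

/-! #### The reduced space as a set -/

theorem isOrbitMapA : IsOrbitMap EA (fun a : A => projCoAd F.projA (a : G) μ) fun h =>
    ((ContinuousLinearMap.compL ℝ E E ℝ).flip ((adGroup ((h : G)⁻¹)).comp F.projA)) :=
  isOrbitMap_projCoAd F.contMDiff_coe_left (fun _ => F.projA_of_mem) F.projA_mem

theorem isOrbitMapB : IsOrbitMap EB (fun b : B => projCoAd F.projB (b : G) ν) fun h =>
    ((ContinuousLinearMap.compL ℝ E E ℝ).flip ((adGroup ((h : G)⁻¹)).comp F.projB)) :=
  isOrbitMap_projCoAd F.contMDiff_coe_right (fun _ => F.projB_of_mem) F.projB_mem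

theorem projCoAd_one {P : E →L[ℝ] E} (hP : ∀ x, μ (P x) = μ x) :
    projCoAd P (1 : G) μ = μ := by
  rw [projCoAd, coAd_one]
  ext x
  exact hP x

/-- $a g b^{-1}=(a g_A)(g_B b^{-1})$, so by uniqueness the factors change by stabilizer elements. -/
theorem toOrbits_eq_of_reductionRel (hμ : ∀ y ∈ lieOfSubgroup E EB B, μ y = 0)
    (hν : ∀ x ∈ lieOfSubgroup E EA A, ν x = 0) {p q : F.levelSet μ ν}
    (h : F.reductionRel μ ν p q) : F.toOrbits μ ν p = F.toOrbits μ ν q := by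
  obtain ⟨a, b, ha, hb, hq⟩ := h
  have hg : q.1.1 = ((a * F.left p.1.1 : A) : G) * ((F.right p.1.1 * b⁻¹ : B) : G) := by
    rw [congrArg Prod.fst hq]
    conv_lhs => rw [← F.left_mul_right p.1.1]
    push_cast
    group
  have hl : F.left q.1.1 = a * F.left p.1.1 := by rw [hg, F.left_mul]
  have hr : F.right q.1.1 = F.right p.1.1 * b⁻¹ := by rw [hg, F.right_mul]
  refine Prod.ext (Subtype.ext ?_) (Subtype.ext ?_)
  · refine (F.isOrbitMapA.apply_eq_iff _ _).2 ?_
    rw [hl, inv_inv, mul_inv_cancel_right]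
    exact ha.trans (projCoAd_one (F.annihilator_comp_projA hμ)).symm
  · refine (F.isOrbitMapB.apply_eq_iff _ _).2 ?_
    rw [hr, mul_inv_rev, inv_inv, inv_mul_cancel_right]
    exact hb.trans (projCoAd_one (F.annihilator_comp_projB hν)).symm

theorem reductionRel_of_toOrbits_eq (hμ : ∀ y ∈ lieOfSubgroup E EB B, μ y = 0)
    (hν : ∀ x ∈ lieOfSubgroup E EA A, ν x = 0) {p q : F.levelSet μ ν}
    (h : F.toOrbits μ ν p = F.toOrbits μ ν q) : F.reductionRel μ ν p q := by
  have h1 : ((F.toOrbits μ ν p).1 : LieDual E) = (F.toOrbits μ ν q).1 := by rw [h]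
  have h2 : ((F.toOrbits μ ν p).2 : LieDual E) = (F.toOrbits μ ν q).2 := by rw [h]
  have hA := (F.isOrbitMapA.apply_eq_iff _ _).1 h1
  have hB := (F.isOrbitMapB.apply_eq_iff _ _).1 h2
  -- The elements $q_Ap_A^{-1}$ and $q_B^{-1}p_B$, in the form $k^{-1}h$ in which `apply_eq_iff`
  -- shows that they are stabilizers.
  refine ⟨((F.left q.1.1)⁻¹)⁻¹ * (F.left p.1.1)⁻¹, (F.right q.1.1)⁻¹ * F.right p.1.1,
    hA.trans (projCoAd_one (F.annihilator_comp_projA hμ)),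
    hB.trans (projCoAd_one (F.annihilator_comp_projB hν)), Prod.ext ?_ ?_⟩
  · conv_lhs => rw [← F.left_mul_right q.1.1]
    have e : (F.left p.1.1 : G)⁻¹ * p.1.1 = F.right p.1.1 := by
      rw [inv_mul_eq_iff_eq_mul, F.left_mul_right]
    push_cast
    rw [inv_inv, mul_assoc (F.left q.1.1 : G), e]
    group
  -- The covector component follows, since $\mathrm{Ad}^\sharp_{g_B}\sigma$ is the sum of the two
  -- orbit points and so agrees at `p` and `q`.
  · have e1 : F.levelCovector μ ν p.1.1 = F.levelCovector μ ν q.1.1 := congrArg₂ (· + ·) h1 h2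
    have hp := (F.mem_levelSet_iff hμ hν p.1).1 p.2
    have hq := (F.mem_levelSet_iff hμ hν q.1).1 q.2
    push_cast
    rw [coAd_mul, hp, e1, ← hq, ← coAd_mul, inv_mul_cancel, coAd_one]

theorem toOrbits_surjective (hμ : ∀ y ∈ lieOfSubgroup E EB B, μ y = 0)
    (hν : ∀ x ∈ lieOfSubgroup E EA A, ν x = 0) : Function.Surjective (F.toOrbits μ ν) := by
  rintro ⟨⟨_, a, rfl⟩, ⟨_, b, rfl⟩⟩
  -- The inverse on `a` compensates for the inverse of $g_A$ in the definition of the map.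
  refine ⟨(F.levelEquiv hμ hν).symm (((a⁻¹ : A) : G) * (b : G)), ?_⟩
  refine Prod.ext (Subtype.ext ?_) (Subtype.ext ?_)
  · change projCoAd F.projA (((F.left (((a⁻¹ : A) : G) * (b : G)))⁻¹ : A) : G) μ = _
    rw [F.left_mul, inv_inv]
  · change projCoAd F.projB (F.right (((a⁻¹ : A) : G) * (b : G)) : G) ν = _
    rw [F.right_mul]

/-- The bijection of the reduced space with the product of the orbits. -/
def reducedEquiv (hμ : ∀ y ∈ lieOfSubgroup E EB B, μ y = 0)
    (hν : ∀ x ∈ lieOfSubgroup E EA A, ν x = 0) :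
    F.ReducedSpace μ ν ≃ projOrbit F.projA A μ × projOrbit F.projB B ν :=
  Equiv.ofBijective (Quot.lift (F.toOrbits μ ν) fun _ _ => F.toOrbits_eq_of_reductionRel hμ hν) <| by
    constructor
    · rintro ⟨p⟩ ⟨q⟩ h
      exact Quot.sound (F.reductionRel_of_toOrbits_eq hμ hν h)
    · intro y
      obtain ⟨p, hp⟩ := F.toOrbits_surjective hμ hν y
      exact ⟨Quot.mk _ p, hp⟩

end Factorization

end

noncomputable section

/-! ### The canonical form on the level set -/

namespace Factorization

set_option linter.unusedSectionVars false

variable {E EA EB : Type*}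
  [NormedAddCommGroup E] [NormedSpace ℝ E] [FiniteDimensional ℝ E]
  [NormedAddCommGroup EA] [NormedSpace ℝ EA]
  [NormedAddCommGroup EB] [NormedSpace ℝ EB]
  {G : Type*} [TopologicalSpace G] [ChartedSpace E G] [Group G] [LieGroup 𝓘(ℝ, E) ∞ G]
  {A B : Subgroup G} [ChartedSpace EA A] [LieGroup 𝓘(ℝ, EA) ∞ A]
  [ChartedSpace EB B] [LieGroup 𝓘(ℝ, EB) ∞ B]
  (F : Factorization E EA EB A B) {μ ν : LieDual E}

/-- The map `g ↦ g_A⁻¹`. -/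
def leftInv (g : G) : A := (F.left g)⁻¹

theorem contMDiff_leftInv : ContMDiff 𝓘(ℝ, E) 𝓘(ℝ, EA) ∞ F.leftInv :=
  (contMDiff_inv 𝓘(ℝ, EA) ∞).comp F.contMDiff_left

theorem contMDiff_levelSection :
    ContMDiff 𝓘(ℝ, E) 𝓘(ℝ, LieDual E) ∞ (F.levelSection μ ν) := by
  have h1 : ContMDiff 𝓘(ℝ, E) 𝓘(ℝ, LieDual E) ∞
      (fun g => projCoAd F.projA (F.leftInv g : G) μ) :=
    (contMDiff_projCoAd F.projA μ).comp (F.contMDiff_coe_left.comp F.contMDiff_leftInv)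
  have h2 : ContMDiff 𝓘(ℝ, E) 𝓘(ℝ, LieDual E) ∞
      (fun g => projCoAd F.projB (F.right g : G) ν) :=
    (contMDiff_projCoAd F.projB ν).comp (F.contMDiff_coe_right.comp F.contMDiff_right)
  have h3 : ContMDiff 𝓘(ℝ, E) 𝓘(ℝ, E →L[ℝ] E) ∞ (fun g => adGroup (E := E) (F.right g : G)) :=
    contMDiff_adGroup.comp (F.contMDiff_coe_right.comp F.contMDiff_right)
  exact (h1.add h2).clm_comp h3

/-- The logarithmic derivative of `g = g_A g_B`. -/
theorem leftMC_eq (g : G) (v : E) :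
    leftMC g v = adGroup ((F.right g : G)⁻¹) (leftMC (F.left g : G)
        (dM 𝓘(ℝ, E) 𝓘(ℝ, E) (fun x => (F.left x : G)) g v)) +
      leftMC (F.right g : G) (dM 𝓘(ℝ, E) 𝓘(ℝ, E) (fun x => (F.right x : G)) g v) := by
  have hl : MDifferentiableAt 𝓘(ℝ, E) 𝓘(ℝ, E) (fun x => (F.left x : G)) g :=
    (F.contMDiff_coe_left.comp F.contMDiff_left).mdifferentiable (by simp) g
  have hr : MDifferentiableAt 𝓘(ℝ, E) 𝓘(ℝ, E) (fun x => (F.right x : G)) g :=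
    (F.contMDiff_coe_right.comp F.contMDiff_right).mdifferentiable (by simp) g
  have h1 := DFunLike.congr_fun (leftMC_comp hl) v
  have h2 := DFunLike.congr_fun (leftMC_comp hr) v
  have hl' := mdifferentiableAt_const_mul (F.left g : G)⁻¹ hl
  have hr' := mdifferentiableAt_const_mul (F.right g : G)⁻¹ hr
  -- Write $g^{-1}x$ as a conjugate of $g_A^{-1}x_A$ times $g_B^{-1}x_B$; both factors are $1$ at
  -- $x=g$.
  have e : (fun x : G => g⁻¹ * x) = fun x => ((F.right g : G)⁻¹ *
      ((F.left g : G)⁻¹ * (F.left x : G)) * ((F.right g : G)⁻¹)⁻¹) *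
      ((F.right g : G)⁻¹ * (F.right x : G)) := by
    funext x
    conv_lhs => rw [← F.left_mul_right g, ← F.left_mul_right x]
    group
  have h3 : leftMC g = dM 𝓘(ℝ, E) 𝓘(ℝ, E) (fun x : G => g⁻¹ * x) g := rfl
  rw [e, dM_mul_of_eq_one (mdifferentiableAt_mul_const _ (mdifferentiableAt_const_mul _ hl')) hr'
    (by group) (by group), dM_conj_of_eq_one _ hl' (by group)] at h3
  rw [h3]
  exact congrArg₂ (fun a b => adGroup ((F.right g : G)⁻¹) a + b) h1.symm h2.symm

/-- $g_A x_A^{-1}$ is the inverse of the conjugate of $g_A^{-1}x_A$ by $g_A$. -/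
theorem leftMC_leftInv (g : G) (v : E) :
    leftMC (F.leftInv g : G) (dM 𝓘(ℝ, E) 𝓘(ℝ, E) (fun x => (F.leftInv x : G)) g v) =
      -adGroup (F.left g : G) (leftMC (F.left g : G)
        (dM 𝓘(ℝ, E) 𝓘(ℝ, E) (fun x => (F.left x : G)) g v)) := by
  have hl : MDifferentiableAt 𝓘(ℝ, E) 𝓘(ℝ, E) (fun x => (F.left x : G)) g :=
    (F.contMDiff_coe_left.comp F.contMDiff_left).mdifferentiable (by simp) g
  have hi : MDifferentiableAt 𝓘(ℝ, E) 𝓘(ℝ, E) (fun x => (F.leftInv x : G)) g :=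
    (F.contMDiff_coe_left.comp F.contMDiff_leftInv).mdifferentiable (by simp) g
  have h1 := DFunLike.congr_fun (leftMC_comp hl) v
  have h2 := DFunLike.congr_fun (leftMC_comp hi) v
  have hl' := mdifferentiableAt_const_mul (F.left g : G)⁻¹ hl
  have e : (fun x => (F.leftInv g : G)⁻¹ * (F.leftInv x : G)) = fun x =>
      ((F.left g : G) * ((F.left g : G)⁻¹ * (F.left x : G)) * (F.left g : G)⁻¹)⁻¹ := by
    funext x
    simp only [leftInv, Subgroup.coe_inv]
    group
  rw [e, dM_inv_of_eq_one (mdifferentiableAt_mul_const _ (mdifferentiableAt_const_mul _ hl'))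
    (by group), dM_conj_of_eq_one _ hl' (by group)] at h2
  exact h2.trans (congrArg (fun a => -adGroup (F.left g : G) a) h1.symm)

/-- With $\tau$ the covector over $g$, $\sigma(\lambda_g)=\tau(\mathrm{Ad}_{g_B}\lambda_g)$, and by
`leftMC_eq` the argument is $\xi+\mathrm{Ad}_{g_B}\zeta$ with $\xi\in\mathfrak a$,
$\zeta\in\mathfrak b$ the logarithmic derivatives of the factors. On $\mathfrak a$ the covector
$\tau$ is $g_A^{-1}\cdot\mu$ and on $\mathfrak b$ it is $g_B\cdot\nu$, which leaves
$\mu(\mathrm{Ad}_{g_A}\xi)+\nu(\zeta)$. The sign of the first term comes from inverting $g_A$. -/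
theorem pullbackForm_canonicalOneForm :
    pullbackForm 𝓘(ℝ, E) (cotangentModel E) (fun g => (g, F.levelSection μ ν g))
        (canonicalOneForm E G) =
      -pullbackForm 𝓘(ℝ, E) 𝓘(ℝ, E) (fun g => (F.leftInv g : G)) (leftInvForm G μ) +
        pullbackForm 𝓘(ℝ, E) 𝓘(ℝ, E) (fun g => (F.right g : G)) (leftInvForm G ν) := by
  refine form_ext fun g => ContinuousAlternatingMap.ext fun t => ?_
  rw [flat_pullbackForm_canonicalOneForm (f := fun g : G => g) mdifferentiableAt_id
    (F.contMDiff_levelSection.mdifferentiable (by simp) g), dM_id]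
  set v := t 0
  change F.levelSection μ ν g (leftMC g v) =
    -μ (leftMC (F.leftInv g : G) (dM 𝓘(ℝ, E) 𝓘(ℝ, E) (fun x => (F.leftInv x : G)) g v)) +
      ν (leftMC (F.right g : G) (dM 𝓘(ℝ, E) 𝓘(ℝ, E) (fun x => (F.right x : G)) g v))
  have hcA : leftMC (F.left g : G) (dM 𝓘(ℝ, E) 𝓘(ℝ, E) (fun x => (F.left x : G)) g v) ∈
      lieOfSubgroup E EA A := by
    rw [dM_comp_apply (J := 𝓘(ℝ, EA)) (g := (Subtype.val : A → G)) (f := F.left)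
      (F.contMDiff_coe_left.mdifferentiable (by simp) _)
      (F.contMDiff_left.mdifferentiable (by simp) _)]
    exact leftMC_incl_mem F.contMDiff_coe_left _ _
  have hcB : leftMC (F.right g : G) (dM 𝓘(ℝ, E) 𝓘(ℝ, E) (fun x => (F.right x : G)) g v) ∈
      lieOfSubgroup E EB B := by
    rw [dM_comp_apply (J := 𝓘(ℝ, EB)) (g := (Subtype.val : B → G)) (f := F.right)
      (F.contMDiff_coe_right.mdifferentiable (by simp) _)
      (F.contMDiff_right.mdifferentiable (by simp) _)]
    exact leftMC_incl_mem F.contMDiff_coe_right _ _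
  rw [leftMC_leftInv, leftMC_eq F]
  set ξ := leftMC (F.left g : G) (dM 𝓘(ℝ, E) 𝓘(ℝ, E) (fun x => (F.left x : G)) g v)
  set ζ := leftMC (F.right g : G) (dM 𝓘(ℝ, E) 𝓘(ℝ, E) (fun x => (F.right x : G)) g v)
  have hA : F.levelCovector μ ν g ξ = μ (adGroup (F.left g : G) ξ) := by
    have h := DFunLike.congr_fun (F.levelCovector_comp_projA (μ := μ) (ν := ν) g) ξ
    rw [projCoAd_apply, Subgroup.coe_inv, inv_inv, F.projA_of_mem hcA] at h
    rw [← h, ContinuousLinearMap.comp_apply, F.projA_of_mem hcA]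
  have hB : F.levelCovector μ ν g (adGroup (F.right g : G) ζ) = ν ζ := by
    have hm := adGroup_mem F.contMDiff_coe_right (F.right g) hcB
    have h := DFunLike.congr_fun (F.levelCovector_comp_projB (μ := μ) (ν := ν) g)
      (adGroup (F.right g : G) ζ)
    rw [projCoAd_apply, ContinuousLinearMap.comp_apply, F.projB_of_mem hm,
      adGroup_inv_apply] at h
    exact h
  rw [map_neg, neg_neg, map_add, ← hA, ← hB]
  change F.levelCovector μ ν g (adGroup (F.right g : G) (adGroup (F.right g : G)⁻¹ ξ)) + _ = _
  rw [adGroup_apply_inv]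
  rfl

/-- The restriction of the canonical symplectic form to the level set, in terms of the forms pulled
back from the orbits to the factors. -/
theorem pullbackForm_canonicalForm :
    pullbackForm 𝓘(ℝ, E) (cotangentModel E) (fun g => (g, F.levelSection μ ν g))
        (canonicalForm E G) =
      pullbackForm 𝓘(ℝ, E) 𝓘(ℝ, EA) F.leftInv (orbitPullback EA A μ) -
        pullbackForm 𝓘(ℝ, E) 𝓘(ℝ, EB) F.right (orbitPullback EB B ν) := by
  have hi : ContMDiff 𝓘(ℝ, E) (cotangentModel E) ∞ (fun g => (g, F.levelSection μ ν g)) :=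
    contMDiff_id.prodMk F.contMDiff_levelSection
  have hA := F.contMDiff_coe_left.comp F.contMDiff_leftInv
  have hB := F.contMDiff_coe_right.comp F.contMDiff_right
  have hsA := (isSmoothForm_leftInvForm (G := G) μ).pullbackForm_one hA
  have hsB := (isSmoothForm_leftInvForm (G := G) ν).pullbackForm_one hB
  rw [canonicalForm, ← extDerivForm_pullbackForm hi isSmoothForm_canonicalOneForm,
    F.pullbackForm_canonicalOneForm]
  refine (extDerivForm_add hsA.neg hsB).trans ?_
  rw [extDerivForm_neg, extDerivForm_pullbackForm hA (isSmoothForm_leftInvForm μ),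
    extDerivForm_pullbackForm hB (isSmoothForm_leftInvForm ν), orbitPullback, orbitPullback,
    pullbackForm_neg, pullbackForm_neg, sub_neg_eq_add]
  refine congrArg₂ (· + ·) (congrArg _ ?_) ?_
  · exact pullbackForm_comp (g := (Subtype.val : A → G)) (f := F.leftInv)
      (F.contMDiff_coe_left.mdifferentiable (by simp))
      (F.contMDiff_leftInv.mdifferentiable (by simp)) _
  · exact pullbackForm_comp (g := (Subtype.val : B → G)) (f := F.right)
      (F.contMDiff_coe_right.mdifferentiable (by simp))
      (F.contMDiff_right.mdifferentiable (by simp)) _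

/-- It is a diffeomorphism with inverse $(a,b)\mapsto a^{-1}b$. -/
theorem isSmoothSubmersion_leftInv_right :
    IsSmoothSubmersion 𝓘(ℝ, E) (𝓘(ℝ, EA).prod 𝓘(ℝ, EB)) (fun g => (F.leftInv g, F.right g)) := by
  have hinv : ContMDiff (𝓘(ℝ, EA).prod 𝓘(ℝ, EB)) 𝓘(ℝ, E) ∞
      (fun p : A × B => F.equiv (p.1⁻¹, p.2)) :=
    F.equiv.contMDiff.comp
      (((contMDiff_inv 𝓘(ℝ, EA) ∞).comp contMDiff_fst).prodMk contMDiff_snd)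
  refine isSmoothSubmersion_of_inverse hinv (F.contMDiff_leftInv.prodMk F.contMDiff_right)
    (fun g => ?_) (fun p => ?_)
  · change F.equiv ((F.left g)⁻¹⁻¹, F.right g) = g
    rw [inv_inv, F.equiv_apply, F.left_mul_right]
  · change ((F.left (F.equiv (p.1⁻¹, p.2)))⁻¹, F.right (F.equiv (p.1⁻¹, p.2))) = p
    rw [F.equiv_apply, F.left_mul, F.right_mul, inv_inv]

end Factorization

end

/-! ### Assembly of the reduction theorem -/

theorem mainTheorem1 {E EA EB : Type*}
    [NormedAddCommGroup E] [NormedSpace ℝ E] [FiniteDimensional ℝ E]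
    [NormedAddCommGroup EA] [NormedSpace ℝ EA] [FiniteDimensional ℝ EA]
    [NormedAddCommGroup EB] [NormedSpace ℝ EB] [FiniteDimensional ℝ EB]
    {G : Type*} [TopologicalSpace G] [T2Space G] [SecondCountableTopology G]
    [ChartedSpace E G] [Group G] [LieGroup 𝓘(ℝ, E) ∞ G]
    (A B : Subgroup G)
    [ChartedSpace EA A] [LieGroup 𝓘(ℝ, EA) ∞ A]
    [ChartedSpace EB B] [LieGroup 𝓘(ℝ, EB) ∞ B]
    (F : Factorization E EA EB A B)
    (μ ν : LieDual E)
    (hμ : ∀ y ∈ lieOfSubgroup E EB B, μ y = 0)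
    (hν : ∀ x ∈ lieOfSubgroup E EA A, ν x = 0) :
    -- the second expression for the map `M_{μν}`
    (∀ p : F.levelSet μ ν,
      ((F.toOrbits μ ν p).1 : LieDual E) = projCoAd F.projA (F.right p.1.1 : G) p.1.2 ∧
      ((F.toOrbits μ ν p).2 : LieDual E) = projCoAd F.projB (F.right p.1.1 : G) p.1.2) ∧
    ∃ (sL : SmoothStructure (F.levelSet μ ν))
      (sA : SmoothStructure (projOrbit F.projA A μ))
      (sB : SmoothStructure (projOrbit F.projB B ν))
      (sR : SmoothStructure (F.ReducedSpace μ ν))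
      (ΩA : DiffForm (𝓡 sA.dim) sA.Carrier 2)
      (ΩB : DiffForm (𝓡 sB.dim) sB.Carrier 2)
      (ΩR : DiffForm (𝓡 sR.dim) sR.Carrier 2),
      -- `Λ_{μν}` is an embedded submanifold of `T^* G`
      (Topology.IsEmbedding (Factorization.levelIncl sL) ∧
        IsSmoothImmersion (𝓡 sL.dim) (cotangentModel E) (Factorization.levelIncl sL)) ∧
      -- the orbits with their Kirillov-Kostant forms are symplectic manifolds
      (IsOrbitStructure EA sA ∧ IsKirillovKostant EA sA ΩA ∧ IsSymplecticForm (𝓡 sA.dim) ΩA) ∧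
      (IsOrbitStructure EB sB ∧ IsKirillovKostant EB sB ΩB ∧ IsSymplecticForm (𝓡 sB.dim) ΩB) ∧
      -- `i^* ω = M^* (ω_μ - ω_ν)`
      ContMDiff (𝓡 sL.dim) ((𝓡 sA.dim).prod (𝓡 sB.dim)) ∞ (Factorization.mapM sL sA sB) ∧
      pullbackForm (𝓡 sL.dim) (cotangentModel E) (Factorization.levelIncl sL)
          (canonicalForm E G) =
        pullbackForm (𝓡 sL.dim) ((𝓡 sA.dim).prod (𝓡 sB.dim)) (Factorization.mapM sL sA sB)
          (productDiffForm (𝓡 sA.dim) (𝓡 sB.dim) ΩA ΩB) ∧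
      -- the reduced space with its reduced form is a symplectic manifold
      IsSmoothSubmersion (𝓡 sL.dim) (𝓡 sR.dim) (Factorization.quotientMap sL sR) ∧
      IsSymplecticForm (𝓡 sR.dim) ΩR ∧
      pullbackForm (𝓡 sL.dim) (𝓡 sR.dim) (Factorization.quotientMap sL sR) ΩR =
        pullbackForm (𝓡 sL.dim) (cotangentModel E) (Factorization.levelIncl sL)
          (canonicalForm E G) ∧
      -- `M` induces a symplectomorphism of the reduced space with the product of the orbits
      ∃ Ψ : sR.Carrier ≃ₘ^∞⟮𝓡 sR.dim, (𝓡 sA.dim).prod (𝓡 sB.dim)⟯ (sA.Carrier × sB.Carrier),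
        (∀ p : sL.Carrier, Ψ (Factorization.quotientMap sL sR p) = Factorization.mapM sL sA sB p) ∧
        pullbackForm (𝓡 sR.dim) ((𝓡 sA.dim).prod (𝓡 sB.dim)) Ψ
          (productDiffForm (𝓡 sA.dim) (𝓡 sB.dim) ΩA ΩB) = ΩR := by
  have : SecondCountableTopology A := Topology.IsInducing.subtypeVal.secondCountableTopology
  have : SecondCountableTopology B := Topology.IsInducing.subtypeVal.secondCountableTopology
  obtain ⟨sA, ΩA, hsA, hKA, hSA, hpA⟩ := exists_orbit_symplectic (μ := μ) F.contMDiff_coe_left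
    (fun _ => F.projA_of_mem) F.projA_mem
  obtain ⟨sB, ΩB, hsB, hKB, hSB, hpB⟩ := exists_orbit_symplectic (μ := ν) F.contMDiff_coe_right
    (fun _ => F.projB_of_mem) F.projB_mem
  obtain ⟨sL, Φ, hΦ⟩ := exists_smoothStructure_of_equiv (I := 𝓘(ℝ, E)) (F.levelEquiv hμ hν)
  let eR : F.ReducedSpace μ ν ≃ sA.Carrier × sB.Carrier := F.reducedEquiv hμ hν
  obtain ⟨sR, Ψ, hΨ⟩ := exists_smoothStructure_of_equiv (I := (𝓡 sA.dim).prod (𝓡 sB.dim)) eR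
  let ΩP := productDiffForm (𝓡 sA.dim) (𝓡 sB.dim) ΩA ΩB
  let φA : A → sA.Carrier := fun a => sA.equip ⟨projCoAd F.projA (a : G) μ, a, rfl⟩
  let φB : B → sB.Carrier := fun b => sB.equip ⟨projCoAd F.projB (b : G) ν, b, rfl⟩
  -- `m` and `i` are the map to the orbits and the inclusion of the level set, read on `G` through
  -- the diffeomorphism `Φ`.
  let m : G → sA.Carrier × sB.Carrier := fun g => (φA (F.leftInv g), φB (F.right g))
  let i : G → G × LieDual E := fun g => (g, F.levelSection μ ν g)
  have hφA : IsSmoothSubmersion 𝓘(ℝ, EA) (𝓡 sA.dim) φA := hsA.1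
  have hφB : IsSmoothSubmersion 𝓘(ℝ, EB) (𝓡 sB.dim) φB := hsB.1
  have hm : IsSmoothSubmersion 𝓘(ℝ, E) ((𝓡 sA.dim).prod (𝓡 sB.dim)) m :=
    IsSmoothSubmersion.comp (g := fun p : A × B => (φA p.1, φB p.2))
      (f := fun g => (F.leftInv g, F.right g)) (hφA.prodMap hφB)
      F.isSmoothSubmersion_leftInv_right
  have hi : ContMDiff 𝓘(ℝ, E) (cotangentModel E) ∞ i :=
    contMDiff_id.prodMk F.contMDiff_levelSection
  have hΦs : IsSmoothSubmersion (𝓡 sL.dim) 𝓘(ℝ, E) Φ :=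
    isSmoothSubmersion_of_inverse Φ.symm.contMDiff Φ.contMDiff Φ.symm_apply_apply
      Φ.apply_symm_apply
  have hΨs : IsSmoothSubmersion ((𝓡 sA.dim).prod (𝓡 sB.dim)) (𝓡 sR.dim) Ψ.symm :=
    isSmoothSubmersion_of_inverse Ψ.contMDiff Ψ.symm.contMDiff Ψ.apply_symm_apply
      Ψ.symm_apply_apply
  have eL : Factorization.levelIncl sL = fun p => i (Φ p) := by
    funext p
    rw [hΦ]
    exact congrArg Subtype.val ((F.levelEquiv hμ hν).symm_apply_apply (sL.out p)).symm
  have eM : Factorization.mapM sL sA sB = fun p => m (Φ p) := by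
    funext p
    rw [hΦ]
    rfl
  have eΨ : ∀ p, Ψ (Factorization.quotientMap sL sR p) = Factorization.mapM sL sA sB p :=
    fun p => hΨ _
  have eQ : Factorization.quotientMap sL sR = fun p => Ψ.symm (m (Φ p)) := by
    funext p
    rw [← congrFun eM p, ← eΨ, Ψ.symm_apply_apply]
  have hmap : IsSmoothSubmersion (𝓡 sL.dim) ((𝓡 sA.dim).prod (𝓡 sB.dim))
      (Factorization.mapM sL sA sB) := by
    rw [eM]
    exact hm.comp hΦs
  have hquot : IsSmoothSubmersion (𝓡 sL.dim) (𝓡 sR.dim) (Factorization.quotientMap sL sR) := by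
    rw [eQ]
    exact hΨs.comp (hm.comp hΦs)
  have hincl : ContMDiff (𝓡 sL.dim) (cotangentModel E) ∞ (Factorization.levelIncl sL) := by
    rw [eL]
    exact hi.comp hΦs.1
  -- The level set is a graph, so projection to `G` gives a smooth global left inverse of the
  -- inclusion. This yields the embedding and the immersion at once.
  let r : G × LieDual E → sL.Carrier := fun p => Φ.symm p.1
  have hr : ContMDiff (cotangentModel E) (𝓡 sL.dim) ∞ r := Φ.symm.contMDiff.comp contMDiff_fst
  have hri : Function.LeftInverse r (Factorization.levelIncl sL) := by
    intro p
    rw [eL]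
    exact Φ.symm_apply_apply p
  have himm : IsSmoothImmersion (𝓡 sL.dim) (cotangentModel E) (Factorization.levelIncl sL) :=
    isSmoothImmersion_of_leftInverse hr hincl hri
  have hemb : Topology.IsEmbedding (Factorization.levelIncl sL) :=
    Topology.IsEmbedding.of_leftInverse hri hr.continuous hincl.continuous
  have hforms : pullbackForm 𝓘(ℝ, E) (cotangentModel E) i (canonicalForm E G) =
      pullbackForm 𝓘(ℝ, E) ((𝓡 sA.dim).prod (𝓡 sB.dim)) m ΩP := by
    have h1 := pullbackForm_productDiffForm (K := 𝓘(ℝ, E)) (f := fun g => φA (F.leftInv g))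
      (g := fun g => φB (F.right g))
      ((hφA.1.comp F.contMDiff_leftInv).mdifferentiable (by simp))
      ((hφB.1.comp F.contMDiff_right).mdifferentiable (by simp)) ΩA ΩB
    rw [pullbackForm_comp (g := φA) (f := F.leftInv) (hφA.1.mdifferentiable (by simp))
      (F.contMDiff_leftInv.mdifferentiable (by simp)), hpA,
      pullbackForm_comp (g := φB) (f := F.right) (hφB.1.mdifferentiable (by simp))
      (F.contMDiff_right.mdifferentiable (by simp)), hpB] at h1
    exact F.pullbackForm_canonicalForm.trans h1.symm
  have hL : pullbackForm (𝓡 sL.dim) (cotangentModel E) (Factorization.levelIncl sL)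
      (canonicalForm E G) = pullbackForm (𝓡 sL.dim) ((𝓡 sA.dim).prod (𝓡 sB.dim))
        (Factorization.mapM sL sA sB) ΩP := by
    rw [eL, eM, pullbackForm_comp (g := i) (f := Φ) (hi.mdifferentiable (by simp))
      (hΦs.1.mdifferentiable (by simp)), hforms]
    exact (pullbackForm_comp (g := m) (f := Φ) (hm.1.mdifferentiable (by simp))
      (hΦs.1.mdifferentiable (by simp)) ΩP).symm
  -- The reduced form is defined as the pullback of the product form by `Ψ`; that it reduces the
  -- canonical form follows from `hL`, because `Ψ` composed with the quotient map is `mapM`.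
  have hR : pullbackForm (𝓡 sL.dim) (𝓡 sR.dim) (Factorization.quotientMap sL sR)
      (pullbackForm (𝓡 sR.dim) ((𝓡 sA.dim).prod (𝓡 sB.dim)) Ψ ΩP) =
      pullbackForm (𝓡 sL.dim) (cotangentModel E) (Factorization.levelIncl sL)
        (canonicalForm E G) := by
    rw [hL, ← pullbackForm_comp (g := Ψ) (f := Factorization.quotientMap sL sR)
      (Ψ.contMDiff.mdifferentiable (by simp)) (hquot.1.mdifferentiable (by simp))]
    congr 1
    exact funext eΨ
  have hqsurj : Function.Surjective (Factorization.quotientMap sL sR) := by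
    rintro ⟨p⟩
    exact ⟨p, rfl⟩
  -- The restriction of the canonical form to the level set is exact, so smoothness and closedness
  -- descend along the quotient submersion.
  have hclosed := hquot.closed_of_pullback_exact hqsurj
    (isSmoothForm_canonicalOneForm.pullbackForm_one hincl)
    (hR.trans (extDerivForm_pullbackForm hincl isSmoothForm_canonicalOneForm).symm)
  have hnondeg := Ψ.pullbackForm_nondegenerate (productDiffForm_nondegenerate hSA hSB)
  exact ⟨F.toOrbits_eq hμ hν, sL, sA, sB, sR, ΩA, ΩB, _, ⟨hemb, himm⟩, ⟨hsA, hKA, hSA⟩,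
    ⟨hsB, hKB, hSB⟩, hmap.1, hL, hquot, ⟨hclosed.1, hclosed.2, hnondeg⟩, hR, Ψ, eΨ, rfl⟩
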